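/- Manifolds are smooth, finite-dimensional, Hausdorff, second countable and without boundary. A \emph{geometric Clifford family} $(\mathscr E\to X\xrightarrow{\pi}S, g^{X/S}, H,\nabla^{\mathscr E})$ consists of: a smooth fibre bundle $\pi:X\to S$ with (non-empty) compact even-dimensional fibres; a smooth distribution $H\subset TX$ such that $\pi_*:H_x\to T_{\pi(x)}S$ is an isomorphism for every $x$; a smooth metric $g^{X/S}$ on $T(X/S):=\ker\pi_*$; a smooth $\mathbb Z/2$-graded complex vector bundle $\mathscr E\to X$ of finite rank with a smooth action of the Clifford algebra bundle $\mathrm{Cl}(T(X/S),g^{X/S})$ (with the convention $v^2=-g^{X/S}(v,v)$) in which vertical vectors act by odd complex linear maps; and a connection $\nabla^{\mathscr E}$ on the complex vector bundle $\mathscr E$ which is a \emph{Clifford connection}, i.e. $$\nabla^{\mathscr E}(v\cdot\sigma)=\nabla^{X/S}v\cdot\sigma+v\cdot\nabla^{\mathscr E}\sigma$$ for all smooth sections $v$ of $T(X/S)$ and $\sigma$ of $\mathscr E$. Here $\nabla^{X/S}=P\circ\nabla^{g^X}\circ\iota$ is the vertical connection: $\iota:T(X/S)\to TX$ is the inclusion,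 $P:TX\to T(X/S)$ is the projection along $H$, and $\nabla^{g^X}$ is the Levi-Civita connection of $g^X=g^{X/S}\oplus\pi^*g^S$ on $TX=T(X/S)\oplus H$ for some metric $g^S$ on $TS$ (the result does not depend on $g^S$). \textbf{Proposition.} Let $G$ be a Lie group and let $(\mathscr E\to X\xrightarrow{\pi}S,g^{X/S},H,\nabla^{\mathscr E})$ be a geometric Clifford family on which $G$ acts smoothly: $\pi$ is equivariant, $G$ acts on $\mathscr E$ over $X$ by fibrewise complex linear maps, and the action preserves $H$, $g^{X/S}$, the grading, the Clifford multiplication and $\nabla^{\mathscr E}$. Let $r:Q\to M$ be a principal $G$-bundle with a connection, given by a $G$-invariant smooth horizontal distribution $V\subset TQ$. For $Y=X,S,\mathscr E$ let $Y_Q=Q\times_G Y$, the quotient manifold of $Q\times Y$ by $(a g,y)\sim(a,g y)$, and let $q:Q\times Y\to Y_Q$ be the quotient map. Then the associated bundles $\mathscr E_Q\to X_Q\xrightarrow{\pi_Q}S_Q$ exist, with $X_Q$ and $S_Q$ smooth manifolds and $\mathscr E_Q\to X_Q$ a smooth complex vector bundle such that $q$ is smooth, is a submersion for $Y=X,S$,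 and induces complex linear isomorphisms $\mathscr E_x\cong(\mathscr E_Q)_{q(a,x)}$. For any such realization the following data on it are well defined: \begin{itemize} \item the distribution $H_Q=q_*(V\oplus H)$; \item the metric $g^{X/S}_Q$ on $T(X_Q/S_Q)$, and the grading and Clifford multiplication on $\mathscr E_Q$, descended fibrewise from $g^{X/S}$ and from $\mathscr E$ (so that $q_*:T_x(X/S)\to T_{q(a,x)}(X_Q/S_Q)$ is an isometry and $\mathscr E_x\cong(\mathscr E_Q)_{q(a,x)}$ is compatible with it); \item the connection $\nabla^{\mathscr E}_Q$ on $\mathscr E_Q$ whose derivative of a section $\sigma$ along $q_*(v,w)$, for $v\in V_a$ and $w\in T_xX$, is the image under $q$ of $(p^*\nabla^{\mathscr E})_{(v,w)}\tilde\sigma$, where $\tilde\sigma$ is the lift of $\sigma$ to a section of $p^*\mathscr E$ over $Q\times X$ and $p:Q\times X\to X$ is the projection. \end{itemize} With these data, $(\mathscr E_Q\to X_Q\to S_Q,g^{X/S}_Q,H_Q,\nabla^{\mathscr E}_Q)$ is a geometric Clifford family, and if $\nabla^{\mathscr E}$ preserves the grading, so does $\nabla^{\mathscr E}_Q$. Moreover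 the vertical connection $\nabla^{X_Q/S_Q}$ of this family is the connection $\nabla^{X/S}_Q$ induced from $\nabla^{X/S}$ by the same rule as $\nabla^{\mathscr E}_Q$ (with $p^*T(X/S)$ in place of $p^*\mathscr E$), and $\nabla^{\mathscr E}_Q$ is a Clifford connection with respect to it. -/

import Mathlib

open scoped Manifold ContDiff Bundle
open Bundle

universe u

noncomputable section

namespace CliffordFamily

/-- A smooth manifold: finite-dimensional, without boundary, Hausdorff and second countable. -/
structure SmoothMfd : Type (u + 1) where
  carrier : Type u
  model : Type u
  [top : TopologicalSpace carrier]
  [t2 : T2Space carrier]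
  [secondCountable : SecondCountableTopology carrier]
  [normed : NormedAddCommGroup model]
  [space : NormedSpace ℝ model]
  [finiteDim : FiniteDimensional ℝ model]
  [charted : ChartedSpace model carrier]
  [smooth : IsManifold 𝓘(ℝ, model) ∞ carrier]

instance : CoeSort SmoothMfd.{u} (Type u) := ⟨SmoothMfd.carrier⟩

attribute [instance] SmoothMfd.top SmoothMfd.t2 SmoothMfd.secondCountable SmoothMfd.normed
  SmoothMfd.space SmoothMfd.finiteDim SmoothMfd.charted SmoothMfd.smooth

/-- The model with corners of a smooth manifold. -/
abbrev SmoothMfd.I (X : SmoothMfd.{u}) : ModelWithCorners ℝ X.model X.model := 𝓘(ℝ, X.model)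

/-- The tangent space `T_x X`. -/
abbrev SmoothMfd.T (X : SmoothMfd.{u}) (x : X) : Type u := TangentSpace X.I x

/-- A vector field is smooth on the set `U`. -/
def SmoothFieldOn (X : SmoothMfd.{u}) (Y : ∀ x : X, X.T x) (U : Set X) : Prop :=
  ContMDiffOn X.I (X.I.prod 𝓘(ℝ, X.model)) ∞
    (fun x => TotalSpace.mk' X.model (E := fun x : X => X.T x) x (Y x)) U

/-- A smooth complex vector bundle of finite rank over a smooth manifold. Its transition functions
are fibrewise complex linear (`complexBundle`) and smooth in the real sense (`smooth`). -/
structure ComplexBundle (X : SmoothMfd.{u}) : Type (u + 1) where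
  F : Type u
  fib : X → Type u
  [normed : NormedAddCommGroup F]
  [space : NormedSpace ℂ F]
  [finiteDim : FiniteDimensional ℂ F]
  [topTotal : TopologicalSpace (TotalSpace F fib)]
  [addCommGroup : ∀ x, AddCommGroup (fib x)]
  [module : ∀ x, Module ℂ (fib x)]
  [top : ∀ x, TopologicalSpace (fib x)]
  [topAdd : ∀ x, IsTopologicalAddGroup (fib x)]
  [contSMul : ∀ x, ContinuousSMul ℝ (fib x)]
  [fiberBundle : FiberBundle F fib]
  [complexBundle : VectorBundle ℂ F fib]
  [realBundle : VectorBundle ℝ F fib]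
  [smooth : ContMDiffVectorBundle ∞ F fib X.I]

attribute [instance] ComplexBundle.normed ComplexBundle.space ComplexBundle.finiteDim
  ComplexBundle.topTotal ComplexBundle.addCommGroup ComplexBundle.module ComplexBundle.top
  ComplexBundle.topAdd ComplexBundle.contSMul ComplexBundle.fiberBundle
  ComplexBundle.complexBundle ComplexBundle.realBundle ComplexBundle.smooth

/-- The total space of a complex vector bundle. -/
abbrev ComplexBundle.Tot {X : SmoothMfd.{u}} (E : ComplexBundle X) : Type u :=
  TotalSpace E.F E.fib

/-- The model with corners of the total space. -/
abbrev ComplexBundle.ITot {X : SmoothMfd.{u}} (E : ComplexBundle X) :=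
  X.I.prod 𝓘(ℝ, E.F)

/-- A section of a complex vector bundle is smooth on the set `U`. -/
def ComplexBundle.SmoothOn {X : SmoothMfd.{u}} (E : ComplexBundle X) (σ : ∀ x, E.fib x)
    (U : Set X) : Prop :=
  ContMDiffOn X.I E.ITot ∞ (fun x => TotalSpace.mk' E.F x (σ x)) U

/-- The derivative at `a`, in the direction `v`, of a map `f` from a manifold into one fixed fibre
`E_x`, computed through a linear isomorphism of `E_x` with the typical fibre. -/
def ComplexBundle.fiberDeriv {X : SmoothMfd.{u}} (E : ComplexBundle X) (A : SmoothMfd.{u}) (x : X)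
    (f : A → E.fib x) (a : A) (v : A.T a) : E.fib x :=
  let L : E.fib x ≃L[ℝ] E.F :=
    (trivializationAt E.F E.fib x).continuousLinearEquivAt ℝ x
      (FiberBundle.mem_baseSet_trivializationAt' x)
  L.symm (mvfderiv A.I (fun b => L (f b)) a v)

/-- The derivative at `a`, in the direction `v`, of a map from a manifold into one fixed tangent
space `T_x X`. -/
def tangentDeriv {X : SmoothMfd.{u}} (A : SmoothMfd.{u}) (x : X) (f : A → X.T x) (a : A)
    (v : A.T a) : X.T x :=
  mvfderiv A.I (F := X.model) f a v

/-! ### Families and horizontal distributions -/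

section Distribution

variable {X S : SmoothMfd.{u}}

/-- The vertical tangent space `T_x(X/S) = ker (pr_* : T_x X → T_{pr x} S)`. -/
def vert (pr : X → S) (x : X) : Submodule ℝ (X.T x) :=
  LinearMap.ker (mfderiv X.I S.I pr x).toLinearMap

/-- Sections of `T(X/S)`. -/
abbrev VertField (pr : X → S) := ∀ x : X, vert pr x

/-- A section of `T(X/S)` is smooth on the set `U`. -/
def VertField.SmoothOn {pr : X → S} (v : VertField pr) (U : Set X) : Prop :=
  SmoothFieldOn X (fun x => (v x : X.T x)) U

/-- `pr_*` restricts to isomorphisms `H_x ≃ T_{pr x} S`. -/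
def IsHorizontal (pr : X → S) (H : ∀ x : X, Submodule ℝ (X.T x)) : Prop :=
  ∀ x, Function.Bijective (fun h : H x => mfderiv X.I S.I pr x (h : X.T x))

theorem IsHorizontal.isCompl {pr : X → S} {H : ∀ x : X, Submodule ℝ (X.T x)}
    (h : IsHorizontal pr H) (x : X) : IsCompl (vert pr x) (H x) := by
  constructor
  · rw [Submodule.disjoint_def]
    intro w hw hw'
    have h1 : (⟨w, hw'⟩ : H x) = 0 := (h x).1 (by
      have h2 : mfderiv X.I S.I pr x w = 0 := hw
      simpa using h2)
    exact congrArg Subtype.val h1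
  · rw [codisjoint_iff, Submodule.eq_top_iff']
    intro w
    obtain ⟨k, hk⟩ := (h x).2 (mfderiv X.I S.I pr x w)
    have h1 : w - (k : X.T x) ∈ vert pr x := by
      change mfderiv X.I S.I pr x (w - (k : X.T x)) = 0
      rw [map_sub, sub_eq_zero]
      exact hk.symm
    have h2 := Submodule.add_mem_sup h1 k.2
    simpa using h2

/-- The projection `P : T_x X → T_x(X/S)` along the horizontal distribution. -/
def vertProj {pr : X → S} {H : ∀ x : X, Submodule ℝ (X.T x)} (h : IsHorizontal pr H) (x : X) :
    X.T x →ₗ[ℝ] vert pr x :=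
  Submodule.projectionOnto (vert pr x) (H x) (h.isCompl x)

/-- `H` is a smooth horizontal distribution for `pr`: it is fibrewise isomorphic to `TS`, and it is
a smooth subbundle, that is, the projection along it maps smooth fields to smooth fields. -/
structure IsHorizontalDistribution (pr : X → S) (H : ∀ x : X, Submodule ℝ (X.T x)) : Prop where
  horizontal : IsHorizontal pr H
  smooth : ∀ (U : Set X) (Y : ∀ x : X, X.T x), IsOpen U → SmoothFieldOn X Y U →
    VertField.SmoothOn (fun x => vertProj horizontal x (Y x)) U

/-- A smooth, locally trivial fibre bundle with non-empty compact even-dimensional fibres. -/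
structure IsCompactEvenFiberBundle (pr : X → S) : Prop where
  smooth : ContMDiff X.I S.I ∞ pr
  surjective : Function.Surjective pr
  locallyTrivial : ∀ s : S, ∃ Z : SmoothMfd.{u}, CompactSpace Z ∧ Even (Module.finrank ℝ Z.model) ∧
    ∃ e : Trivialization Z pr, s ∈ e.baseSet ∧
      ContMDiffOn X.I (S.I.prod Z.I) ∞ e e.source ∧
      ContMDiffOn (S.I.prod Z.I) X.I ∞ e.toOpenPartialHomeomorph.symm e.target

/-! ### The vertical connection -/

/-- `D` is the Levi-Civita connection of the Riemannian metric `m`: torsion-free and metric. -/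
def IsLeviCivita (X : SmoothMfd.{u}) (m : ∀ x : X, X.T x → X.T x → ℝ)
    (D : CovariantDerivative X.I X.model (fun x : X => X.T x)) : Prop :=
  (∀ Y Z : ∀ x : X, X.T x, SmoothFieldOn X Y Set.univ → SmoothFieldOn X Z Set.univ → ∀ x,
    D Z x (Y x) - D Y x (Z x) = VectorField.mlieBracket X.I Y Z x) ∧
  (∀ Y Z : ∀ x : X, X.T x, SmoothFieldOn X Y Set.univ → SmoothFieldOn X Z Set.univ →
    ∀ (x : X) (w : X.T x),
      mvfderiv X.I (fun y => m y (Y y) (Z y)) x w = m x (D Y x w) (Z x) + m x (Y x) (D Z x w))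

/-- The metric `g^X = g^{X/S} ⊕ pr^* g^S` on `TX = T(X/S) ⊕ H`. -/
def sumMetric {pr : X → S} {H : ∀ x : X, Submodule ℝ (X.T x)} (h : IsHorizontal pr H)
    (g : ∀ x : X, LinearMap.BilinForm ℝ (vert pr x))
    (gS : ContMDiffRiemannianMetric S.I ∞ S.model (fun s : S => S.T s)) (x : X) (v w : X.T x) : ℝ :=
  g x (vertProj h x v) (vertProj h x w) +
    gS.inner (pr x) (mfderiv X.I S.I pr x v) (mfderiv X.I S.I pr x w)

/-- `N` is the vertical connection `∇^{X/S} = P ∘ ∇^{g^X} ∘ ι`, for a metric `g^S` on `TS` and the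
Levi-Civita connection of `g^{X/S} ⊕ pr^* g^S`. Here `N v x w` is `(∇^{X/S}_w v)(x)`; its values on
sections that are not smooth are irrelevant. -/
def IsVerticalConnection {pr : X → S} {H : ∀ x : X, Submodule ℝ (X.T x)} (h : IsHorizontal pr H)
    (g : ∀ x : X, LinearMap.BilinForm ℝ (vert pr x))
    (N : VertField pr → ∀ x : X, X.T x → vert pr x) : Prop :=
  ∃ (gS : ContMDiffRiemannianMetric S.I ∞ S.model (fun s : S => S.T s))
    (D : CovariantDerivative X.I X.model (fun x : X => X.T x)),
    IsLeviCivita X (sumMetric h g gS) D ∧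
    ∀ v : VertField pr, v.SmoothOn Set.univ → ∀ (x : X) (w : X.T x),
      N v x w = vertProj h x (D (fun y => (v y : X.T y)) x w)

end Distribution

/-! ### Geometric Clifford families -/

/-- The bundles underlying a family: a map `pr : X → S` and a complex vector bundle `E → X`. -/
structure Tower : Type (u + 1) where
  X : SmoothMfd.{u}
  S : SmoothMfd.{u}
  pr : X → S
  E : ComplexBundle X

/-- The quadratic form `v ↦ -g(v, v)`; in its Clifford algebra `v * v = -g(v, v)`. -/
def cliffordForm {V : Type*} [AddCommGroup V] [Module ℝ V] (g : LinearMap.BilinForm ℝ V) :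
    QuadraticForm ℝ V :=
  -LinearMap.BilinMap.toQuadraticMap g

/-- The geometric data on a tower `E → X → S`: a horizontal distribution, a vertical metric, the
grading operator `ε` of `E` (equal to `±1` on `E^±`), the action of `Cl(T(X/S), g)` on `E`,
and a connection on `E`. -/
structure GeometricData (τ : Tower.{u}) where
  H : ∀ x : τ.X, Submodule ℝ (τ.X.T x)
  g : ∀ x : τ.X, LinearMap.BilinForm ℝ (vert τ.pr x)
  ε : ∀ x : τ.X, τ.E.fib x →ₗ[ℂ] τ.E.fib x
  c : ∀ x : τ.X, CliffordAlgebra (cliffordForm (g x)) →ₐ[ℝ] Module.End ℂ (τ.E.fib x)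
  nabla : CovariantDerivative τ.X.I τ.E.F τ.E.fib

namespace GeometricData

variable {τ : Tower.{u}} (𝒟 : GeometricData τ)

/-- Clifford multiplication `v · e` by a vertical vector. -/
def cmul (x : τ.X) (v : vert τ.pr x) (e : τ.E.fib x) : τ.E.fib x :=
  𝒟.c x (CliffordAlgebra.ι (cliffordForm (𝒟.g x)) v) e

/-- `(X → S, H, g^{X/S})` is a geometric family. -/
structure IsGeometricFamily : Prop where
  bundle : IsCompactEvenFiberBundle τ.pr
  distribution : IsHorizontalDistribution τ.pr 𝒟.H
  g_symm : ∀ x v w, 𝒟.g x v w = 𝒟.g x w v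
  g_pos : ∀ x v, v ≠ 0 → 0 < 𝒟.g x v v
  g_smooth : ∀ (U : Set τ.X) (v w : VertField τ.pr), IsOpen U → v.SmoothOn U → w.SmoothOn U →
    ContMDiffOn τ.X.I 𝓘(ℝ, ℝ) ∞ (fun x => 𝒟.g x (v x) (w x)) U

/-- `E` is a `ℤ/2`-graded module bundle over `Cl(T(X/S), g^{X/S})`. -/
structure IsGradedCliffordModule : Prop where
  ε_sq : ∀ x e, 𝒟.ε x (𝒟.ε x e) = e
  ε_smooth : ∀ (U : Set τ.X) (σ : ∀ x, τ.E.fib x), IsOpen U → τ.E.SmoothOn σ U →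
    τ.E.SmoothOn (fun x => 𝒟.ε x (σ x)) U
  odd : ∀ x v e, 𝒟.ε x (𝒟.cmul x v e) = -𝒟.cmul x v (𝒟.ε x e)
  cmul_smooth : ∀ (U : Set τ.X) (v : VertField τ.pr) (σ : ∀ x, τ.E.fib x), IsOpen U →
    v.SmoothOn U → τ.E.SmoothOn σ U → τ.E.SmoothOn (fun x => 𝒟.cmul x (v x) (σ x)) U

/-- The Leibniz rule `∇^E (v · σ) = N v · σ + v · ∇^E σ` with respect to a connection `N` on
`T(X/S)`. -/
def CliffordLeibniz (N : VertField τ.pr → ∀ x : τ.X, τ.X.T x → vert τ.pr x) : Prop :=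
  ∀ (v : VertField τ.pr) (σ : ∀ x, τ.E.fib x), v.SmoothOn Set.univ → τ.E.SmoothOn σ Set.univ →
    ∀ (x : τ.X) (w : τ.X.T x),
      𝒟.nabla (fun y => 𝒟.cmul y (v y) (σ y)) x w =
        𝒟.cmul x (N v x w) (σ x) + 𝒟.cmul x (v x) (𝒟.nabla σ x w)

/-- A geometric Clifford family. -/
structure IsGeometricCliffordFamily : Prop where
  family : 𝒟.IsGeometricFamily
  cliffordModule : 𝒟.IsGradedCliffordModule
  nabla_smooth : ContMDiffCovariantDerivativeOn τ.E.F ∞ 𝒟.nabla.toFun Set.univ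
  nabla_complex : ∀ σ : ∀ x, τ.E.fib x, τ.E.SmoothOn σ Set.univ → ∀ (x : τ.X) (w : τ.X.T x),
    𝒟.nabla (fun y => Complex.I • σ y) x w = Complex.I • 𝒟.nabla σ x w
  clifford : ∃ N, IsVerticalConnection family.distribution.horizontal 𝒟.g N ∧ 𝒟.CliffordLeibniz N

/-- The connection preserves the grading. -/
def PreservesGrading : Prop :=
  ∀ σ : ∀ x, τ.E.fib x, τ.E.SmoothOn σ Set.univ → ∀ (x : τ.X) (w : τ.X.T x),
    𝒟.nabla (fun y => 𝒟.ε y (σ y)) x w = 𝒟.ε x (𝒟.nabla σ x w)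

end GeometricData

/-! ### Group actions -/

section Action

variable {EG : Type*} [NormedAddCommGroup EG] [NormedSpace ℝ EG]
  (G : Type*) [TopologicalSpace G] [ChartedSpace EG G] [Group G]

/-- The lift of smooth `G`-actions on `X` and `S` to a tower `E → X → S`: `pr` is equivariant and
`G` acts on `E` over `X`, smoothly and by fibrewise complex linear maps. -/
structure TowerAction (τ : Tower.{u}) [MulAction G τ.X] [MulAction G τ.S] where
  pr_smul : ∀ (g : G) (x : τ.X), τ.pr (g • x) = g • τ.pr x
  ρ : ∀ (g : G) (x : τ.X), τ.E.fib x →ₗ[ℂ] τ.E.fib (g • x)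
  ρ_one : ∀ (x : τ.X) (e : τ.E.fib x),
    TotalSpace.mk' τ.E.F ((1 : G) • x) (ρ 1 x e) = TotalSpace.mk' τ.E.F x e
  ρ_mul : ∀ (g h : G) (x : τ.X) (e : τ.E.fib x),
    TotalSpace.mk' τ.E.F ((g * h) • x) (ρ (g * h) x e) =
      TotalSpace.mk' τ.E.F (g • h • x) (ρ g (h • x) (ρ h x e))
  ρ_smooth : ContMDiff (𝓘(ℝ, EG).prod τ.E.ITot) τ.E.ITot ∞
    (fun p : G × τ.E.Tot => TotalSpace.mk' τ.E.F (p.1 • p.2.proj) (ρ p.1 p.2.proj p.2.snd))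

variable {G}

/-- The differential `g_* : T_x X → T_{gx} X`. -/
def pushG {X : SmoothMfd.{u}} [MulAction G X] (g : G) (x : X) (w : X.T x) : X.T (g • x) :=
  mfderiv X.I X.I (fun y : X => g • y) x w

/-- The action preserves the geometric data: distribution, metric, grading, Clifford
multiplication and connection. -/
structure TowerAction.Preserves {τ : Tower.{u}} [MulAction G τ.X] [MulAction G τ.S]
    (α : TowerAction (EG := EG) G τ) (𝒟 : GeometricData τ) : Prop where
  H : ∀ (g : G) (x : τ.X) (w : τ.X.T x), w ∈ 𝒟.H x → pushG g x w ∈ 𝒟.H (g • x)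
  metric : ∀ (g : G) (x : τ.X) (v w : vert τ.pr x) (v' w' : vert τ.pr (g • x)),
    (v' : τ.X.T (g • x)) = pushG g x v → (w' : τ.X.T (g • x)) = pushG g x w →
      𝒟.g (g • x) v' w' = 𝒟.g x v w
  grading : ∀ (g : G) (x : τ.X) (e : τ.E.fib x), 𝒟.ε (g • x) (α.ρ g x e) = α.ρ g x (𝒟.ε x e)
  clifford : ∀ (g : G) (x : τ.X) (v : vert τ.pr x) (v' : vert τ.pr (g • x)) (e : τ.E.fib x),
    (v' : τ.X.T (g • x)) = pushG g x v →
      𝒟.cmul (g • x) v' (α.ρ g x e) = α.ρ g x (𝒟.cmul x v e)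
  nabla : ∀ (g : G) (σ σ' : ∀ x, τ.E.fib x), τ.E.SmoothOn σ Set.univ →
    τ.E.SmoothOn σ' Set.univ → (∀ x, σ' (g • x) = α.ρ g x (σ x)) →
      ∀ (x : τ.X) (w : τ.X.T x),
        𝒟.nabla σ' (g • x) (pushG g x w) = α.ρ g x (𝒟.nabla σ x w)

end Action

/-! ### Principal bundles with connection and associated bundles -/

section Principal

variable {EG : Type*} [NormedAddCommGroup EG] [NormedSpace ℝ EG]
  (G : Type*) [TopologicalSpace G] [ChartedSpace EG G] [Group G]

/-- A smooth principal `G`-bundle `r : Q → M`; the right action is `act q g = q · g`. -/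
structure PrincipalBundle : Type _ where
  Q : SmoothMfd.{u}
  M : SmoothMfd.{u}
  r : Q → M
  r_smooth : ContMDiff Q.I M.I ∞ r
  act : Q → G → Q
  act_one : ∀ q, act q 1 = q
  act_mul : ∀ q g h, act q (g * h) = act (act q g) h
  act_smooth : ContMDiff (Q.I.prod 𝓘(ℝ, EG)) Q.I ∞ (fun p : Q × G => act p.1 p.2)
  r_act : ∀ q g, r (act q g) = r q
  locallyTrivial : ∀ m : M, ∃ e : Trivialization G r, m ∈ e.baseSet ∧
    ContMDiffOn Q.I (M.I.prod 𝓘(ℝ, EG)) ∞ e e.source ∧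
    ContMDiffOn (M.I.prod 𝓘(ℝ, EG)) Q.I ∞ e.toOpenPartialHomeomorph.symm e.target ∧
    ∀ q ∈ e.source, ∀ g : G, (e (act q g)).2 = (e q).2 * g

variable {G}

namespace PrincipalBundle

/-- A connection on a principal bundle: a `G`-invariant horizontal distribution `V ⊂ TQ`. -/
structure IsConnection (P : PrincipalBundle.{u} (EG := EG) G)
    (V : ∀ q : P.Q, Submodule ℝ (P.Q.T q)) : Prop where
  distribution : IsHorizontalDistribution P.r V
  invariant : ∀ (g : G) (q : P.Q) (v : P.Q.T q), v ∈ V q →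
    mfderiv P.Q.I P.Q.I (fun a => P.act a g) q v ∈ V (P.act q g)

variable (P : PrincipalBundle.{u} (EG := EG) G)

/-- For `k : Q × Y → Z`, the differential at `(a, y)` applied to `(v, w) ∈ T_a Q ⊕ T_y Y`. -/
def push {Y Z : SmoothMfd.{u}} (k : P.Q × Y → Z) (a : P.Q) (y : Y) (v : P.Q.T a) (w : Y.T y) :
    Z.T (k (a, y)) :=
  mfderiv (P.Q.I.prod Y.I) Z.I k (a, y) (((v, w) : P.Q.model × Y.model))

/-- The smooth manifold `Z` with the map `k` is the associated bundle `Y_Q = Q ×_G Y`: the quotient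
manifold of `Q × Y` by the relation `(a · g, y) ∼ (a, g y)`. -/
structure IsAssociated (Y Z : SmoothMfd.{u}) [MulAction G Y] (k : P.Q × Y → Z) : Prop where
  smooth : ContMDiff (P.Q.I.prod Y.I) Z.I ∞ k
  surjective : Function.Surjective k
  submersion : ∀ p, Function.Surjective (mfderiv (P.Q.I.prod Y.I) Z.I k p)
  fibers : ∀ (a b : P.Q) (y z : Y), k (a, y) = k (b, z) ↔ ∃ g : G, a = P.act b g ∧ z = g • y

/-- The associated bundles `E_Q → X_Q → S_Q` of a tower with `G`-action, with the quotient maps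
`Q × X → X_Q`, `Q × S → S_Q`, and `Q × E → E_Q`; the last one is given by complex linear
isomorphisms `qE a x : E_x ≃ (E_Q)_{[a, x]}`. -/
structure AssociatedTower {τ : Tower.{u}} [MulAction G τ.X] [MulAction G τ.S]
    (α : TowerAction (EG := EG) G τ) : Type (u + 1) where
  tower : Tower.{u}
  qX : P.Q × τ.X → tower.X
  qS : P.Q × τ.S → tower.S
  assocX : P.IsAssociated τ.X tower.X qX
  assocS : P.IsAssociated τ.S tower.S qS
  pr_q : ∀ a x, tower.pr (qX (a, x)) = qS (a, τ.pr x)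
  qE : ∀ (a : P.Q) (x : τ.X), τ.E.fib x →ₗ[ℂ] tower.E.fib (qX (a, x))
  qE_bijective : ∀ a x, Function.Bijective (qE a x)
  qE_smooth : ContMDiff (P.Q.I.prod τ.E.ITot) tower.E.ITot ∞
    (fun p : P.Q × τ.E.Tot =>
      TotalSpace.mk' tower.E.F (qX (p.1, p.2.proj)) (qE p.1 p.2.proj p.2.snd))
  qE_invariant : ∀ (a : P.Q) (g : G) (x : τ.X) (e : τ.E.fib x),
    TotalSpace.mk' tower.E.F (qX (P.act a g, x)) (qE (P.act a g) x e) =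
      TotalSpace.mk' tower.E.F (qX (a, g • x)) (qE a (g • x) (α.ρ g x e))

end PrincipalBundle

namespace PrincipalBundle.AssociatedTower

variable {P : PrincipalBundle.{u} (EG := EG) G} {τ : Tower.{u}} [MulAction G τ.X]
  [MulAction G τ.S] {α : TowerAction (EG := EG) G τ} (R : P.AssociatedTower α)

/-- The data on `E_Q → X_Q → S_Q` induced by the data `𝒟` on `E → X → S` and the connection `V`. -/
structure IsInduced (V : ∀ q : P.Q, Submodule ℝ (P.Q.T q)) (𝒟 : GeometricData τ)
    (𝒟Q : GeometricData R.tower) : Prop where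
  /-- `H_Q = q_*(V ⊕ H)`. -/
  H : ∀ a x (w : R.tower.X.T (R.qX (a, x))),
    w ∈ 𝒟Q.H (R.qX (a, x)) ↔ ∃ v ∈ V a, ∃ h ∈ 𝒟.H x, P.push R.qX a x v h = w
  /-- The metric descends: `q_* : T_x(X/S) → T_{[a, x]}(X_Q/S_Q)` is isometric. -/
  metric : ∀ a x (v w : vert τ.pr x) (v' w' : vert R.tower.pr (R.qX (a, x))),
    (v' : R.tower.X.T (R.qX (a, x))) = P.push R.qX a x 0 v →
    (w' : R.tower.X.T (R.qX (a, x))) = P.push R.qX a x 0 w →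
      𝒟Q.g (R.qX (a, x)) v' w' = 𝒟.g x v w
  grading : ∀ a x (e : τ.E.fib x), 𝒟Q.ε (R.qX (a, x)) (R.qE a x e) = R.qE a x (𝒟.ε x e)
  /-- Clifford multiplication on `E_Q` is fibrewise the one on `E`. -/
  clifford : ∀ a x (v : vert τ.pr x) (v' : vert R.tower.pr (R.qX (a, x))) (e : τ.E.fib x),
    (v' : R.tower.X.T (R.qX (a, x))) = P.push R.qX a x 0 v →
      𝒟Q.cmul (R.qX (a, x)) v' (R.qE a x e) = R.qE a x (𝒟.cmul x v e)
  /-- `∇^E_Q`: for a section `σ` of `E_Q` with lift `σ'` to an equivariant section of `p^* E` over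
  `Q × X`, the derivative of `σ` along `q_*(v, w)`, with `v` horizontal for the connection on `Q`,
  is the image of the pulled back derivative `(p^* ∇^E)_{(v, w)} σ' = (d_Q + ∇^E)_{(v, w)} σ'`. -/
  nabla : ∀ (σ : ∀ z, R.tower.E.fib z) (σ' : P.Q → ∀ x, τ.E.fib x),
    R.tower.E.SmoothOn σ Set.univ → (∀ a x, R.qE a x (σ' a x) = σ (R.qX (a, x))) →
    ∀ (a : P.Q) (x : τ.X), ∀ v ∈ V a, ∀ w : τ.X.T x,
      𝒟Q.nabla σ (R.qX (a, x)) (P.push R.qX a x v w) =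
        R.qE a x (τ.E.fiberDeriv P.Q x (fun b => σ' b x) a v + 𝒟.nabla (σ' a) x w)

/-- `NQ` is the connection on `T(X_Q/S_Q)` induced by the connection `N` on `T(X/S)` and the
connection `V` on `Q`, by the same rule as for `∇^E_Q`. -/
def IsInducedVertical (V : ∀ q : P.Q, Submodule ℝ (P.Q.T q))
    (N : VertField τ.pr → ∀ x : τ.X, τ.X.T x → vert τ.pr x)
    (NQ : VertField R.tower.pr → ∀ z : R.tower.X, R.tower.X.T z → vert R.tower.pr z) : Prop :=
  ∀ (ν : VertField R.tower.pr) (ν' : P.Q → VertField τ.pr),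
    ν.SmoothOn Set.univ → (∀ a x, P.push R.qX a x 0 (ν' a x) = ν (R.qX (a, x))) →
    ∀ (a : P.Q) (x : τ.X), ∀ v ∈ V a, ∀ w : τ.X.T x,
      (NQ ν (R.qX (a, x)) (P.push R.qX a x v w) : R.tower.X.T (R.qX (a, x))) =
        P.push R.qX a x 0
          (tangentDeriv P.Q x (fun b => (ν' b x : τ.X.T x)) a v + (N (ν' a) x w : τ.X.T x))

end PrincipalBundle.AssociatedTower

end Principal

end CliffordFamily

end

/-! The quotient map `q : Q × X → X_Q` is a surjective submersion whose fibres are the orbits of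
`G`, and the argument takes place upstairs on `Q × X`. A map out of `X_Q` is smooth as soon as its
composite with `q` is, because submersions have local sections (`exists_local_section`,
`IsAssociated.contMDiffAt_of_comp`).

The connection on `Q` enters through the isomorphism `V_a ⊕ T_x X ≅ T_{[a, x]} X_Q`. It is onto
because a vertical vector of `Q` is tangent to an orbit, and motion along the orbit in `Q` can be
traded for motion along the orbit in `X` (`exists_push`); it is injective because `V_a` maps
isomorphically to the tangent space of `M` (`eq_of_push_eq`). In this picture the vertical vectors
are `0 ⊕ T_x(X/S)`, the distribution `H_Q` is `V_a ⊕ H_x`, and smooth fields and sections have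
smooth lifts. Each datum is defined through one representative `(a, x)`; independence of the choice
is the invariance under `G`, by way of `push_act` and, for the connection, `ρ_liftDeriv`.

The delicate point is the vertical connection, since nothing relates the Levi-Civita connections of
`X` and `X_Q` directly. The Koszul formula, tested on vertical vectors, expresses `g(∇^{X/S}_u v,
w)` through the vertical metric, the projection `P` and Lie brackets alone: the metric of the base
drops out (`IsVerticalConnection.koszul`). Every term can then be computed upstairs. Derivatives of
the metric split into a `Q`-part and an `X`-part (`mvfderiv_metric_push`), and so do brackets, up to
a term in `V` that `P` annihilates (`mlieBracket_push`). Adding up leaves the Koszul formula on `X`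
plus twice the derivative along `Q`, which is the rule for the induced connection
(`isInducedVertical`). The Clifford property is then a product rule in a fixed fibre combined with
the Leibniz rule on `E` (`cliffordLeibniz`).

Two existence results are needed besides. The bundles `X_Q`, `S_Q` and `E_Q` are glued from gauges
of `Q`. A vertical connection on `X_Q` comes from a Levi-Civita connection, built point by point
from Christoffel symbols (`exists_leviCivita`). -/

namespace CliffordFamily

open Filter Topology Set

set_option linter.unusedSectionVars false

noncomputable section

/-! ### Smooth families of vectors along a map, read in local trivializations -/

section Along

variable {EN HN N : Type*} [NormedAddCommGroup EN] [NormedSpace ℝ EN] [TopologicalSpace HN]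
  {J : ModelWithCorners ℝ EN HN} [TopologicalSpace N] [ChartedSpace HN N]
  {EB HB B : Type*} [NormedAddCommGroup EB] [NormedSpace ℝ EB] [TopologicalSpace HB]
  {I : ModelWithCorners ℝ EB HB} [TopologicalSpace B] [ChartedSpace HB B]
  {F : Type*} [NormedAddCommGroup F] [NormedSpace ℝ F]
  {E : B → Type*} [TopologicalSpace (TotalSpace F E)]
  [∀ x, AddCommGroup (E x)] [∀ x, Module ℝ (E x)] [∀ x, TopologicalSpace (E x)]
  [FiberBundle F E] [VectorBundle ℝ F E]
  {EC HC C : Type*} [NormedAddCommGroup EC] [NormedSpace ℝ EC] [TopologicalSpace HC]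
  {K : ModelWithCorners ℝ EC HC} [TopologicalSpace C] [ChartedSpace HC C]
  {F' : Type*} [NormedAddCommGroup F'] [NormedSpace ℝ F']
  {E' : C → Type*} [TopologicalSpace (TotalSpace F' E')]
  [∀ x, AddCommGroup (E' x)] [∀ x, Module ℝ (E' x)] [∀ x, TopologicalSpace (E' x)]
  [FiberBundle F' E'] [VectorBundle ℝ F' E']

variable (F E) in
/-- The fibre coordinate `E_x → F` in the preferred trivialization at `x₀`. -/
abbrev coordAt (x₀ x : B) : E x →L[ℝ] F := (trivializationAt F E x₀).continuousLinearMapAt ℝ x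

variable (F E) in
/-- The inverse `F → E_x` of the fibre coordinate in the preferred trivialization at `x₀`. -/
abbrev coordSymm (x₀ x : B) : F →L[ℝ] E x := (trivializationAt F E x₀).symmL ℝ x

variable (F E) in
theorem eventually_mem_baseSet (x₀ : B) : ∀ᶠ x in 𝓝 x₀, x ∈ (trivializationAt F E x₀).baseSet :=
  (trivializationAt F E x₀).open_baseSet.mem_nhds (mem_baseSet_trivializationAt F E x₀)

theorem coordSymm_coordAt {x₀ x : B} (hx : x ∈ (trivializationAt F E x₀).baseSet) (v : E x) :
    coordSymm F E x₀ x (coordAt F E x₀ x v) = v :=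
  (trivializationAt F E x₀).symmL_continuousLinearMapAt hx v

theorem coordAt_coordSymm {x₀ x : B} (hx : x ∈ (trivializationAt F E x₀).baseSet) (v : F) :
    coordAt F E x₀ x (coordSymm F E x₀ x v) = v :=
  (trivializationAt F E x₀).continuousLinearMapAt_symmL hx v

theorem coordAt_apply {x₀ x : B} (hx : x ∈ (trivializationAt F E x₀).baseSet) (v : E x) :
    coordAt F E x₀ x v = (trivializationAt F E x₀ ⟨x, v⟩).2 := by
  rw [coordAt, Trivialization.continuousLinearMapAt_apply, Trivialization.linearMapAt_apply,
    if_pos hx]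

/-- Near `n₀` the points `b n` stay in one base set, so a single fibre coordinate decides. Sums,
multiples and images of smooth families are all reduced to vector-valued functions in this way. -/
theorem along_iff {b : N → B} {f : ∀ n, E (b n)} {n₀ : N} (hb : ContMDiffAt J I ∞ b n₀) :
    ContMDiffAt J (I.prod 𝓘(ℝ, F)) ∞ (fun n => TotalSpace.mk' F (b n) (f n)) n₀ ↔
      ContMDiffAt J 𝓘(ℝ, F) ∞ (fun n => coordAt F E (b n₀) (b n) (f n)) n₀ := by
  rw [contMDiffAt_totalSpace]
  simp only [hb, true_and]
  apply EventuallyEq.contMDiffAt_iff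
  filter_upwards [hb.continuousAt.eventually (eventually_mem_baseSet F E (b n₀))] with n hn
  exact (coordAt_apply hn _).symm

theorem along_base {b : N → B} {f : ∀ n, E (b n)} {n₀ : N}
    (hf : ContMDiffAt J (I.prod 𝓘(ℝ, F)) ∞ (fun n => TotalSpace.mk' F (b n) (f n)) n₀) :
    ContMDiffAt J I ∞ b n₀ :=
  (contMDiffAt_totalSpace.1 hf).1

theorem along_coord {b : N → B} {f : ∀ n, E (b n)} {n₀ : N}
    (hf : ContMDiffAt J (I.prod 𝓘(ℝ, F)) ∞ (fun n => TotalSpace.mk' F (b n) (f n)) n₀) :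
    ContMDiffAt J 𝓘(ℝ, F) ∞ (fun n => coordAt F E (b n₀) (b n) (f n)) n₀ :=
  (along_iff (along_base hf)).1 hf

theorem along_add {b : N → B} {f g : ∀ n, E (b n)} {n₀ : N}
    (hf : ContMDiffAt J (I.prod 𝓘(ℝ, F)) ∞ (fun n => TotalSpace.mk' F (b n) (f n)) n₀)
    (hg : ContMDiffAt J (I.prod 𝓘(ℝ, F)) ∞ (fun n => TotalSpace.mk' F (b n) (g n)) n₀) :
    ContMDiffAt J (I.prod 𝓘(ℝ, F)) ∞ (fun n => TotalSpace.mk' F (b n) (f n + g n)) n₀ := by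
  refine (along_iff (along_base hf)).2 ?_
  simp only [map_add]
  exact (along_coord hf).add (along_coord hg)

theorem along_sub {b : N → B} {f g : ∀ n, E (b n)} {n₀ : N}
    (hf : ContMDiffAt J (I.prod 𝓘(ℝ, F)) ∞ (fun n => TotalSpace.mk' F (b n) (f n)) n₀)
    (hg : ContMDiffAt J (I.prod 𝓘(ℝ, F)) ∞ (fun n => TotalSpace.mk' F (b n) (g n)) n₀) :
    ContMDiffAt J (I.prod 𝓘(ℝ, F)) ∞ (fun n => TotalSpace.mk' F (b n) (f n - g n)) n₀ := by
  refine (along_iff (along_base hf)).2 ?_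
  simp only [map_sub]
  exact (along_coord hf).sub (along_coord hg)

theorem along_zero {b : N → B} {n₀ : N} (hb : ContMDiffAt J I ∞ b n₀) :
    ContMDiffAt J (I.prod 𝓘(ℝ, F)) ∞ (fun n => TotalSpace.mk' F (b n) (0 : E (b n))) n₀ := by
  refine (along_iff hb).2 ?_
  simpa only [map_zero] using contMDiffAt_const

theorem along_smul {b : N → B} {c : N → ℝ} {f : ∀ n, E (b n)} {n₀ : N}
    (hc : ContMDiffAt J 𝓘(ℝ, ℝ) ∞ c n₀)
    (hf : ContMDiffAt J (I.prod 𝓘(ℝ, F)) ∞ (fun n => TotalSpace.mk' F (b n) (f n)) n₀) :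
    ContMDiffAt J (I.prod 𝓘(ℝ, F)) ∞ (fun n => TotalSpace.mk' F (b n) (c n • f n)) n₀ := by
  refine (along_iff (along_base hf)).2 ?_
  simp only [map_smul]
  exact hc.smul (along_coord hf)

theorem along_sum {ι : Type*} {s : Finset ι} {b : N → B} {f : ι → ∀ n, E (b n)} {n₀ : N}
    (hb : ContMDiffAt J I ∞ b n₀)
    (hf : ∀ i, ContMDiffAt J (I.prod 𝓘(ℝ, F)) ∞ (fun n => TotalSpace.mk' F (b n) (f i n)) n₀) :
    ContMDiffAt J (I.prod 𝓘(ℝ, F)) ∞ (fun n => TotalSpace.mk' F (b n) (∑ i ∈ s, f i n)) n₀ := by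
  classical
  induction s using Finset.induction_on with
  | empty => simpa using along_zero hb
  | insert a s ha ih => simpa only [Finset.sum_insert ha] using along_add (hf a) ih

variable (J) in
theorem contMDiffAt_coordSymm [ContMDiffVectorBundle ∞ F E I] (x₀ : B) {x : B}
    (hx : x ∈ (trivializationAt F E x₀).baseSet) (y : F) :
    ContMDiffAt I (I.prod 𝓘(ℝ, F)) ∞
      (fun x => TotalSpace.mk' F x (coordSymm F E x₀ x y)) x := by
  rw [(trivializationAt F E x₀).contMDiffAt_section_iff hx]
  refine (contMDiffAt_const (c := y)).congr_of_eventuallyEq ?_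
  filter_upwards [(trivializationAt F E x₀).open_baseSet.mem_nhds hx] with z hz
  rw [← coordAt_apply hz, coordAt_coordSymm hz]

theorem along_coordSymm [ContMDiffVectorBundle ∞ F E I] {b : N → B} {n₀ : N}
    (hb : ContMDiffAt J I ∞ b n₀) (y : F) :
    ContMDiffAt J (I.prod 𝓘(ℝ, F)) ∞
      (fun n => TotalSpace.mk' F (b n) (coordSymm F E (b n₀) (b n) y)) n₀ :=
  (contMDiffAt_coordSymm (b n₀) (mem_baseSet_trivializationAt F E (b n₀)) y).comp n₀ hb

/-- A smooth family of linear forms applied to a smooth family of vectors is smooth. -/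
theorem along_apply [FiniteDimensional ℝ F] {W : Type*} [NormedAddCommGroup W] [NormedSpace ℝ W]
    {b : N → B} {f : ∀ n, E (b n)} {n₀ : N} (Φ : ∀ n, E (b n) →ₗ[ℝ] W)
    (hΦ : ∀ y : F, ContMDiffAt J 𝓘(ℝ, W) ∞ (fun n => Φ n (coordSymm F E (b n₀) (b n) y)) n₀)
    (hf : ContMDiffAt J (I.prod 𝓘(ℝ, F)) ∞ (fun n => TotalSpace.mk' F (b n) (f n)) n₀) :
    ContMDiffAt J 𝓘(ℝ, W) ∞ (fun n => Φ n (f n)) n₀ := by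
  -- Near `n₀`, `f n` is expanded in the local frame attached to `β`; its coefficients are smooth,
  -- and so is `Φ` on each frame vector.
  let β := Module.finBasis ℝ F
  have h1 : ContMDiffAt J 𝓘(ℝ, W) ∞ (fun n => ∑ i, (β.coord i) (coordAt F E (b n₀) (b n) (f n)) •
      Φ n (coordSymm F E (b n₀) (b n) (β i))) n₀ := by
    refine ContMDiffAt.sum fun i _ => ContMDiffAt.smul (I' := 𝓘(ℝ, W)) (I := 𝓘(ℝ, ℝ)) ?_ (hΦ (β i))
    exact (LinearMap.toContinuousLinearMap (β.coord i)).contMDiff.contMDiffAt.comp n₀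
      (along_coord hf)
  refine h1.congr_of_eventuallyEq ?_
  filter_upwards [(along_base hf).continuousAt.eventually
    (eventually_mem_baseSet F E (b n₀))] with n hn
  conv_lhs => rw [← coordSymm_coordAt hn (f n), ← β.sum_repr (coordAt F E (b n₀) (b n) (f n))]
  simp only [map_sum, map_smul]
  rfl

/-- A smooth family of linear maps between vector bundles maps smooth sections to smooth
sections. -/
theorem along_map [FiniteDimensional ℝ F] {b : N → B} {c : N → C} {f : ∀ n, E (b n)} {n₀ : N}
    (hc : ContMDiffAt J K ∞ c n₀) (Φ : ∀ n, E (b n) →ₗ[ℝ] E' (c n))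
    (hΦ : ∀ y : F, ContMDiffAt J (K.prod 𝓘(ℝ, F')) ∞
      (fun n => TotalSpace.mk' F' (c n) (Φ n (coordSymm F E (b n₀) (b n) y))) n₀)
    (hf : ContMDiffAt J (I.prod 𝓘(ℝ, F)) ∞ (fun n => TotalSpace.mk' F (b n) (f n)) n₀) :
    ContMDiffAt J (K.prod 𝓘(ℝ, F')) ∞ (fun n => TotalSpace.mk' F' (c n) (Φ n (f n))) n₀ := by
  refine (along_iff hc).2 ?_
  exact along_apply (fun n => (coordAt F' E' (c n₀) (c n)).toLinearMap ∘ₗ Φ n)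
    (fun y => along_coord (hΦ y)) hf

/-- If a smooth family of injective linear maps sends a family of vectors to a smooth family, then
the family of vectors is smooth. -/
theorem along_of_injective_apply [FiniteDimensional ℝ F] {W : Type*} [NormedAddCommGroup W]
    [NormedSpace ℝ W] [FiniteDimensional ℝ W] {b : N → B} {f : ∀ n, E (b n)} {n₀ : N}
    (hb : ContMDiffAt J I ∞ b n₀) (Φ : ∀ n, E (b n) →ₗ[ℝ] W)
    (hΦ : ∀ y : F, ContMDiffAt J 𝓘(ℝ, W) ∞ (fun n => Φ n (coordSymm F E (b n₀) (b n) y)) n₀)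
    (hinj : Function.Injective (Φ n₀))
    (hf : ContMDiffAt J 𝓘(ℝ, W) ∞ (fun n => Φ n (f n)) n₀) :
    ContMDiffAt J (I.prod 𝓘(ℝ, F)) ∞ (fun n => TotalSpace.mk' F (b n) (f n)) n₀ := by
  let β := Module.finBasis ℝ F
  let Ψ : N → F →ₗ[ℝ] W := fun n => Φ n ∘ₗ (coordSymm F E (b n₀) (b n)).toLinearMap
  have hΨ : Function.Injective (Ψ n₀) := by
    refine hinj.comp fun y z h => ?_
    have hm := mem_baseSet_trivializationAt F E (b n₀)
    have := congrArg (coordAt F E (b n₀) (b n₀)) h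
    simpa only [ContinuousLinearMap.coe_coe, coordAt_coordSymm hm] using this
  -- A left inverse at the single point `n₀` suffices: `A ∘ Ψ n` depends smoothly on `n` and is the
  -- identity at `n₀`, hence is invertible nearby. Its inverse, applied to `A (Φ n (f n))`, recovers
  -- the coordinate of `f n`.
  obtain ⟨A, hA⟩ := LinearMap.exists_leftInverse_of_injective (Ψ n₀) (LinearMap.ker_eq_bot.2 hΨ)
  let A' : W →L[ℝ] F := LinearMap.toContinuousLinearMap A
  let M : N → F →L[ℝ] F := fun n => LinearMap.toContinuousLinearMap (A ∘ₗ Ψ n)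
  have hM : ContMDiffAt J 𝓘(ℝ, F →L[ℝ] F) ∞ M n₀ := by
    have h1 : ContMDiffAt J 𝓘(ℝ, F →L[ℝ] F) ∞ (fun n => ∑ i,
        ContinuousLinearMap.smulRightL ℝ F F (LinearMap.toContinuousLinearMap (β.coord i))
          (A' (Ψ n (β i)))) n₀ := by
      refine ContMDiffAt.sum fun i _ => ?_
      exact ((ContinuousLinearMap.contMDiff _).contMDiffAt.comp n₀
        (A'.contMDiff.contMDiffAt.comp n₀ (hΦ (β i))))
    refine h1.congr_of_eventuallyEq (Eventually.of_forall fun n => ?_)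
    ext y
    conv_lhs => rw [← β.sum_repr y]
    simp only [M, A', map_sum, map_smul, LinearMap.coe_toContinuousLinearMap', LinearMap.comp_apply,
      sum_apply, ContinuousLinearMap.smulRightL_apply_apply]
    rfl
  have hM0 : M n₀ = ContinuousLinearMap.id ℝ F := by
    ext y; exact LinearMap.congr_fun hA y
  have hinv : ContMDiffAt J 𝓘(ℝ, F →L[ℝ] F) ∞ (fun n => ContinuousLinearMap.inverse (M n)) n₀ := by
    have h2 : ContDiffAt ℝ ∞ (ContinuousLinearMap.inverse : (F →L[ℝ] F) → _) (M n₀) := by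
      rw [hM0]; exact contDiffAt_map_inverse (ContinuousLinearEquiv.refl ℝ F)
    exact h2.contMDiffAt.comp n₀ hM
  have hev : ∀ᶠ n in 𝓝 n₀, (M n).IsInvertible := by
    have h3 : ∀ᶠ L : F →L[ℝ] F in 𝓝 (M n₀), L.IsInvertible := by
      rw [hM0]
      exact (ContinuousLinearEquiv.refl ℝ F).nhds
    exact hM.continuousAt.eventually h3
  refine (along_iff hb).2 ?_
  refine (hinv.clm_apply (A'.contMDiff.contMDiffAt.comp n₀ hf)).congr_of_eventuallyEq ?_
  filter_upwards [hev, hb.continuousAt.eventually (eventually_mem_baseSet F E (b n₀))] with n hn hn'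
  have h4 : A' (Φ n (f n)) = M n (coordAt F E (b n₀) (b n) (f n)) := by
    simp only [M, A', Ψ, LinearMap.coe_toContinuousLinearMap', LinearMap.comp_apply,
      ContinuousLinearMap.coe_coe, coordSymm_coordAt hn']
  change _ = ContinuousLinearMap.inverse (M n) (A' (Φ n (f n)))
  rw [h4]
  exact (hn.inverse_apply_eq.2 rfl).symm

variable {ED HD D : Type*} [NormedAddCommGroup ED] [NormedSpace ℝ ED] [TopologicalSpace HD]
  {L : ModelWithCorners ℝ ED HD} [TopologicalSpace D] [ChartedSpace HD D]
  {F'' : Type*} [NormedAddCommGroup F''] [NormedSpace ℝ F'']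
  {E'' : D → Type*} [TopologicalSpace (TotalSpace F'' E'')]
  [∀ x, AddCommGroup (E'' x)] [∀ x, Module ℝ (E'' x)] [∀ x, TopologicalSpace (E'' x)]
  [FiberBundle F'' E''] [VectorBundle ℝ F'' E'']

/-- A family of vectors is smooth if its images under two smooth families of linear maps, injective
together, are smooth. -/
theorem along_of_injective₂ [FiniteDimensional ℝ F] [FiniteDimensional ℝ F']
    [FiniteDimensional ℝ F''] {b : N → B} {c : N → C} {d : N → D} {f : ∀ n, E (b n)} {n₀ : N}
    (hb : ContMDiffAt J I ∞ b n₀)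
    (Φ : ∀ n, E (b n) →ₗ[ℝ] E' (c n)) (Φ' : ∀ n, E (b n) →ₗ[ℝ] E'' (d n))
    (hΦ : ∀ y : F, ContMDiffAt J (K.prod 𝓘(ℝ, F')) ∞
      (fun n => TotalSpace.mk' F' (c n) (Φ n (coordSymm F E (b n₀) (b n) y))) n₀)
    (hΦ' : ∀ y : F, ContMDiffAt J (L.prod 𝓘(ℝ, F'')) ∞
      (fun n => TotalSpace.mk' F'' (d n) (Φ' n (coordSymm F E (b n₀) (b n) y))) n₀)
    (hinj : ∀ y, Φ n₀ y = 0 → Φ' n₀ y = 0 → y = 0)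
    (hf : ContMDiffAt J (K.prod 𝓘(ℝ, F')) ∞ (fun n => TotalSpace.mk' F' (c n) (Φ n (f n))) n₀)
    (hf' : ContMDiffAt J (L.prod 𝓘(ℝ, F'')) ∞
      (fun n => TotalSpace.mk' F'' (d n) (Φ' n (f n))) n₀) :
    ContMDiffAt J (I.prod 𝓘(ℝ, F)) ∞ (fun n => TotalSpace.mk' F (b n) (f n)) n₀ := by
  refine along_of_injective_apply (W := F' × F'') hb
    (fun n => ((coordAt F' E' (c n₀) (c n)).toLinearMap ∘ₗ Φ n).prod
      ((coordAt F'' E'' (d n₀) (d n)).toLinearMap ∘ₗ Φ' n))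
    (fun y => (along_coord (hΦ y)).prodMk_space (along_coord (hΦ' y))) ?_
    ((along_coord hf).prodMk_space (along_coord hf'))
  rw [← LinearMap.ker_eq_bot, LinearMap.ker_eq_bot']
  intro y hy
  have hy1 : coordAt F' E' (c n₀) (c n₀) (Φ n₀ y) = 0 := congrArg Prod.fst hy
  have hy2 : coordAt F'' E'' (d n₀) (d n₀) (Φ' n₀ y) = 0 := congrArg Prod.snd hy
  refine hinj y ?_ ?_
  · rw [← coordSymm_coordAt (mem_baseSet_trivializationAt F' E' (c n₀)) (Φ n₀ y), hy1, map_zero]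
  · rw [← coordSymm_coordAt (mem_baseSet_trivializationAt F'' E'' (d n₀)) (Φ' n₀ y), hy2, map_zero]

/-- A family of vectors is smooth if its image under a smooth family of injective linear maps is
smooth. -/
theorem along_of_injective [FiniteDimensional ℝ F] [FiniteDimensional ℝ F']
    {b : N → B} {c : N → C} {f : ∀ n, E (b n)} {n₀ : N}
    (hb : ContMDiffAt J I ∞ b n₀) (Φ : ∀ n, E (b n) →ₗ[ℝ] E' (c n))
    (hΦ : ∀ y : F, ContMDiffAt J (K.prod 𝓘(ℝ, F')) ∞
      (fun n => TotalSpace.mk' F' (c n) (Φ n (coordSymm F E (b n₀) (b n) y))) n₀)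
    (hinj : Function.Injective (Φ n₀))
    (hf : ContMDiffAt J (K.prod 𝓘(ℝ, F')) ∞ (fun n => TotalSpace.mk' F' (c n) (Φ n (f n))) n₀) :
    ContMDiffAt J (I.prod 𝓘(ℝ, F)) ∞ (fun n => TotalSpace.mk' F (b n) (f n)) n₀ :=
  along_of_injective₂ hb Φ Φ hΦ hΦ (fun _ hy _ => hinj (hy.trans (map_zero _).symm)) hf hf

/-- A section that is smooth near a point agrees near it with a globally smooth section. -/
theorem exists_smooth_section_eventuallyEq [FiniteDimensional ℝ EB] [T2Space B]
    [IsManifold I ∞ B] [ContMDiffVectorBundle ∞ F E I] [I.Boundaryless]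
    (s : ∀ x, E x) (x₀ : B)
    (hs : ∀ᶠ x in 𝓝 x₀, ContMDiffAt I (I.prod 𝓘(ℝ, F)) ∞ (fun x => TotalSpace.mk' F x (s x)) x) :
    ∃ t : ∀ x, E x, ContMDiff I (I.prod 𝓘(ℝ, F)) ∞ (fun x => TotalSpace.mk' F x (t x)) ∧
      ∀ᶠ x in 𝓝 x₀, t x = s x := by
  obtain ⟨U, hU, hUo, hx⟩ := eventually_nhds_iff.1 hs
  obtain ⟨φ, -, hφ⟩ := (SmoothBumpFunction.nhds_basis_tsupport (I := I) x₀).mem_iff.1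
    (hUo.mem_nhds hx)
  refine ⟨fun x => φ x • s x, ?_, ?_⟩
  · exact (ContMDiffOn.smul_section_of_tsupport (u := U)
      φ.contMDiff.contMDiffOn hUo hφ (fun x hx => (hU x hx).contMDiffWithinAt))
  · filter_upwards [φ.eventuallyEq_one] with x hx
    simp [hx]

theorem exists_smooth_section_apply_eq [FiniteDimensional ℝ EB] [T2Space B]
    [IsManifold I ∞ B] [ContMDiffVectorBundle ∞ F E I] [I.Boundaryless] (x₀ : B) (v : E x₀) :
    ∃ t : ∀ x, E x, ContMDiff I (I.prod 𝓘(ℝ, F)) ∞ (fun x => TotalSpace.mk' F x (t x)) ∧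
      t x₀ = v := by
  obtain ⟨t, ht, h⟩ := exists_smooth_section_eventuallyEq (I := I)
    (fun x => coordSymm F E x₀ x (coordAt F E x₀ x₀ v)) x₀ <| by
    filter_upwards [eventually_mem_baseSet F E x₀] with x hx
    exact contMDiffAt_coordSymm x₀ hx _
  exact ⟨t, ht, h.self_of_nhds.trans
    (coordSymm_coordAt (mem_baseSet_trivializationAt F E x₀) v)⟩

end Along

end

noncomputable section

/-! ### Second derivatives and the Lie bracket in a chart -/

section Bracket

variable {EM HM M : Type*} [NormedAddCommGroup EM] [NormedSpace ℝ EM] [CompleteSpace EM]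
  [TopologicalSpace HM]
  {I : ModelWithCorners ℝ EM HM} [I.Boundaryless] [TopologicalSpace M] [ChartedSpace HM M]
  [IsManifold I ∞ M]
  {F : Type*} [NormedAddCommGroup F] [NormedSpace ℝ F]

theorem coordAt_tangent {p y : M} (hy : y ∈ (chartAt HM p).source) (v : TangentSpace I y) :
    coordAt EM (TangentSpace I : M → Type _) p y v = mfderiv I 𝓘(ℝ, EM) (extChartAt I p) y v := by
  rw [coordAt, TangentBundle.continuousLinearMapAt_trivializationAt hy]
  rfl

/-- The tangent bundle is built from coordinate changes between preferred charts, and the change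
from a chart to itself is trivial. This permits `T_p M` and the model space to be interchanged
throughout. -/
theorem coordAt_tangent_self (p : M) (v : TangentSpace I p) :
    coordAt EM (TangentSpace I : M → Type _) p p v = v := by
  rw [coordAt, TangentBundle.continuousLinearMapAt_trivializationAt_eq_core (mem_chart_source _ _)]
  exact (tangentBundleCore I M).coordChange_self _ _ (mem_chart_source _ _) _

theorem mvfderiv_eq_fderiv {g : M → F} {p : M} (hg : MDifferentiableAt I 𝓘(ℝ, F) g p)
    (v : TangentSpace I p) :
    mvfderiv I g p v = fderiv ℝ (g ∘ (extChartAt I p).symm) (extChartAt I p p) v := by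
  rw [hg.mvfderiv, I.range_eq_univ, fderivWithin_univ]
  rfl

theorem contDiffAt_comp_extChartAt_symm {g : M → F} {p : M}
    (hg : ContMDiffAt I 𝓘(ℝ, F) ∞ g p) :
    ContDiffAt ℝ ∞ (g ∘ (extChartAt I p).symm) (extChartAt I p p) := by
  have := (contMDiffAt_iff.1 hg).2
  rw [I.range_eq_univ] at this
  exact this

/-- The chart expression is needed on a neighbourhood, not only at `p`, because it is differentiated
once more. -/
theorem mvfderiv_apply_eventuallyEq {ψ : M → F} {p : M} (hψ : ContMDiffAt I 𝓘(ℝ, F) ∞ ψ p)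
    (W : ∀ y : M, TangentSpace I y) :
    (fun y => mvfderiv I ψ y (W y)) =ᶠ[𝓝 p]
      fun y => fderiv ℝ (ψ ∘ (extChartAt I p).symm) (extChartAt I p y)
        (coordAt EM (TangentSpace I : M → Type _) p y (W y)) := by
  have hψd := contDiffAt_comp_extChartAt_symm hψ
  have h2 : ∀ᶠ y in 𝓝 p, ContDiffAt ℝ 1 (ψ ∘ (extChartAt I p).symm) (extChartAt I p y) :=
    (continuousAt_extChartAt p).eventually
      ((hψd.of_le (n := ∞) (m := 1) ENat.LEInfty.out).eventually (by simp))
  filter_upwards [h2, (chartAt HM p).open_source.mem_nhds (mem_chart_source HM p)] with y hy hy'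
  have h3 : ψ =ᶠ[𝓝 y] (ψ ∘ (extChartAt I p).symm) ∘ extChartAt I p := by
    filter_upwards [(chartAt HM p).open_source.mem_nhds hy'] with z hz
    simp only [Function.comp_apply]
    rw [(extChartAt I p).left_inv (by rwa [extChartAt_source])]
  have h4 : MDifferentiableAt I 𝓘(ℝ, EM) (extChartAt I p) y := mdifferentiableAt_extChartAt hy'
  have h5 : MDifferentiableAt 𝓘(ℝ, EM) 𝓘(ℝ, F) (ψ ∘ (extChartAt I p).symm) (extChartAt I p y) :=
    (hy.differentiableAt (by simp)).mdifferentiableAt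
  rw [coordAt_tangent hy']
  change mfderiv I 𝓘(ℝ, F) ψ y (W y) = _
  rw [h3.mfderiv_eq, mfderiv_comp y h5 h4, mfderiv_eq_fderiv]
  rfl

theorem mvfderiv_congr {g h : M → F} {p : M} (e : g =ᶠ[𝓝 p] h) : mvfderiv I g p = mvfderiv I h p := by
  ext v
  change mfderiv I 𝓘(ℝ, F) g p v = mfderiv I 𝓘(ℝ, F) h p v
  rw [e.mfderiv_eq]
  rfl

theorem mvfderiv_fderiv_apply {ψ : EM → F} {p : M} (hψ : ContDiffAt ℝ ∞ ψ (extChartAt I p p))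
    {W : M → EM} (hW : ContMDiffAt I 𝓘(ℝ, EM) ∞ W p) (v : TangentSpace I p) :
    mvfderiv I (fun y => fderiv ℝ ψ (extChartAt I p y) (W y)) p v =
      fderiv ℝ (fderiv ℝ ψ) (extChartAt I p p) v (W p) +
        fderiv ℝ ψ (extChartAt I p p) (mvfderiv I W p v) := by
  have hW' := contDiffAt_comp_extChartAt_symm hW
  have h7 : ContDiffAt ℝ ∞ (fderiv ℝ ψ) (extChartAt I p p) := hψ.fderiv_right (by simp)
  have h6 : ContMDiffAt I 𝓘(ℝ, F) ∞ (fun y => fderiv ℝ ψ (extChartAt I p y) (W y)) p :=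
    (h7.contMDiffAt.comp p contMDiffAt_extChartAt).clm_apply hW
  have h8 : ((fun y => fderiv ℝ ψ (extChartAt I p y) (W y)) ∘ (extChartAt I p).symm)
      =ᶠ[𝓝 (extChartAt I p p)] fun s => fderiv ℝ ψ s ((W ∘ (extChartAt I p).symm) s) := by
    filter_upwards [extChartAt_target_mem_nhds (I := I) p] with s hs
    simp only [Function.comp_apply, (extChartAt I p).right_inv hs]
  rw [mvfderiv_eq_fderiv (h6.mdifferentiableAt (by simp)),
    mvfderiv_eq_fderiv (hW.mdifferentiableAt (by simp)), h8.fderiv_eq,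
    fderiv_clm_apply (h7.differentiableAt (by simp)) (hW'.differentiableAt (by simp))]
  have h9 : (W ∘ (extChartAt I p).symm) (extChartAt I p p) = W p := by
    rw [Function.comp_apply, extChartAt_to_inv]
  rw [h9]
  exact add_comm _ _

/-- The two summands separate the Hessian of `ψ`, which is symmetric, from the derivative of the
coordinates of `W`. Only the latter survives in a commutator. -/
theorem mvfderiv_mvfderiv_apply {ψ : M → F} {p : M} (hψ : ContMDiffAt I 𝓘(ℝ, F) ∞ ψ p)
    {W : ∀ y : M, TangentSpace I y}
    (hW : ContMDiffAt I (I.prod 𝓘(ℝ, EM)) ∞ (fun y => TotalSpace.mk' EM y (W y)) p)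
    (v : TangentSpace I p) :
    mvfderiv I (fun y => mvfderiv I ψ y (W y)) p v =
      fderiv ℝ (fderiv ℝ (ψ ∘ (extChartAt I p).symm)) (extChartAt I p p) v (W p) +
      mvfderiv I ψ p
        (mvfderiv I (fun y => coordAt EM (TangentSpace I : M → Type _) p y (W y)) p v) := by
  rw [mvfderiv_congr (mvfderiv_apply_eventuallyEq hψ W),
    mvfderiv_fderiv_apply (contDiffAt_comp_extChartAt_symm hψ) (along_coord hW),
    coordAt_tangent_self]
  exact congrArg _ (mvfderiv_eq_fderiv (hψ.mdifferentiableAt (by simp)) _).symm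

/-- Differentiating a function twice along two vector fields. -/
theorem mvfderiv_mvfderiv_sub {ψ : M → F} {p : M} (hψ : ContMDiffAt I 𝓘(ℝ, F) ∞ ψ p)
    {V W : ∀ y : M, TangentSpace I y}
    (hV : ContMDiffAt I (I.prod 𝓘(ℝ, EM)) ∞ (fun y => TotalSpace.mk' EM y (V y)) p)
    (hW : ContMDiffAt I (I.prod 𝓘(ℝ, EM)) ∞ (fun y => TotalSpace.mk' EM y (W y)) p) :
    mvfderiv I (fun y => mvfderiv I ψ y (W y)) p (V p) -
      mvfderiv I (fun y => mvfderiv I ψ y (V y)) p (W p) =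
    mvfderiv I ψ p
      ((mvfderiv I (fun y => coordAt EM (TangentSpace I : M → Type _) p y (W y)) p (V p) -
        mvfderiv I (fun y => coordAt EM (TangentSpace I : M → Type _) p y (V y)) p (W p) : EM)) := by
  rw [mvfderiv_mvfderiv_apply hψ hW, mvfderiv_mvfderiv_apply hψ hV]
  -- Symmetry of the second derivative makes the Hessian terms cancel.
  have h := (contDiffAt_comp_extChartAt_symm hψ).isSymmSndFDerivAt (by simpa using (ENat.LEInfty.out : (2 : ℕ∞ω) ≤ ∞))
  rw [h (V p) (W p)]
  have h2 := map_sub (mvfderiv I ψ p)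
    (mvfderiv I (fun y => coordAt EM (TangentSpace I : M → Type _) p y (W y)) p (V p))
    (mvfderiv I (fun y => coordAt EM (TangentSpace I : M → Type _) p y (V y)) p (W p))
  refine Eq.trans ?_ h2.symm
  abel

/-- The bracket is defined by pulling the fields back to the model space. Near the image of `p`
these pullbacks are the coordinates in the trivialization at `p`, and the differential of the chart
at `p` itself is the identity. -/
theorem mlieBracket_eq {V W : ∀ y : M, TangentSpace I y} {p : M}
    (hV : ContMDiffAt I (I.prod 𝓘(ℝ, EM)) ∞ (fun y => TotalSpace.mk' EM y (V y)) p)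
    (hW : ContMDiffAt I (I.prod 𝓘(ℝ, EM)) ∞ (fun y => TotalSpace.mk' EM y (W y)) p) :
    VectorField.mlieBracket I V W p =
      ((mvfderiv I (fun y => coordAt EM (TangentSpace I : M → Type _) p y (W y)) p (V p) -
        mvfderiv I (fun y => coordAt EM (TangentSpace I : M → Type _) p y (V y)) p (W p) : EM)) := by
  have key : ∀ U : ∀ y : M, TangentSpace I y,
      VectorField.mpullbackWithin 𝓘(ℝ, EM) I (extChartAt I p).symm U (range I)
        =ᶠ[𝓝 (extChartAt I p p)]
      (fun y => coordAt EM (TangentSpace I : M → Type _) p y (U y)) ∘ (extChartAt I p).symm := by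
    intro U
    filter_upwards [extChartAt_target_mem_nhds (I := I) p] with s hs
    have hs' : (extChartAt I p).symm s ∈ (chartAt HM p).source := by
      rw [← extChartAt_source I]; exact (extChartAt I p).map_target hs
    rw [VectorField.mpullbackWithin_apply]
    simp only [Function.comp_apply, coordAt_tangent hs']
    have h1 := mfderivWithin_extChartAt_symm_comp_mfderiv_extChartAt hs
    have h2 := mfderiv_extChartAt_comp_mfderivWithin_extChartAt_symm hs
    rw [ContinuousLinearMap.inverse_eq h1 h2]
    rfl
  have hd : (mfderiv I 𝓘(ℝ, EM) (extChartAt I p) p).inverse = ContinuousLinearMap.id ℝ EM := by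
    have : mfderiv I 𝓘(ℝ, EM) (extChartAt I p) p = ContinuousLinearMap.id ℝ EM := by
      ext v
      exact (coordAt_tangent (mem_chart_source HM p) v).symm.trans (coordAt_tangent_self p v)
    rw [this]; exact ContinuousLinearMap.inverse_id
  have h1 : VectorField.mlieBracket I V W p = VectorField.lieBracketWithin ℝ
      (VectorField.mpullbackWithin 𝓘(ℝ, EM) I (extChartAt I p).symm V (range I))
      (VectorField.mpullbackWithin 𝓘(ℝ, EM) I (extChartAt I p).symm W (range I))
      ((extChartAt I p).symm ⁻¹' univ ∩ range I) (extChartAt I p p) := by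
    rw [← VectorField.mlieBracketWithin_univ, VectorField.mlieBracketWithin_apply, hd]
    rfl
  have h2 : ((extChartAt I p).symm ⁻¹' univ ∩ range I) = univ := by simp [I.range_eq_univ]
  have h4 : ∀ V₁ V₂ W₁ W₂ : EM → EM, V₁ =ᶠ[𝓝 (extChartAt I p p)] V₂ →
      W₁ =ᶠ[𝓝 (extChartAt I p p)] W₂ →
      VectorField.lieBracketWithin ℝ V₁ W₁ univ (extChartAt I p p) =
        fderiv ℝ W₂ (extChartAt I p p) (V₂ (extChartAt I p p)) -
          fderiv ℝ V₂ (extChartAt I p p) (W₂ (extChartAt I p p)) := by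
    intro V₁ V₂ W₁ W₂ h h'
    rw [VectorField.lieBracketWithin_univ, VectorField.lieBracket, h.fderiv_eq, h'.fderiv_eq,
      h.self_of_nhds, h'.self_of_nhds]
  have h3 : ∀ U : ∀ y : M, TangentSpace I y,
      ((fun y => coordAt EM (TangentSpace I : M → Type _) p y (U y)) ∘ (extChartAt I p).symm)
      (extChartAt I p p) = U p := by
    intro U
    rw [Function.comp_apply, extChartAt_to_inv]
    exact coordAt_tangent_self p (U p)
  rw [h1, h2]
  refine (h4 _ _ _ _ (key V) (key W)).trans ?_
  rw [h3, h3, mvfderiv_eq_fderiv ((along_coord hV).mdifferentiableAt (by simp)),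
    mvfderiv_eq_fderiv ((along_coord hW).mdifferentiableAt (by simp))]

end Bracket

end

noncomputable section

/-! ### Local sections of submersions -/

section LocalSection

variable {EM HM M : Type*} [NormedAddCommGroup EM] [NormedSpace ℝ EM]
  [TopologicalSpace HM] {I : ModelWithCorners ℝ EM HM} [I.Boundaryless] [TopologicalSpace M]
  [ChartedSpace HM M] [IsManifold I ∞ M]
  {EN HN N : Type*} [NormedAddCommGroup EN] [NormedSpace ℝ EN] [FiniteDimensional ℝ EN]
  [TopologicalSpace HN] {J : ModelWithCorners ℝ EN HN} [J.Boundaryless] [TopologicalSpace N]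
  [ChartedSpace HN N] [IsManifold J ∞ N]

/-- A submersion has smooth local sections. -/
theorem exists_local_section {f : M → N} {p : M} (hf : ContMDiffAt I J ∞ f p)
    (hs : Function.Surjective (mfderiv I J f p)) :
    ∃ σ : N → M, σ (f p) = p ∧ ContMDiffAt J I ∞ σ (f p) ∧ ∀ᶠ z in 𝓝 (f p), f (σ z) = z := by
  set g : EM → EN := writtenInExtChartAt I J p f with hg
  set s₀ := extChartAt I p p with hs₀
  have hgd : ContDiffAt ℝ ∞ g s₀ := by
    have := (contMDiffAt_iff.1 hf).2
    rw [I.range_eq_univ] at this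
    exact this
  have hD : ∀ v : EM, mfderiv I J f p v = fderiv ℝ g s₀ v := by
    intro v
    rw [(hf.mdifferentiableAt (by simp)).mfderiv, I.range_eq_univ, fderivWithin_univ]
    rfl
  obtain ⟨R, hR⟩ : ∃ R : EN →L[ℝ] EM, (fderiv ℝ g s₀).comp R = ContinuousLinearMap.id ℝ EN := by
    obtain ⟨R, hR⟩ := LinearMap.exists_rightInverse_of_surjective (fderiv ℝ g s₀).toLinearMap
      (LinearMap.range_eq_top.2 fun w => (hs w).imp fun v hv => (hD v).symm.trans hv)
    exact ⟨LinearMap.toContinuousLinearMap R, by ext v; exact LinearMap.congr_fun hR v⟩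
  set t₀ := g s₀ with ht₀
  have ht₀' : t₀ = extChartAt J (f p) (f p) := by
    rw [ht₀, hg, hs₀, writtenInExtChartAt, Function.comp_apply, Function.comp_apply,
      extChartAt_to_inv]
  -- An affine slice in the direction of the right inverse `R` of the differential. Along it `g ∘ h`
  -- has derivative the identity at `t₀`, so the inverse function theorem provides `τ`, and `h ∘ τ`
  -- is the section in charts.
  let h : EN → EM := fun t => s₀ + R (t - t₀)
  have hh : ContDiff ℝ ∞ h := contDiff_const.add (R.contDiff.comp (contDiff_id.sub contDiff_const))
  have hh0 : h t₀ = s₀ := by simp [h]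
  have hgd' : ContDiffAt ℝ ∞ g (h t₀) := hh0.symm ▸ hgd
  have hG : ContDiffAt ℝ ∞ (g ∘ h) t₀ := hgd'.comp t₀ hh.contDiffAt
  have hG' : HasFDerivAt (g ∘ h) ((ContinuousLinearEquiv.refl ℝ EN : EN ≃L[ℝ] EN) : EN →L[ℝ] EN)
      t₀ := by
    have h1 : HasFDerivAt h R t₀ := by
      have h2 : HasFDerivAt (fun t => R (t - t₀)) (R.comp (ContinuousLinearMap.id ℝ EN)) t₀ :=
        R.hasFDerivAt.comp t₀ ((hasFDerivAt_id t₀).sub_const t₀)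
      exact h2.const_add s₀
    have h2 : HasFDerivAt g (fderiv ℝ g s₀) (h t₀) := by
      rw [hh0]; exact (hgd.differentiableAt (by simp)).hasFDerivAt
    have h3 := h2.comp t₀ h1
    rw [hR] at h3
    exact h3
  have hGt : (g ∘ h) t₀ = t₀ := by simp only [Function.comp_apply, hh0]; rfl
  set τ := hG.localInverse hG' (by simp) with hτ
  have hτs : ContDiffAt ℝ ∞ τ t₀ := by
    have := hG.to_localInverse hG' (by simp)
    rwa [hGt] at this
  have hτ0 : τ t₀ = t₀ := by
    have := hG.localInverse_apply_image hG' (by simp)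
    rwa [hGt] at this
  have hτr : ∀ᶠ t in 𝓝 t₀, g (h (τ t)) = t := by
    have := (hG.hasStrictFDerivAt' hG' (by simp)).eventually_right_inverse
    rw [hGt] at this
    exact this
  have hcont : ContMDiffAt J 𝓘(ℝ, EM) ∞ (fun z => h (τ (extChartAt J (f p) z))) (f p) := by
    have h1 : ContMDiffAt 𝓘(ℝ, EN) 𝓘(ℝ, EM) ∞ (h ∘ τ) (extChartAt J (f p) (f p)) := by
      rw [← ht₀']
      exact ((hh.contDiffAt).comp t₀ hτs).contMDiffAt
    exact h1.comp (f p) contMDiffAt_extChartAt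
  have hval : h (τ (extChartAt J (f p) (f p))) = s₀ := by rw [← ht₀', hτ0, hh0]
  have hσ : ContMDiffAt J I ∞ (fun z => (extChartAt I p).symm (h (τ (extChartAt J (f p) z))))
      (f p) := by
    have h1 : ContMDiffAt 𝓘(ℝ, EM) I ∞ (extChartAt I p).symm (h (τ (extChartAt J (f p) (f p)))) := by
      rw [hval]
      exact (contMDiffOn_extChartAt_symm p).contMDiffAt (extChartAt_target_mem_nhds p)
    exact ContMDiffAt.comp (f p) h1 hcont
  have hp : (extChartAt I p).symm (h (τ (extChartAt J (f p) (f p)))) = p := by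
    rw [hval, hs₀, extChartAt_to_inv]
  refine ⟨fun z => (extChartAt I p).symm (h (τ (extChartAt J (f p) z))), hp, hσ, ?_⟩
  have hfσ : ContinuousAt (fun z => f ((extChartAt I p).symm (h (τ (extChartAt J (f p) z))))) (f p) :=
    ContinuousAt.comp' (f := fun z => (extChartAt I p).symm (h (τ (extChartAt J (f p) z))))
      (by rw [hp]; exact hf.continuousAt) hσ.continuousAt
  have hev1 : ∀ᶠ z in 𝓝 (f p), f ((extChartAt I p).symm (h (τ (extChartAt J (f p) z)))) ∈
      (extChartAt J (f p)).source := by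
    refine hfσ.eventually ?_
    simp only [hp]
    exact extChartAt_source_mem_nhds (f p)
  have hev2 : ∀ᶠ z in 𝓝 (f p), g (h (τ (extChartAt J (f p) z))) = extChartAt J (f p) z := by
    exact (continuousAt_extChartAt (I := J) (f p)).eventually
      (p := fun t => g (h (τ t)) = t) (by rw [← ht₀']; exact hτr)
  filter_upwards [hev1, hev2, extChartAt_source_mem_nhds (I := J) (f p)] with z h1 h2 h3
  exact (extChartAt J (f p)).injOn h1 h3 h2

end LocalSection

/-! ### The product rule in a local frame -/

section Product

variable {EN HN N : Type*} [NormedAddCommGroup EN] [NormedSpace ℝ EN] [TopologicalSpace HN]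
  {J : ModelWithCorners ℝ EN HN} [TopologicalSpace N] [ChartedSpace HN N]
  {EB HB B : Type*} [NormedAddCommGroup EB] [NormedSpace ℝ EB] [TopologicalSpace HB]
  {I : ModelWithCorners ℝ EB HB} [TopologicalSpace B] [ChartedSpace HB B]
  {F : Type*} [NormedAddCommGroup F] [NormedSpace ℝ F] [FiniteDimensional ℝ F]
  {E : B → Type*} [TopologicalSpace (TotalSpace F E)]
  [∀ x, AddCommGroup (E x)] [∀ x, Module ℝ (E x)] [∀ x, TopologicalSpace (E x)]
  [FiberBundle F E] [VectorBundle ℝ F E]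
  {W : Type*} [NormedAddCommGroup W] [NormedSpace ℝ W]

theorem mdifferentiableAt_fun_smul {c : N → ℝ} {f : N → W} {n : N}
    (hc : MDifferentiableAt J 𝓘(ℝ, ℝ) c n) (hf : MDifferentiableAt J 𝓘(ℝ, W) f n) :
    MDifferentiableAt J 𝓘(ℝ, W) (fun m => c m • f m) n :=
  hc.smul hf

theorem mvfderiv_finset_sum {ι : Type*} (s : Finset ι) {f : ι → N → W} {n : N}
    (hf : ∀ i, MDifferentiableAt J 𝓘(ℝ, W) (f i) n) (v : TangentSpace J n) :
    MDifferentiableAt J 𝓘(ℝ, W) (fun m => ∑ i ∈ s, f i m) n ∧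
    mvfderiv J (fun m => ∑ i ∈ s, f i m) n v = ∑ i ∈ s, mvfderiv J (f i) n v := by
  classical
  induction s using Finset.induction_on with
  | empty =>
    simp only [Finset.sum_empty, mvfderiv_const]
    exact ⟨mdifferentiableAt_const, rfl⟩
  | insert a s ha ih =>
    simp only [Finset.sum_insert ha]
    refine ⟨(hf a).add ih.1, ?_⟩
    rw [mvfderiv_fun_add (hf a) ih.1, ← ih.2]
    rfl

theorem mvfderiv_congr' {g h : N → W} {p : N} (e : g =ᶠ[𝓝 p] h) :
    mvfderiv J g p = mvfderiv J h p := by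
  ext v
  change mfderiv J 𝓘(ℝ, W) g p v = mfderiv J 𝓘(ℝ, W) h p v
  rw [e.mfderiv_eq]
  rfl

/-- The product rule for a family of linear maps applied to a family of vectors. -/
theorem mvfderiv_along_apply {b : N → B} {f : ∀ n, E (b n)} {n₀ : N} (Φ : ∀ n, E (b n) →ₗ[ℝ] W)
    (hb : ContMDiffAt J I ∞ b n₀)
    (hΦ : ∀ y : F, MDifferentiableAt J 𝓘(ℝ, W) (fun n => Φ n (coordSymm F E (b n₀) (b n) y)) n₀)
    (hf : MDifferentiableAt J 𝓘(ℝ, F) (fun n => coordAt F E (b n₀) (b n) (f n)) n₀)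
    (v : TangentSpace J n₀) :
    mvfderiv J (fun n => Φ n (f n)) n₀ v =
      mvfderiv J (fun n => Φ n (coordSymm F E (b n₀) (b n)
        (coordAt F E (b n₀) (b n₀) (f n₀)))) n₀ v +
      Φ n₀ (coordSymm F E (b n₀) (b n₀)
        (mvfderiv J (fun n => coordAt F E (b n₀) (b n) (f n)) n₀ v)) := by
  let β := Module.finBasis ℝ F
  set y := fun n => coordAt F E (b n₀) (b n) (f n) with hy
  have hβ : ∀ i, MDifferentiableAt J 𝓘(ℝ, ℝ) (fun n => β.coord i (y n)) n₀ := fun i =>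
    ((LinearMap.toContinuousLinearMap (β.coord i)).differentiableAt.mdifferentiableAt).comp n₀ hf
  have hβ' : ∀ i, mvfderiv J (fun n => β.coord i (y n)) n₀ v = β.coord i (mvfderiv J y n₀ v) := by
    intro i
    have h1 : MDifferentiableAt 𝓘(ℝ, F) 𝓘(ℝ, ℝ) (LinearMap.toContinuousLinearMap (β.coord i))
      (y n₀) := (LinearMap.toContinuousLinearMap (β.coord i)).differentiableAt.mdifferentiableAt
    have := mfderiv_comp_apply n₀ h1 hf v
    rw [mfderiv_eq_fderiv, ContinuousLinearMap.fderiv] at this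
    exact this
  have h1 : (fun n => Φ n (f n)) =ᶠ[𝓝 n₀] fun n => ∑ i, β.coord i (y n) •
      Φ n (coordSymm F E (b n₀) (b n) (β i)) := by
    filter_upwards [hb.continuousAt.eventually (eventually_mem_baseSet F E (b n₀))] with n hn
    conv_lhs => rw [← coordSymm_coordAt hn (f n), ← β.sum_repr (coordAt F E (b n₀) (b n) (f n))]
    simp only [map_sum, map_smul]
    rfl
  have h2 : (fun n => Φ n (coordSymm F E (b n₀) (b n) (y n₀))) = fun n => ∑ i, β.coord i (y n₀) •
      Φ n (coordSymm F E (b n₀) (b n) (β i)) := by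
    funext n
    conv_lhs => rw [← β.sum_repr (y n₀)]
    simp only [map_sum, map_smul]
    rfl
  have h3 : Φ n₀ (coordSymm F E (b n₀) (b n₀) (mvfderiv J y n₀ v)) =
      ∑ i, β.coord i (mvfderiv J y n₀ v) • Φ n₀ (coordSymm F E (b n₀) (b n₀) (β i)) := by
    conv_lhs => rw [← β.sum_repr (mvfderiv J y n₀ v)]
    simp only [map_sum, map_smul]
    rfl
  rw [mvfderiv_congr' h1, h2, h3, (mvfderiv_finset_sum _ (fun i => mdifferentiableAt_fun_smul (hβ i) (hΦ (β i))) v).2,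
    (mvfderiv_finset_sum _
      (fun i => mdifferentiableAt_fun_smul mdifferentiableAt_const (hΦ (β i))) v).2,
    ← Finset.sum_add_distrib]
  refine Finset.sum_congr rfl fun i _ => ?_
  rw [mvfderiv_fun_smul (hβ i) (hΦ (β i)), mvfderiv_fun_smul mdifferentiableAt_const (hΦ (β i)),
    mvfderiv_const]
  simp only [add_apply, smul_apply,
    ContinuousLinearMap.smulRight_apply, hβ', zero_apply, zero_smul, add_zero]

end Product

end

noncomputable section

/-! ### Bundles of homomorphisms and existence of Riemannian metrics -/

section Hom

variable {EN HN N : Type*} [NormedAddCommGroup EN] [NormedSpace ℝ EN] [TopologicalSpace HN]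
  {J : ModelWithCorners ℝ EN HN} [TopologicalSpace N] [ChartedSpace HN N]
  {EB HB B : Type*} [NormedAddCommGroup EB] [NormedSpace ℝ EB] [TopologicalSpace HB]
  {I : ModelWithCorners ℝ EB HB} [TopologicalSpace B] [ChartedSpace HB B]
  {F : Type*} [NormedAddCommGroup F] [NormedSpace ℝ F] [FiniteDimensional ℝ F]
  {E : B → Type*} [TopologicalSpace (TotalSpace F E)]
  [∀ x, AddCommGroup (E x)] [∀ x, Module ℝ (E x)] [∀ x, TopologicalSpace (E x)]
  [FiberBundle F E] [VectorBundle ℝ F E]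
  {F' : Type*} [NormedAddCommGroup F'] [NormedSpace ℝ F']
  {E' : B → Type*} [TopologicalSpace (TotalSpace F' E')]
  [∀ x, AddCommGroup (E' x)] [∀ x, Module ℝ (E' x)] [∀ x, TopologicalSpace (E' x)]
  [∀ x, IsTopologicalAddGroup (E' x)] [∀ x, ContinuousSMul ℝ (E' x)]
  [FiberBundle F' E'] [VectorBundle ℝ F' E']

/-- In a basis of the finite-dimensional space `F`, the map `A n` is a finite sum of rank-one maps,
each depending smoothly on the value of `A n` at one basis vector. -/
theorem contMDiffAt_clm_of_apply {A : N → F →L[ℝ] F'} {n₀ : N}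
    (h : ∀ y, ContMDiffAt J 𝓘(ℝ, F') ∞ (fun n => A n y) n₀) :
    ContMDiffAt J 𝓘(ℝ, F →L[ℝ] F') ∞ A n₀ := by
  let β := Module.finBasis ℝ F
  have h1 : ContMDiffAt J 𝓘(ℝ, F →L[ℝ] F') ∞ (fun n => ∑ i,
      ContinuousLinearMap.smulRightL ℝ F F' (LinearMap.toContinuousLinearMap (β.coord i))
        (A n (β i))) n₀ := by
    refine ContMDiffAt.sum fun i _ => ?_
    exact ((ContinuousLinearMap.contMDiff _).contMDiffAt.comp n₀ (h (β i)))
  refine h1.congr_of_eventuallyEq (Eventually.of_forall fun n => ?_)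
  ext y
  conv_lhs => rw [← β.sum_repr y]
  simp only [map_sum, map_smul, sum_apply, ContinuousLinearMap.smulRightL_apply_apply]
  rfl

/-- A section of a bundle of homomorphisms is smooth if it maps local frames to smooth sections. -/
theorem along_hom {b : N → B} {n₀ : N} (hb : ContMDiffAt J I ∞ b n₀)
    {Φ : ∀ n, E (b n) →L[ℝ] E' (b n)}
    (hΦ : ∀ y : F, ContMDiffAt J (I.prod 𝓘(ℝ, F')) ∞
      (fun n => TotalSpace.mk' F' (b n) (Φ n (coordSymm F E (b n₀) (b n) y))) n₀) :
    ContMDiffAt J (I.prod 𝓘(ℝ, F →L[ℝ] F')) ∞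
      (fun n => TotalSpace.mk' (F →L[ℝ] F') (E := fun x => E x →L[ℝ] E' x) (b n) (Φ n)) n₀ := by
  rw [contMDiffAt_hom_bundle]
  exact ⟨hb, contMDiffAt_clm_of_apply fun y => along_coord (hΦ y)⟩

theorem along_trivial_iff {b : N → B} {n₀ : N} (hb : ContMDiffAt J I ∞ b n₀) {f : N → F'} :
    ContMDiffAt J (I.prod 𝓘(ℝ, F')) ∞
      (fun n => TotalSpace.mk' F' (E := Bundle.Trivial B F') (b n) (f n)) n₀ ↔
      ContMDiffAt J 𝓘(ℝ, F') ∞ f n₀ := by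
  rw [contMDiffAt_totalSpace]
  simp only [hb, true_and]
  rfl

variable (I F E) in
-- Symmetric positive definite forms make up a convex subset of each fibre, so a partition of unity
-- glues the local forms given by sums of squares of fibre coordinates.
theorem exists_smooth_innerProduct [FiniteDimensional ℝ EB] [T2Space B] [SigmaCompactSpace B]
    [IsManifold I ∞ B] [∀ x, IsTopologicalAddGroup (E x)] [∀ x, ContinuousSMul ℝ (E x)]
    [ContMDiffVectorBundle ∞ F E I] :
    ∃ s : ContMDiffSection I (F →L[ℝ] F →L[ℝ] ℝ) ∞ (fun x => E x →L[ℝ] E x →L[ℝ] ℝ),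
      ∀ x, (∀ v w, s x v w = s x w v) ∧ ∀ v, v ≠ 0 → 0 < s x v v := by
  have h1 : ∀ x, IsTopologicalAddGroup (E x →L[ℝ] ℝ) := fun x =>
    ContinuousLinearMap.topologicalAddGroup
  have h2 : ∀ x, ContinuousAdd (E x →L[ℝ] ℝ) := fun x => (h1 x).toContinuousAdd
  let t : ∀ x : B, Set (E x →L[ℝ] E x →L[ℝ] ℝ) := fun s =>
    {b | (∀ v w, b v w = b w v) ∧ ∀ v, v ≠ 0 → 0 < b v v}
  let β := Module.finBasis ℝ F
  refine exists_contMDiffSection_forall_mem_convex_of_local I (n := ⊤) _ t ?_ ?_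
  · intro x A hA C hC a b ha hb hab
    refine ⟨fun v w => ?_, fun v hv => ?_⟩
    · simp only [add_apply, smul_apply, hA.1 v w, hC.1 v w]
    · simp only [add_apply, smul_apply, smul_eq_mul]
      rcases ha.eq_or_lt with rfl | ha
      · have hb1 : b = 1 := by linarith
        simpa [hb1] using hC.2 v hv
      · exact add_pos_of_pos_of_nonneg (mul_pos ha (hA.2 v hv)) (mul_nonneg hb (hC.2 v hv).le)
  · intro x₀
    let l : ∀ i, ∀ y : B, E y →L[ℝ] ℝ := fun i y =>
      LinearMap.toContinuousLinearMap (β.coord i) ∘L coordAt F E x₀ y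
    have hl : ∀ y v w, (∑ i, (l i y).smulRight (l i y) : E y →L[ℝ] E y →L[ℝ] ℝ) v w =
        ∑ i, l i y v * l i y w := by
      intro y v w
      simp only [sum_apply, ContinuousLinearMap.smulRight_apply, smul_apply, smul_eq_mul]
    refine ⟨_, eventually_mem_baseSet F E x₀, fun y => ∑ i, (l i y).smulRight (l i y), ?_, ?_⟩
    · intro y hy
      refine ContMDiffAt.contMDiffWithinAt ?_
      have hls : ∀ i z, ContMDiffAt I 𝓘(ℝ, ℝ) ∞ (fun x => l i x (coordSymm F E y x z)) y := by
        intro i z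
        have h1 := (Trivialization.contMDiffAt_section_iff (trivializationAt F E x₀) hy).1
          (contMDiffAt_coordSymm (I := I) (F := F) (E := E) y
            (mem_baseSet_trivializationAt F E y) z)
        refine (LinearMap.toContinuousLinearMap (β.coord i)).contMDiff.contMDiffAt.comp y
          (h1.congr_of_eventuallyEq ?_)
        filter_upwards [(trivializationAt F E x₀).open_baseSet.mem_nhds hy] with x hx
        exact coordAt_apply hx _
      refine along_hom contMDiffAt_id fun v => along_hom (E' := Bundle.Trivial B ℝ) contMDiffAt_id
        fun w => (along_trivial_iff contMDiffAt_id).2 ?_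
      simp only [id, hl]
      exact ContMDiffAt.sum fun i _ => (hls i v).mul (hls i w)
    · intro y hy
      refine ⟨fun v w => ?_, fun v hv => ?_⟩
      · simp only [hl, mul_comm]
      · simp only [hl]
        refine lt_of_le_of_ne (Finset.sum_nonneg fun i _ => mul_self_nonneg _) fun h0 => hv ?_
        rw [eq_comm, Finset.sum_eq_zero_iff_of_nonneg fun i _ => mul_self_nonneg _] at h0
        have h1 : coordAt F E x₀ y v = 0 := by
          refine β.ext_elem fun i => ?_
          have h2 : l i y v = 0 := by simpa using h0 i (Finset.mem_univ i)
          rw [map_zero]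
          exact h2
        rw [← coordSymm_coordAt hy v, h1, map_zero]

end Hom

section Mfd

variable {X S : SmoothMfd.{u}}

theorem smoothFieldOn_univ {Y : ∀ x : X, X.T x} : SmoothFieldOn X Y univ ↔
    ∀ x, ContMDiffAt X.I (X.I.prod 𝓘(ℝ, X.model)) ∞
      (fun x => TotalSpace.mk' X.model (E := fun x : X => X.T x) x (Y x)) x :=
  contMDiffOn_univ

theorem exists_smoothField (x : X) (w : X.T x) :
    ∃ Y : ∀ x : X, X.T x, SmoothFieldOn X Y univ ∧ Y x = w := by
  obtain ⟨Y, hY, h⟩ := exists_smooth_section_apply_eq (I := X.I) (F := X.model)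
    (E := fun x : X => X.T x) x w
  exact ⟨Y, hY.contMDiffOn, h⟩

/-- By compactness of the unit sphere, `B v v` is bounded below by a positive multiple of `‖v‖ ^ 2`.
This serves the boundedness clause in the definition of a Riemannian metric. -/
theorem isVonNBounded_of_pos {V : Type*} [NormedAddCommGroup V] [NormedSpace ℝ V]
    [FiniteDimensional ℝ V] (B : V →L[ℝ] V →L[ℝ] ℝ) (hpos : ∀ v, v ≠ 0 → 0 < B v v) :
    Bornology.IsVonNBounded ℝ {v | B v v < 1} := by
  have hc : Continuous fun v => B v v := by fun_prop
  obtain ⟨c, hc0, hc⟩ : ∃ c > 0, ∀ v, c * ‖v‖ ^ 2 ≤ B v v := by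
    rcases subsingleton_or_nontrivial V with h | h
    · exact ⟨1, one_pos, fun v => by simp [Subsingleton.elim v 0]⟩
    · obtain ⟨w, hw, hmin⟩ := (isCompact_sphere (0 : V) 1).exists_isMinOn
        (NormedSpace.sphere_nonempty.2 zero_le_one) hc.continuousOn
      have hw0 : w ≠ 0 := by rintro rfl; simp at hw
      refine ⟨B w w, hpos w hw0, fun v => ?_⟩
      rcases eq_or_ne v 0 with rfl | hv
      · simp
      have hn : ‖v‖ ≠ 0 := norm_ne_zero_iff.2 hv
      have := hmin (show ‖v‖⁻¹ • v ∈ Metric.sphere (0 : V) 1 by simp [norm_smul, hn])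
      simp only [mem_ofPred_eq, map_smul, smul_apply, smul_eq_mul] at this
      calc B w w * ‖v‖ ^ 2 ≤ (‖v‖⁻¹ * (‖v‖⁻¹ * B v v)) * ‖v‖ ^ 2 := by gcongr
        _ = B v v := by field_simp
  rw [NormedSpace.isVonNBounded_iff]
  -- Beyond radius `max 1 c⁻¹` both `‖v‖` and `c * ‖v‖` exceed `1`, and hence so does `c * ‖v‖ ^ 2`.
  refine (Metric.isBounded_closedBall (x := (0 : V)) (r := max 1 c⁻¹)).subset fun v hv => ?_
  simp only [mem_closedBall_zero_iff]
  by_contra! h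
  have h1 : 1 < ‖v‖ := (le_max_left _ _).trans_lt h
  have h2 : c⁻¹ < ‖v‖ := (le_max_right _ _).trans_lt h
  have h3 : 1 < c * ‖v‖ := by rwa [inv_lt_iff_one_lt_mul₀' hc0] at h2
  have h4 := hc v
  have h5 : B v v < 1 := hv
  nlinarith

theorem exists_riemannianMetric (S : SmoothMfd.{u}) :
    Nonempty (ContMDiffRiemannianMetric S.I ∞ S.model (fun s : S => S.T s)) := by
  have : LocallyCompactSpace S := Manifold.locallyCompact_of_finiteDimensional S.I
  have : SigmaCompactSpace S := sigmaCompactSpace_of_locallyCompact_secondCountable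
  obtain ⟨s, hs⟩ := exists_smooth_innerProduct (I := S.I) (F := S.model) (E := fun s : S => S.T s)
  exact ⟨{
    inner := s
    symm := fun b => (hs b).1
    pos := fun b => (hs b).2
    isVonNBounded := fun b => isVonNBounded_of_pos (V := S.model) (s b) (hs b).2
    contMDiff := s.contMDiff }⟩

end Mfd

end

noncomputable section

/-! ### The Levi-Civita connection of a smooth metric -/

section Coord

variable {EN HN N : Type*} [NormedAddCommGroup EN] [NormedSpace ℝ EN] [TopologicalSpace HN]
  {J : ModelWithCorners ℝ EN HN} [TopologicalSpace N] [ChartedSpace HN N]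
  {EB HB B : Type*} [NormedAddCommGroup EB] [NormedSpace ℝ EB] [TopologicalSpace HB]
  {I : ModelWithCorners ℝ EB HB} [TopologicalSpace B] [ChartedSpace HB B]
  {F : Type*} [NormedAddCommGroup F] [NormedSpace ℝ F]
  {E : B → Type*} [TopologicalSpace (TotalSpace F E)]
  [∀ x, AddCommGroup (E x)] [∀ x, Module ℝ (E x)] [∀ x, TopologicalSpace (E x)]
  [FiberBundle F E] [VectorBundle ℝ F E]

/-- The axioms of a covariant derivative concern sections that are merely differentiable at a point,
so the coordinate criterion is needed in this regularity too. -/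
theorem along_mdifferentiableAt_coord {b : N → B} {f : ∀ n, E (b n)} {n₀ : N}
    (h : MDifferentiableAt J (I.prod 𝓘(ℝ, F)) (fun n => TotalSpace.mk' F (b n) (f n)) n₀) :
    MDifferentiableAt J I b n₀ ∧
      MDifferentiableAt J 𝓘(ℝ, F) (fun n => coordAt F E (b n₀) (b n) (f n)) n₀ := by
  obtain ⟨h1, h2⟩ := (mdifferentiableAt_totalSpace I _).1 h
  refine ⟨h1, h2.congr_of_eventuallyEq ?_⟩
  filter_upwards [h1.continuousAt.eventually (eventually_mem_baseSet F E (b n₀))] with n hn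
  exact coordAt_apply hn _

end Coord

/-- Here `S a b w` plays the role of the derivative of the metric coefficient of `a`, `b` along `w`
at one point. Nondegeneracy of `B` represents the Koszul combination `(S a c w + S w c a - S w a c)
/ 2`, as a linear form in `c`, by a vector `Γ a w`. Symmetry of `Γ` will give the vanishing of
torsion, and the second identity compatibility with the metric. -/
theorem exists_christoffel {V : Type*} [AddCommGroup V] [Module ℝ V] [FiniteDimensional ℝ V]
    (B : LinearMap.BilinForm ℝ V) (hB : ∀ v w, B v w = B w v) (hpos : ∀ v, v ≠ 0 → 0 < B v v)
    (S : V → V → V →ₗ[ℝ] ℝ) (hS : ∀ a b w, S a b w = S b a w)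
    (hadd : ∀ a a' b w, S (a + a') b w = S a b w + S a' b w)
    (hsmul : ∀ (r : ℝ) a b w, S (r • a) b w = r * S a b w) :
    ∃ Γ : V →ₗ[ℝ] V →ₗ[ℝ] V, (∀ a w, Γ a w = Γ w a) ∧
      ∀ a b w, S a b w = B (Γ a w) b + B a (Γ b w) := by
  have hinj : ∀ u v, (∀ c, B u c = B v c) → u = v := by
    intro u v h
    by_contra hne
    have := hpos (u - v) (sub_ne_zero.2 hne)
    simp [h] at this
  have hex : ∀ l : V →ₗ[ℝ] ℝ, ∃ u, ∀ c, B u c = l c := by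
    intro l
    have hi : Function.Injective B := fun u v h => hinj u v fun c => LinearMap.congr_fun h c
    obtain ⟨u, hu⟩ := (LinearMap.injective_iff_surjective_of_finrank_eq_finrank
      (Subspace.dual_finrank_eq (K := ℝ) (V := V)).symm (f := B)).1 hi l
    exact ⟨u, fun c => LinearMap.congr_fun hu c⟩
  have hadd' : ∀ a b b' w, S a (b + b') w = S a b w + S a b' w := fun a b b' w => by
    rw [hS, hadd, hS b, hS b']
  have hsmul' : ∀ (r : ℝ) a b w, S a (r • b) w = r * S a b w := fun r a b w => by
    rw [hS, hsmul, hS b]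
  have hl : ∀ a w, ∃ l : V →ₗ[ℝ] ℝ, ∀ c, l c = (1 / 2 : ℝ) * (S a c w + S w c a - S w a c) := by
    intro a w
    refine ⟨{ toFun := fun c => (1 / 2 : ℝ) * (S a c w + S w c a - S w a c)
              map_add' := fun c c' => ?_
              map_smul' := fun r c => ?_ }, fun c => rfl⟩
    · rw [hadd', hadd', map_add]; ring
    · rw [hsmul', hsmul', map_smul]; simp only [smul_eq_mul, RingHom.id_apply]; ring
  choose l hl using hl
  choose γ hγ using fun a w => hex (l a w)
  have hγ' : ∀ a w c, B (γ a w) c = (1 / 2 : ℝ) * (S a c w + S w c a - S w a c) := by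
    intro a w c; rw [hγ, hl]
  refine ⟨LinearMap.mk₂ ℝ γ ?_ ?_ ?_ ?_, ?_, ?_⟩
  · intro a a' w; refine hinj _ _ fun c => ?_
    simp only [map_add, LinearMap.add_apply, hγ', hadd, hadd']; ring
  · intro r a w; refine hinj _ _ fun c => ?_
    simp only [map_smul, LinearMap.smul_apply, hγ', smul_eq_mul, hsmul, hsmul']; ring
  · intro a w w'; refine hinj _ _ fun c => ?_
    simp only [map_add, LinearMap.add_apply, hγ', hadd]; ring
  · intro r a w; refine hinj _ _ fun c => ?_
    simp only [map_smul, LinearMap.smul_apply, hγ', smul_eq_mul, hsmul]; ring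
  · intro a w
    refine hinj _ _ fun c => ?_
    simp only [LinearMap.mk₂_apply, hγ']
    rw [hS w a c]; ring
  · intro a b w
    rw [hB a]
    simp only [LinearMap.mk₂_apply, hγ']
    rw [hS b a w]; ring

section Mfd

variable {X S : SmoothMfd.{u}}

/-- Smoothness at `x` of a vector field. -/
abbrev SmoothFieldAt (X : SmoothMfd.{u}) (Y : ∀ x : X, X.T x) (x : X) : Prop :=
  ContMDiffAt X.I (X.I.prod 𝓘(ℝ, X.model)) ∞
      (fun x => TotalSpace.mk' X.model (E := fun x : X => X.T x) x (Y x)) x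

variable (X) in
/-- The coordinate `T_y X → X.model` in the preferred trivialization at `x`. -/
abbrev tcoord (x y : X) : X.T y →L[ℝ] X.model := coordAt X.model (fun x : X => X.T x) x y

variable (X) in
abbrev tframe (x y : X) : X.model →L[ℝ] X.T y := coordSymm X.model (fun x : X => X.T x) x y

theorem tcoord_self (x : X) (v : X.T x) : tcoord X x x v = v := coordAt_tangent_self x v

theorem tframe_self (x : X) (v : X.T x) : tframe X x x v = v := by
  have h := coordSymm_coordAt (F := X.model) (E := fun x : X => X.T x)
    (mem_baseSet_trivializationAt X.model (fun x : X => X.T x) x) v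
  exact (congrArg (tframe X x x) (tcoord_self x v)).symm.trans h

/-- A smooth metric has a Levi-Civita connection. -/
theorem exists_leviCivita (m : ∀ x : X, LinearMap.BilinForm ℝ (X.T x))
    (hm : ∀ x v w, m x v w = m x w v) (hpos : ∀ x v, v ≠ 0 → 0 < m x v v)
    (hsm : ∀ (Y Z : ∀ x : X, X.T x) (x : X), SmoothFieldAt X Y x → SmoothFieldAt X Z x →
      ContMDiffAt X.I 𝓘(ℝ, ℝ) ∞ (fun y => m y (Y y) (Z y)) x) :
    ∃ D, IsLeviCivita X (fun x v w => m x v w) D := by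
  have hfr : ∀ (x : X) (a : X.model), SmoothFieldAt X (fun y => tframe X x y a) x := fun x a =>
    contMDiffAt_coordSymm x (mem_baseSet_trivializationAt _ _ x) a
  have hT : ∀ x (a b : X.model), MDifferentiableAt X.I 𝓘(ℝ, ℝ)
      (fun y => m y (tframe X x y a) (tframe X x y b)) x := fun x a b =>
    (hsm _ _ x (hfr x a) (hfr x b)).mdifferentiableAt (by simp)
  -- The Christoffel symbols at `x` refer to the frame of the trivialization centred at `x` and are
  -- chosen for each point separately.
  have hex : ∀ x : X, ∃ Γ : X.model →ₗ[ℝ] X.model →ₗ[ℝ] X.model, (∀ a w, Γ a w = Γ w a) ∧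
      ∀ a b w, mvfderiv X.I (fun y => m y (tframe X x y a) (tframe X x y b)) x w =
        m x (Γ a w) b + m x a (Γ b w) := by
    intro x
    have hfd : FiniteDimensional ℝ (X.T x) := inferInstanceAs (FiniteDimensional ℝ X.model)
    have hsymm : ∀ a b : X.model, (fun y => m y (tframe X x y a) (tframe X x y b)) =
        fun y => m y (tframe X x y b) (tframe X x y a) := fun a b => funext fun y => hm _ _ _
    refine exists_christoffel (V := X.T x) (m x) (hm x) (hpos x) (fun a b =>
      (mvfderiv X.I (fun y => m y (tframe X x y a) (tframe X x y b)) x).toLinearMap) ?_ ?_ ?_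
    · intro a b w
      exact congrArg (fun f => mvfderiv X.I f x w) (hsymm a b)
    · intro a a' b w
      have h1 : (fun y => m y (tframe X x y ((a + a' : X.model))) (tframe X x y b)) =
          fun y => m y (tframe X x y a) (tframe X x y b) +
            m y (tframe X x y a') (tframe X x y b) := by
        funext y
        exact (congrArg (fun v => m y v (tframe X x y b)) (map_add (tframe X x y) _ _)).trans
          (congrArg (fun l => l (tframe X x y b)) (map_add (m y) _ _))
      exact (congrArg (fun f => mvfderiv X.I f x w) h1).trans
        (congrArg (fun l : X.T x →L[ℝ] ℝ => l w) (mvfderiv_fun_add (hT x a b) (hT x a' b)))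
    · intro r a b w
      have h1 : (fun y => m y (tframe X x y ((r • a : X.model))) (tframe X x y b)) =
          fun y => r • m y (tframe X x y a) (tframe X x y b) := by
        funext y
        exact (congrArg (fun v => m y v (tframe X x y b)) (map_smul (tframe X x y) _ _)).trans
          (congrArg (fun l => l (tframe X x y b)) (map_smul (m y) _ _))
      refine (congrArg (fun f => mvfderiv X.I f x w) h1).trans ?_
      refine (congrArg (fun l : X.T x →L[ℝ] ℝ => l w)
          (mvfderiv_fun_smul (mdifferentiableAt_const (c := r)) (hT x a b))).trans ?_
      rw [mvfderiv_const]
      simp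
  choose Γ hΓ hΓm using hex
  have hco : ∀ {x : X} {σ : ∀ x : X, X.T x}, MDifferentiableAt X.I (X.I.prod 𝓘(ℝ, X.model))
      (fun x => TotalSpace.mk' X.model (E := fun x : X => X.T x) x (σ x)) x →
      MDifferentiableAt X.I 𝓘(ℝ, X.model) (fun y => tcoord X x y (σ y)) x := fun h =>
    (along_mdifferentiableAt_coord (b := id) h).2
  let d : (∀ x : X, X.T x) → ∀ x : X, X.model →L[ℝ] X.model := fun Z x =>
    mvfderiv X.I (fun y => tcoord X x y (Z y)) x
  let Γ' : X → X.model → X.model →L[ℝ] X.model := fun x a =>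
    LinearMap.toContinuousLinearMap (Γ x a)
  -- No change of coordinates appears, since the trivialization centred at `x` is the identity over
  -- `x`. That the frame varies with `x` is harmless: the axioms of a connection, torsion-freeness
  -- and metricity are all checked at one point at a time.
  let cov : (∀ x : X, X.T x) → ∀ x : X, X.T x →L[ℝ] X.T x := fun Z x => d Z x + Γ' x (Z x)
  have hcov : ∀ Z x w, cov Z x w =
      ((d Z x w : X.model) + Γ x (Z x) w : X.model) :=
    fun Z x w => rfl
  have hcd : IsCovariantDerivativeOn X.model cov univ := by
    refine ⟨?_, ?_⟩
    · intro σ σ' x hσ hσ' _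
      ext w
      have h1 := congrArg (fun l : X.model →L[ℝ] X.model => l w)
        (mvfderiv_fun_add (hco hσ) (hco hσ'))
      have h2 : (fun y => tcoord X x y ((σ + σ') y)) =
          fun y => tcoord X x y (σ y) + tcoord X x y (σ' y) := funext fun y => map_add _ _ _
      have h3 : Γ x ((σ + σ') x) w = Γ x (σ x) w + Γ x (σ' x) w :=
        LinearMap.congr_fun (map_add (Γ x) (σ x) (σ' x)) w
      have h4 : d (σ + σ') x w = (d σ x w + d σ' x w : X.model) :=
        (congrArg (fun f => mvfderiv X.I f x w) h2).trans h1
      refine (congrArg₂ (fun a b : X.model => a + b) h4 h3).trans ?_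
      exact add_add_add_comm (G := X.model) _ _ _ _
    · intro σ g x hσ hg _
      ext w
      have h1 := congrArg (fun l : X.model →L[ℝ] X.model => l w)
        (mvfderiv_fun_smul hg (hco hσ))
      have h2 : (fun y => tcoord X x y ((g • σ) y)) =
          fun y => g y • tcoord X x y (σ y) := funext fun y => map_smul _ _ _
      have h3 : Γ x ((g • σ) x) w = g x • Γ x (σ x) w :=
        LinearMap.congr_fun (map_smul (Γ x) (g x) (σ x)) w
      let σx : X.model := σ x
      have h4 : d (g • σ) x w = (g x • d σ x w + mvfderiv X.I g x w • σx : X.model) := by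
        refine ((congrArg (fun f => mvfderiv X.I f x w) h2).trans h1).trans ?_
        exact congrArg (fun v : X.model => (g x • d σ x w + mvfderiv X.I g x w • v : X.model))
          (tcoord_self x (σ x))
      refine (congrArg₂ (fun a b : X.model => a + b) h4 h3).trans ?_
      change _ = g x • (d σ x w + Γ x (σ x) w : X.model) + mvfderiv X.I g x w • σx
      rw [smul_add]
      exact add_right_comm (G := X.model) _ _ _
  refine ⟨⟨cov, hcd⟩, ?_, ?_⟩
  · intro Y Z hY hZ x
    rw [smoothFieldOn_univ] at hY hZ
    refine Eq.trans ?_ (mlieBracket_eq (hY x) (hZ x)).symm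
    change (mvfderiv X.I (fun y => tcoord X x y (Z y)) x (Y x) + Γ x (Z x) (Y x) : X.model) -
      (mvfderiv X.I (fun y => tcoord X x y (Y y)) x (Z x) + Γ x (Y x) (Z x) : X.model) = _
    have := hΓ x (Y x) (Z x)
    rw [this]
    exact add_sub_add_right_eq_sub (G := X.model) _ _ _
  · intro Y Z hY hZ x w
    rw [smoothFieldOn_univ] at hY hZ
    have hYc := (along_coord (hY x)).mdifferentiableAt (by simp)
    have hZc := (along_coord (hZ x)).mdifferentiableAt (by simp)
    -- The product rule is applied to one argument of the metric after the other; what then remains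
    -- is the derivative of a metric coefficient in the frame at `x`, which `Γ` was chosen to match.
    have h1 := mvfderiv_along_apply (J := X.I) (I := X.I) (b := id) (F := X.model)
      (E := fun x : X => X.T x) (f := Y) (n₀ := x) (fun y => (m y).flip (Z y)) contMDiffAt_id
      (fun a => (hsm _ _ x (hfr x a) (hZ x)).mdifferentiableAt (by simp)) hYc w
    have h2 := mvfderiv_along_apply (J := X.I) (I := X.I) (b := id) (F := X.model)
      (E := fun x : X => X.T x) (f := Z) (n₀ := x)
      (fun y => m y (tframe X x y (tcoord X x x (Y x)))) contMDiffAt_id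
      (fun a => (hsm _ _ x (hfr x _) (hfr x a)).mdifferentiableAt (by simp)) hZc w
    refine h1.trans ?_
    refine (congrArg (· + _) h2).trans ?_
    have e1 : ∀ v : X.T x, tframe X x x (tcoord X x x v) = v := fun v =>
      (congrArg _ (tcoord_self x v)).trans (tframe_self x v)
    have h5 : ∀ a : X.model, tframe X x x a = a := fun a => tframe_self x a
    have h6 : ∀ v : X.T x, tcoord X x x v = v := fun v => tcoord_self x v
    have h3 : mvfderiv X.I (fun y => m y (tframe X x y (tcoord X x x (Y x)))
        (tframe X x y (tcoord X x x (Z x)))) x w =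
        m x (Γ x (Y x) w) (Z x) + m x (Y x) (Γ x (Z x) w) := by
      refine (hΓm x (tcoord X x x (Y x)) (tcoord X x x (Z x)) w).trans ?_
      rw [h6, h6]
    have h7 : m x (tframe X x x (tcoord X x x (Y x))) (tframe X x x (d Z x w)) =
        m x (Y x) (d Z x w) := by
      rw [e1]; exact congrArg _ (h5 _)
    have h8 : m x (tframe X x x (d Y x w)) (Z x) = m x (d Y x w) (Z x) :=
      congrArg (fun v => m x v (Z x)) (h5 _)
    have h9 : m x (cov Y x w) (Z x) = m x (d Y x w) (Z x) + m x (Γ x (Y x) w) (Z x) :=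
      (congrArg (fun l => l (Z x)) (map_add (m x) (d Y x w) (Γ x (Y x) w)))
    have h10 : m x (Y x) (cov Z x w) = m x (Y x) (d Z x w) + m x (Y x) (Γ x (Z x) w) :=
      map_add (m x (Y x)) (d Z x w) (Γ x (Z x) w)
    refine (congrArg₂ (fun r s => r + s) (congrArg₂ (fun r s => r + s) h3 h7) h8).trans ?_
    refine Eq.trans ?_ (congrArg₂ (fun r s => r + s) h9 h10).symm
    ring

end Mfd

end

noncomputable section

theorem baseSet_mem_nhds {B : Type*} [TopologicalSpace B] (F : Type*) [TopologicalSpace F]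
    (E : B → Type*) [TopologicalSpace (TotalSpace F E)] [∀ x, TopologicalSpace (E x)]
    [FiberBundle F E] (x : B) : (trivializationAt F E x).baseSet ∈ 𝓝 x :=
  (trivializationAt F E x).open_baseSet.mem_nhds (mem_baseSet_trivializationAt F E x)

/-! ### Distributions, metrics and Clifford modules along arbitrary smooth maps -/

section Family

variable {EN HN N : Type*} [NormedAddCommGroup EN] [NormedSpace ℝ EN] [TopologicalSpace HN]
  {J : ModelWithCorners ℝ EN HN} [TopologicalSpace N] [ChartedSpace HN N]
  {X S : SmoothMfd.{u}}

/-- Smoothness at `n` of a family of tangent vectors `f n ∈ T_{b n} X`. -/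
abbrev SmoothAlong (J : ModelWithCorners ℝ EN HN) (X : SmoothMfd.{u}) (b : N → X)
    (f : ∀ n, X.T (b n)) (n : N) : Prop :=
  ContMDiffAt J (X.I.prod 𝓘(ℝ, X.model)) ∞
    (fun n => TotalSpace.mk' X.model (E := fun x : X => X.T x) (b n) (f n)) n

/-- Smoothness at `n` of a family of elements `f n ∈ E_{b n}`. -/
abbrev ComplexBundle.SmoothAlong (J : ModelWithCorners ℝ EN HN) (E : ComplexBundle X) (b : N → X)
    (f : ∀ n, E.fib (b n)) (n : N) : Prop :=
  ContMDiffAt J E.ITot ∞ (fun n => TotalSpace.mk' E.F (b n) (f n)) n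

instance (E : ComplexBundle X) : FiniteDimensional ℝ E.F := FiniteDimensional.complexToReal E.F

theorem mfderiv_along {pr : X → S} (hpr : ContMDiff X.I S.I ∞ pr) {b : N → X} {f : ∀ n, X.T (b n)}
    {n : N} (hf : SmoothAlong J X b f n) :
    SmoothAlong J S (fun n => pr (b n)) (fun n => mfderiv X.I S.I pr (b n) (f n)) n := by
  have h1 : ContMDiff X.I.tangent S.I.tangent ∞ (tangentMap X.I S.I pr) :=
    hpr.contMDiff_tangentMap (by simp)
  exact h1.contMDiffAt.comp n hf

theorem smoothAlong_comp {Y : ∀ x : X, X.T x} {b : N → X} {n : N}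
    (hY : SmoothFieldAt X Y (b n)) (hb : ContMDiffAt J X.I ∞ b n) :
    SmoothAlong J X b (fun n => Y (b n)) n :=
  ContMDiffAt.comp n hY hb

theorem smoothFieldOn_frame (x : X) (y : X.model) :
    SmoothFieldOn X (fun z => tframe X x z y)
      (trivializationAt X.model (fun x : X => X.T x) x).baseSet := fun _ hz =>
  (contMDiffAt_coordSymm x hz y).contMDiffWithinAt

theorem ComplexBundle.smoothOn_frame (E : ComplexBundle X) (x : X) (y : E.F) :
    E.SmoothOn (fun z => coordSymm E.F E.fib x z y) (trivializationAt E.F E.fib x).baseSet :=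
  fun _ hz => (contMDiffAt_coordSymm x hz y).contMDiffWithinAt

section Distribution

variable {pr : X → S} {H : ∀ x : X, Submodule ℝ (X.T x)}

theorem vertProj_coe (h : IsHorizontal pr H) (x : X) (v : vert pr x) : vertProj h x v = v :=
  Submodule.projectionOnto_apply_left _ v

theorem vertProj_eq_zero_iff (h : IsHorizontal pr H) {x : X} {v : X.T x} :
    vertProj h x v = 0 ↔ v ∈ H x :=
  Submodule.projectionOnto_apply_eq_zero_iff _

theorem mem_vert {x : X} {v : X.T x} : v ∈ vert pr x ↔ mfderiv X.I S.I pr x v = 0 := Iff.rfl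

variable (h : IsHorizontalDistribution pr H)
include h

theorem smoothFieldAt_vertProj_frame (x : X) (y : X.model) :
    SmoothFieldAt X (fun z => (vertProj h.horizontal z (tframe X x z y) : X.T z)) x :=
  (h.smooth _ _ (trivializationAt X.model (fun x : X => X.T x) x).open_baseSet
    (smoothFieldOn_frame x y)).contMDiffAt (baseSet_mem_nhds _ _ _)

/-- The definition of a smooth distribution speaks of vector fields on open sets of `X`. Applied to
local frames and combined with linearity, it controls vectors along any map, in particular along `Q
× X → X`. -/
theorem vertProj_along {b : N → X} {f : ∀ n, X.T (b n)} {n : N} (hf : SmoothAlong J X b f n) :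
    SmoothAlong J X b (fun n => (vertProj h.horizontal (b n) (f n) : X.T (b n))) n :=
  along_map (E := fun x : X => X.T x) (E' := fun x : X => X.T x) (along_base hf)
    (fun n => (vert pr (b n)).subtype ∘ₗ vertProj h.horizontal (b n))
    (fun y => smoothAlong_comp (smoothFieldAt_vertProj_frame h (b n) y) (along_base hf)) hf

/-- A family of tangent vectors is smooth if its image in the base and its vertical part are. -/
theorem smoothAlong_of_mfderiv_of_vertProj (hpr : ContMDiff X.I S.I ∞ pr) {b : N → X}
    {f : ∀ n, X.T (b n)} {n : N} (hb : ContMDiffAt J X.I ∞ b n)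
    (h1 : SmoothAlong J S (fun n => pr (b n)) (fun n => mfderiv X.I S.I pr (b n) (f n)) n)
    (h2 : SmoothAlong J X b (fun n => (vertProj h.horizontal (b n) (f n) : X.T (b n))) n) :
    SmoothAlong J X b f n := by
  refine along_of_injective₂ (E := fun x : X => X.T x) (E' := fun x : S => S.T x)
    (E'' := fun x : X => X.T x) hb
    (fun n => (mfderiv X.I S.I pr (b n)).toLinearMap)
    (fun n => (vert pr (b n)).subtype ∘ₗ vertProj h.horizontal (b n))
    (fun y => mfderiv_along hpr (along_coordSymm hb y))
    (fun y => vertProj_along h (along_coordSymm hb y)) ?_ h1 h2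
  intro y hy hy'
  have h3 : vertProj h.horizontal (b n) y = 0 := Subtype.ext hy'
  have h4 := vertProj_coe h.horizontal (b n) ⟨y, hy⟩
  exact congrArg Subtype.val (h4.symm.trans h3)

/-- A horizontal family has zero vertical part, so its image in the base decides. This is how lifts
to `V` will be seen to be smooth. -/
theorem smoothAlong_of_mem (hpr : ContMDiff X.I S.I ∞ pr) {b : N → X}
    {f : ∀ n, X.T (b n)} {n : N} (hb : ContMDiffAt J X.I ∞ b n) (hf : ∀ n, f n ∈ H (b n))
    (h1 : SmoothAlong J S (fun n => pr (b n)) (fun n => mfderiv X.I S.I pr (b n) (f n)) n) :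
    SmoothAlong J X b f n := by
  refine smoothAlong_of_mfderiv_of_vertProj h hpr hb h1 ?_
  have h2 : ∀ n, vertProj h.horizontal (b n) (f n) = 0 := fun n =>
    (vertProj_eq_zero_iff _).2 (hf n)
  simp only [h2]
  exact along_zero (E := fun x : X => X.T x) hb

end Distribution

end Family

section Data

variable {EN HN N : Type*} [NormedAddCommGroup EN] [NormedSpace ℝ EN] [TopologicalSpace HN]
  {J : ModelWithCorners ℝ EN HN} [TopologicalSpace N] [ChartedSpace HN N]
  {τ : Tower.{u}} {𝒟 : GeometricData τ}

namespace GeometricData.IsGeometricFamily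

variable (h𝒟 : 𝒟.IsGeometricFamily)
include h𝒟

theorem metric_along {b : N → τ.X} {v w : ∀ n, vert τ.pr (b n)} {n : N}
    (hv : SmoothAlong J τ.X b (fun n => (v n : τ.X.T (b n))) n)
    (hw : SmoothAlong J τ.X b (fun n => (w n : τ.X.T (b n))) n) :
    ContMDiffAt J 𝓘(ℝ, ℝ) ∞ (fun n => 𝒟.g (b n) (v n) (w n)) n := by
  have hh := h𝒟.distribution.horizontal
  have hb := along_base hv
  -- Composing with the vertical projection extends the metric to all tangent vectors, so that
  -- frames of `TX` can be used in place of frames of `T(X/S)`. Smoothness is obtained for two frame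
  -- vectors, then in the second argument and finally in the first.
  have h1 : ∀ y, ContMDiffAt J 𝓘(ℝ, ℝ) ∞ (fun m => 𝒟.g (b m)
      (vertProj hh (b m) (tframe τ.X (b n) (b m) y)) (vertProj hh (b m) (w m))) n := by
    intro y
    refine along_apply (E := fun x : τ.X => τ.X.T x) (fun m => 𝒟.g (b m)
      (vertProj hh (b m) (tframe τ.X (b n) (b m) y)) ∘ₗ vertProj hh (b m)) (fun z => ?_) hw
    have h2 : ContMDiffAt τ.X.I 𝓘(ℝ, ℝ) ∞ (fun x => 𝒟.g x
        (vertProj hh x (tframe τ.X (b n) x y)) (vertProj hh x (tframe τ.X (b n) x z))) (b n) := by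
      refine (h𝒟.g_smooth _ _ _ (trivializationAt τ.X.model
        (fun x : τ.X => τ.X.T x) (b n)).open_baseSet ?_ ?_).contMDiffAt
        (baseSet_mem_nhds _ _ _)
      · exact h𝒟.distribution.smooth _ _ (trivializationAt _ _ _).open_baseSet
          (smoothFieldOn_frame (b n) y)
      · exact h𝒟.distribution.smooth _ _ (trivializationAt _ _ _).open_baseSet
          (smoothFieldOn_frame (b n) z)
    exact h2.comp n hb
  have h3 := along_apply (E := fun x : τ.X => τ.X.T x) (fun m => (𝒟.g (b m)).flip
      (vertProj hh (b m) (w m)) ∘ₗ vertProj hh (b m)) h1 hv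
  refine h3.congr_of_eventuallyEq (Eventually.of_forall fun m => ?_)
  change _ = 𝒟.g (b m) (vertProj hh (b m) (v m)) (vertProj hh (b m) (w m))
  rw [vertProj_coe, vertProj_coe]

end GeometricData.IsGeometricFamily

section Module

variable (h𝒟 : 𝒟.IsGeometricCliffordFamily)
include h𝒟

theorem GeometricData.IsGeometricCliffordFamily.ε_along {b : N → τ.X} {σ : ∀ n, τ.E.fib (b n)}
    {n : N} (hσ : τ.E.SmoothAlong J b σ n) :
    τ.E.SmoothAlong J b (fun n => 𝒟.ε (b n) (σ n)) n := by
  refine along_map (along_base hσ) (fun n => (𝒟.ε (b n)).restrictScalars ℝ) (fun y => ?_) hσ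
  have h1 := (h𝒟.cliffordModule.ε_smooth _ _ (trivializationAt _ _ _).open_baseSet
    (τ.E.smoothOn_frame (b n) y)).contMDiffAt (baseSet_mem_nhds _ _ _)
  exact ContMDiffAt.comp n h1 (along_base hσ)

/-- Clifford multiplication as a bilinear map. -/
def GeometricData.cmulₗ (𝒟 : GeometricData τ) (x : τ.X) :
    vert τ.pr x →ₗ[ℝ] τ.E.fib x →ₗ[ℝ] τ.E.fib x :=
  LinearMap.mk₂ ℝ (𝒟.cmul x)
    (fun v w e => by simp only [cmul, map_add, LinearMap.add_apply])
    (fun r v e => by simp only [cmul, map_smul, LinearMap.smul_apply])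
    (fun v e f => by simp only [cmul, map_add])
    (fun r v e => by simp only [cmul, LinearMap.map_smul_of_tower])

theorem GeometricData.IsGeometricCliffordFamily.cmul_along {b : N → τ.X}
    {v : ∀ n, vert τ.pr (b n)} {σ : ∀ n, τ.E.fib (b n)} {n : N}
    (hv : SmoothAlong J τ.X b (fun n => (v n : τ.X.T (b n))) n)
    (hσ : τ.E.SmoothAlong J b σ n) :
    τ.E.SmoothAlong J b (fun n => 𝒟.cmul (b n) (v n) (σ n)) n := by
  have hh := h𝒟.family.distribution.horizontal
  have hb := along_base hσ
  have hop : IsOpen ((trivializationAt τ.X.model (fun x : τ.X => τ.X.T x) (b n)).baseSet ∩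
    (trivializationAt τ.E.F τ.E.fib (b n)).baseSet) :=
      (trivializationAt _ _ _).open_baseSet.inter (trivializationAt _ _ _).open_baseSet
  have h1 : ∀ y, τ.E.SmoothAlong J b (fun m => 𝒟.cmulₗ (b m)
      (vertProj hh (b m) (tframe τ.X (b n) (b m) y)) (σ m)) n := by
    intro y
    refine along_map hb (fun m => 𝒟.cmulₗ (b m)
      (vertProj hh (b m) (tframe τ.X (b n) (b m) y))) (fun z => ?_) hσ
    have h2 : τ.E.SmoothAlong τ.X.I id (fun x => 𝒟.cmul x
        (vertProj hh x (tframe τ.X (b n) x y)) (coordSymm τ.E.F τ.E.fib (b n) x z)) (b n) := by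
      refine (h𝒟.cliffordModule.cmul_smooth _ _ _ hop ?_ ?_).contMDiffAt
        (inter_mem (baseSet_mem_nhds _ _ _) (baseSet_mem_nhds _ _ _))
      · exact h𝒟.family.distribution.smooth _ _ hop
          ((smoothFieldOn_frame (b n) y).mono inter_subset_left)
      · exact (τ.E.smoothOn_frame (b n) z).mono inter_subset_right
    exact ContMDiffAt.comp n h2 hb
  have h3 := along_map (E := fun x : τ.X => τ.X.T x) hb (fun m => (𝒟.cmulₗ (b m)).flip (σ m) ∘ₗ
    vertProj hh (b m)) h1 hv
  refine h3.congr_of_eventuallyEq (Eventually.of_forall fun m => ?_)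
  refine congrArg (TotalSpace.mk' τ.E.F (b m)) ?_
  change _ = 𝒟.cmul (b m) (vertProj hh (b m) (v m)) (σ m)
  rw [vertProj_coe]

end Module

end Data

end

noncomputable section

/-! ### The vertical connection and its Koszul formula -/

section Vertical

variable {X S : SmoothMfd.{u}} {pr : X → S} {H : ∀ x : X, Submodule ℝ (X.T x)}

/-- The differential of `pr` as a linear map between tangent spaces. -/
abbrev prStar (pr : X → S) (x : X) : X.T x →ₗ[ℝ] S.T (pr x) := (mfderiv X.I S.I pr x).toLinearMap

/-- The metric `g^{X/S} ⊕ pr^* g^S` as a bilinear form. -/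
def sumForm (h : IsHorizontal pr H) (g : ∀ x : X, LinearMap.BilinForm ℝ (vert pr x))
    (gS : ContMDiffRiemannianMetric S.I ∞ S.model (fun s : S => S.T s)) (x : X) :
    LinearMap.BilinForm ℝ (X.T x) :=
  (g x).compl₁₂ (vertProj h x) (vertProj h x) +
    (LinearMap.mk₂ ℝ (fun v w : S.T (pr x) => gS.inner (pr x) v w)
      (fun v v' w => by rw [map_add]; rfl) (fun r v w => by rw [map_smul]; rfl)
      (fun v w w' => map_add _ _ _) (fun r v w => map_smul _ _ _)).compl₁₂ (prStar pr x)
        (prStar pr x)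

theorem sumForm_apply (h : IsHorizontal pr H) (g : ∀ x : X, LinearMap.BilinForm ℝ (vert pr x))
    (gS : ContMDiffRiemannianMetric S.I ∞ S.model (fun s : S => S.T s)) (x : X) (v w : X.T x) :
    sumForm h g gS x v w = sumMetric h g gS x v w := rfl

theorem smoothAlong_riemannianMetric {EN HN N : Type*} [NormedAddCommGroup EN] [NormedSpace ℝ EN]
    [TopologicalSpace HN] {J : ModelWithCorners ℝ EN HN} [TopologicalSpace N] [ChartedSpace HN N]
    (gS : ContMDiffRiemannianMetric S.I ∞ S.model (fun s : S => S.T s)) {b : N → S}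
    {v w : ∀ n, S.T (b n)} {n : N} (hv : SmoothAlong J S b v n) (hw : SmoothAlong J S b w n) :
    ContMDiffAt J 𝓘(ℝ, ℝ) ∞ (fun n => gS.inner (b n) (v n) (w n)) n := by
  have hb := along_base hv
  have h1 : ContMDiffAt J (S.I.prod 𝓘(ℝ, S.model →L[ℝ] S.model →L[ℝ] ℝ)) ∞
      (fun m => TotalSpace.mk' (S.model →L[ℝ] S.model →L[ℝ] ℝ)
        (E := fun s : S => S.T s →L[ℝ] S.T s →L[ℝ] ℝ) (b m) (gS.inner (b m))) n :=
    gS.contMDiff.contMDiffAt.comp n hb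
  have h2 := ContMDiffAt.clm_bundle_apply₂ (F₁ := S.model) (F₂ := S.model) (F₃ := ℝ)
    (E₁ := fun s : S => S.T s) (E₂ := fun s : S => S.T s) (E₃ := Bundle.Trivial S ℝ) h1 hv hw
  exact (along_trivial_iff hb).1 h2

/-- Any metric on the base will do. The sum metric is positive because a nonzero vector is either
vertical, hence seen by `g`, or has a nonzero image in the base. -/
theorem exists_verticalConnection {τ : Tower.{u}} {𝒟 : GeometricData τ}
    (h𝒟 : 𝒟.IsGeometricFamily) :
    ∃ N, IsVerticalConnection h𝒟.distribution.horizontal 𝒟.g N := by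
  obtain ⟨gS⟩ := exists_riemannianMetric τ.S
  have hh := h𝒟.distribution.horizontal
  obtain ⟨D, hD⟩ := exists_leviCivita (sumForm hh 𝒟.g gS)
    (fun x v w => by
      simp only [sumForm_apply, sumMetric]
      rw [h𝒟.g_symm, gS.symm])
    (fun x v hv => by
      simp only [sumForm_apply, sumMetric]
      have h1 : 0 ≤ 𝒟.g x (vertProj hh x v) (vertProj hh x v) := by
        rcases eq_or_ne (vertProj hh x v) 0 with h | h
        · rw [h]; simp
        · exact (h𝒟.g_pos _ _ h).le
      have h2 : 0 ≤ gS.inner (τ.pr x) (mfderiv τ.X.I τ.S.I τ.pr x v)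
          (mfderiv τ.X.I τ.S.I τ.pr x v) := by
        rcases eq_or_ne (mfderiv τ.X.I τ.S.I τ.pr x v) 0 with h | h
        · rw [h]; simp
        · exact (gS.pos _ _ h).le
      rcases eq_or_ne (mfderiv τ.X.I τ.S.I τ.pr x v) 0 with h | h
      · refine add_pos_of_pos_of_nonneg (h𝒟.g_pos _ _ fun h3 => hv ?_) h2
        have h4 := vertProj_coe hh x ⟨v, h⟩
        exact congrArg Subtype.val (h4.symm.trans h3)
      · exact add_pos_of_nonneg_of_pos h1 (gS.pos _ _ h))
    (fun Y Z x hY hZ => by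
      simp only [sumForm_apply, sumMetric]
      refine ContMDiffAt.add ?_ ?_
      · exact h𝒟.metric_along (vertProj_along h𝒟.distribution hY)
          (vertProj_along h𝒟.distribution hZ)
      · exact smoothAlong_riemannianMetric gS (mfderiv_along h𝒟.bundle.smooth hY)
          (mfderiv_along h𝒟.bundle.smooth hZ))
  exact ⟨fun v x w => vertProj hh x (D (fun y => (v y : τ.X.T y)) x w), gS, D, hD,
    fun v _ x w => rfl⟩

theorem mfderiv_extChartAt_self (x : X) (v : X.T x) :
    mfderiv X.I 𝓘(ℝ, X.model) (extChartAt X.I x) x v = v :=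
  (coordAt_tangent (mem_chart_source _ x) v).symm.trans (coordAt_tangent_self x v)

theorem mfderiv_extChartAt_comp {EN HN N : Type*} [NormedAddCommGroup EN] [NormedSpace ℝ EN]
    [TopologicalSpace HN] {J : ModelWithCorners ℝ EN HN} [TopologicalSpace N] [ChartedSpace HN N]
    {f : N → X} {n : N} (hf : MDifferentiableAt J X.I f n)
    (v : TangentSpace J n) :
    mvfderiv J (fun m => extChartAt X.I (f n) (f m)) n v = mfderiv J X.I f n v := by
  have h1 := mfderiv_comp_apply n (mdifferentiableAt_extChartAt (I := X.I) (mem_chart_source _ (f n)))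
    hf v
  exact h1.trans (mfderiv_extChartAt_self (f n) _)

/-- Vertical fields annihilate `pr`, read in a chart of `S`, on a whole neighbourhood. Hence both
iterated derivatives vanish, and by the commutator formula so does the derivative along the bracket.
-/
theorem mfderiv_mlieBracket_eq_zero (hpr : ContMDiff X.I S.I ∞ pr) {v w : VertField pr} {x : X}
    (hv : SmoothFieldAt X (fun y => (v y : X.T y)) x)
    (hw : SmoothFieldAt X (fun y => (w y : X.T y)) x) :
    VectorField.mlieBracket X.I (fun y => (v y : X.T y)) (fun y => (w y : X.T y)) x ∈ vert pr x := by
  have hψ : ContMDiffAt X.I 𝓘(ℝ, S.model) ∞ (fun y => extChartAt S.I (pr x) (pr y)) x :=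
    (contMDiffAt_extChartAt (n := ∞) (I := S.I) (x := pr x)).comp x hpr.contMDiffAt
  have h0 : ∀ v : VertField pr, (fun y => mvfderiv X.I (fun y => extChartAt S.I (pr x) (pr y)) y
      (v y : X.T y)) =ᶠ[𝓝 x] fun _ => 0 := by
    intro v
    have hmem : ∀ᶠ y in 𝓝 x, pr y ∈ (chartAt S.model (pr x)).source :=
      hpr.continuous.continuousAt.eventually (chart_source_mem_nhds _ _)
    filter_upwards [hmem] with y hy
    have h1 := mfderiv_comp_apply y (mdifferentiableAt_extChartAt (I := S.I) hy)
      (hpr.mdifferentiableAt (by simp)) (v y : X.T y)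
    refine h1.trans ?_
    have h2 : mfderiv X.I S.I pr y (v y : X.T y) = 0 := (v y).2
    rw [h2, map_zero]
    rfl
  have h1 := mvfderiv_mvfderiv_sub hψ hv hw
  rw [mvfderiv_congr (h0 v), mvfderiv_congr (h0 w), ← mlieBracket_eq hv hw] at h1
  rw [mem_vert, ← mfderiv_extChartAt_comp (hpr.mdifferentiableAt (by simp)), ← h1]
  rw [mvfderiv_const]
  exact sub_zero (G := S.model) 0

/-- The Koszul formula for the vertical connection. -/
theorem IsVerticalConnection.koszul (h : IsHorizontal pr H)
    {g : ∀ x : X, LinearMap.BilinForm ℝ (vert pr x)} (hg : ∀ x v w, g x v w = g x w v)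
    (hpr : ContMDiff X.I S.I ∞ pr)
    {N : VertField pr → ∀ x : X, X.T x → vert pr x} (hN : IsVerticalConnection h g N)
    {u : ∀ x : X, X.T x} {v w : VertField pr} (hu : SmoothFieldOn X u univ)
    (hv : v.SmoothOn univ) (hw : w.SmoothOn univ) (x : X) :
    2 * g x (N v x (u x)) (w x) =
      mvfderiv X.I (fun y => g y (v y) (w y)) x (u x) +
      mvfderiv X.I (fun y => g y (vertProj h y (u y)) (w y)) x (v x) -
      mvfderiv X.I (fun y => g y (vertProj h y (u y)) (v y)) x (w x) +
      g x (vertProj h x (VectorField.mlieBracket X.I u (fun y => (v y : X.T y)) x)) (w x) -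
      g x (vertProj h x (VectorField.mlieBracket X.I u (fun y => (w y : X.T y)) x)) (v x) -
      g x (vertProj h x (VectorField.mlieBracket X.I (fun y => (v y : X.T y))
        (fun y => (w y : X.T y)) x)) (vertProj h x (u x)) := by
  obtain ⟨gS, D, ⟨hT, hM⟩, hND⟩ := hN
  -- Against a vertical vector the sum metric sees only `g` and the projection `P`. This is the
  -- reason why the metric of the base disappears from the formula.
  have hm : ∀ y (a : X.T y) (b : vert pr y),
      sumMetric h g gS y a b = g y (vertProj h y a) b := by
    intro y a b
    have hb : mfderiv X.I S.I pr y (b : X.T y) = 0 := b.2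
    simp only [sumMetric, hb, map_zero, vertProj_coe, add_zero]
  have hm' : ∀ y (a b : X.T y), a ∈ vert pr y →
      sumMetric h g gS y a b = g y (vertProj h y a) (vertProj h y b) := by
    intro y a b ha
    have ha : mfderiv X.I S.I pr y a = 0 := ha
    simp only [sumMetric, ha, map_zero, zero_apply, add_zero]
  have hs : ∀ y a b, sumMetric h g gS y a b = sumMetric h g gS y b a := by
    intro y a b
    simp only [sumMetric]
    rw [hg, gS.symm]
  have hsub : ∀ y a b c, sumMetric h g gS y (a - b) c =
      sumMetric h g gS y a c - sumMetric h g gS y b c := by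
    intro y a b c
    simp only [← sumForm_apply, map_sub, LinearMap.sub_apply]
  have e1 := hM _ _ hv hw x (u x)
  have e2 := hM _ _ hu hw x (v x)
  have e3 := hM _ _ hu hv x (w x)
  have t1 := hT _ _ hu hv x
  have t2 := hT _ _ hu hw x
  have t3 := hT _ _ hv hw x
  simp only [hm] at e1 e2 e3
  simp only [vertProj_coe] at e1
  -- Metricity has expanded the three derivatives, and torsion-freeness now turns the brackets into
  -- differences of covariant derivatives. By symmetry of the metric everything cancels except twice
  -- the pairing of the derivative of `v` along `u` with `w`.
  rw [e1, e2, e3, hND v hv x (u x), ← hm x _ (w x), ← hm x _ (w x), ← hm x _ (v x),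
    ← hm' x _ (u x) (mfderiv_mlieBracket_eq_zero hpr (smoothFieldOn_univ.1 hv x)
      (smoothFieldOn_univ.1 hw x)), ← t1, ← t2, ← t3]
  simp only [hsub, ← hm]
  rw [hs x (v x) (D (fun y => (w y : X.T y)) x (u x)), hs x (u x) (D _ x (v x)),
    hs x (u x) (D _ x (w x))]
  ring

end Vertical

end

noncomputable section

/-! ### Partial derivatives, and gauges of a principal bundle -/

section ProductRule

variable {E₁ H₁ M₁ E₂ H₂ M₂ E₃ H₃ M₃ E₄ H₄ M₄ : Type*}
  [NormedAddCommGroup E₁] [NormedSpace ℝ E₁] [TopologicalSpace H₁] {I₁ : ModelWithCorners ℝ E₁ H₁}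
  [TopologicalSpace M₁] [ChartedSpace H₁ M₁]
  [NormedAddCommGroup E₂] [NormedSpace ℝ E₂] [TopologicalSpace H₂] {I₂ : ModelWithCorners ℝ E₂ H₂}
  [TopologicalSpace M₂] [ChartedSpace H₂ M₂]
  [NormedAddCommGroup E₃] [NormedSpace ℝ E₃] [TopologicalSpace H₃] {I₃ : ModelWithCorners ℝ E₃ H₃}
  [TopologicalSpace M₃] [ChartedSpace H₃ M₃]
  [NormedAddCommGroup E₄] [NormedSpace ℝ E₄] [TopologicalSpace H₄] {I₄ : ModelWithCorners ℝ E₄ H₄}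
  [TopologicalSpace M₄] [ChartedSpace H₄ M₄]

/-- The chain rule for a map of two variables, through partial derivatives. -/
theorem mfderiv_comp₂ {f : M₁ × M₂ → M₃} {b : M₄ → M₁} {c : M₄ → M₂} {n : M₄}
    (hf : MDifferentiableAt (I₁.prod I₂) I₃ f (b n, c n)) (hb : MDifferentiableAt I₄ I₁ b n)
    (hc : MDifferentiableAt I₄ I₂ c n) (v : TangentSpace I₄ n) :
    mfderiv I₄ I₃ (fun m => f (b m, c m)) n v =
      mfderiv I₁ I₃ (fun x => f (x, c n)) (b n) (mfderiv I₄ I₁ b n v) +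
      mfderiv I₂ I₃ (fun y => f (b n, y)) (c n) (mfderiv I₄ I₂ c n v) := by
  have h1 := mfderiv_comp_apply (I := I₄) (I' := I₁.prod I₂) (I'' := I₃) n hf (hb.prodMk hc) v
  refine h1.trans ?_
  rw [hb.mfderiv_prod hc]
  exact mfderiv_prod_eq_add_apply hf

end ProductRule

section Principal

variable {EG : Type*} [NormedAddCommGroup EG] [NormedSpace ℝ EG]
  {G : Type*} [TopologicalSpace G] [ChartedSpace EG G] [Group G]

namespace PrincipalBundle

variable (P : PrincipalBundle.{u} (EG := EG) G)

/-- A local section `s` of a principal bundle over an open set `U`, together with the corresponding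
coordinate `γ` in the group. -/
structure Gauge where
  U : Set P.M
  s : P.M → P.Q
  γ : P.Q → G
  isOpen : IsOpen U
  smooth_s : ContMDiffOn P.M.I P.Q.I ∞ s U
  smooth_γ : ContMDiffOn P.Q.I 𝓘(ℝ, EG) ∞ γ (P.r ⁻¹' U)
  r_s : ∀ m ∈ U, P.r (s m) = m
  γ_act : ∀ q, P.r q ∈ U → ∀ g, γ (P.act q g) = γ q * g
  act_γ : ∀ q, P.r q ∈ U → P.act (s (P.r q)) (γ q) = q

theorem exists_gauge (m : P.M) : ∃ φ : P.Gauge, m ∈ φ.U := by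
  obtain ⟨e, hm, h1, h2, h3⟩ := P.locallyTrivial m
  have hs : ∀ m ∈ e.baseSet, P.r (e.toOpenPartialHomeomorph.symm (m, 1)) = m := fun m hm =>
    e.proj_symm_apply' hm
  refine ⟨{ U := e.baseSet
            s := fun m => e.toOpenPartialHomeomorph.symm (m, 1)
            γ := fun q => (e q).2
            isOpen := e.open_baseSet
            smooth_s := ?_
            smooth_γ := ?_
            r_s := hs
            γ_act := fun q hq g => h3 q (e.mem_source.2 hq) g
            act_γ := ?_ }, hm⟩
  · refine h2.comp (contMDiff_id.prodMk contMDiff_const).contMDiffOn ?_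
    intro m hm
    exact e.mem_target.2 hm
  · rw [e.source_eq] at h1
    exact contMDiff_snd.comp_contMDiffOn h1
  -- Both points lie over `P.r q` and, by equivariance, have the same group coordinate, so the
  -- trivialization identifies them.
  · intro q hq
    have hq' := e.mem_source.2 hq
    have hsq : e.toOpenPartialHomeomorph.symm (P.r q, 1) ∈ e.source :=
      e.mem_source.2 (by rw [hs _ hq]; exact hq)
    have hact : P.act (e.toOpenPartialHomeomorph.symm (P.r q, 1)) (e q).2 ∈ e.source :=
      e.mem_source.2 (by rw [P.r_act, hs _ hq]; exact hq)
    refine e.toOpenPartialHomeomorph.injOn hact hq' (Prod.ext ?_ ?_)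
    · exact (e.coe_fst hact).trans ((by rw [P.r_act, hs _ hq] : _ = P.r q).trans
        (e.coe_fst hq').symm)
    · refine (h3 _ hsq _).trans ?_
      rw [e.apply_symm_apply' hq, one_mul]
      rfl

variable {P}

namespace Gauge

variable (φ : P.Gauge)

/-- The gauge axioms force this: applying `γ` to `s m · γ (s m) = s m` shows `γ (s m)` to be
idempotent. -/
theorem γ_s {m : P.M} (hm : m ∈ φ.U) : φ.γ (φ.s m) = 1 := by
  have h1 : P.r (φ.s m) ∈ φ.U := by rw [φ.r_s m hm]; exact hm
  have h2 := φ.act_γ (φ.s m) h1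
  rw [φ.r_s m hm] at h2
  have h3 := φ.γ_act (φ.s m) h1 (φ.γ (φ.s m))
  rw [h2] at h3
  exact (left_eq_mul.1 h3)

theorem contMDiffAt_s {m : P.M} (hm : m ∈ φ.U) : ContMDiffAt P.M.I P.Q.I ∞ φ.s m :=
  φ.smooth_s.contMDiffAt (φ.isOpen.mem_nhds hm)

theorem eventually_mem {q : P.Q} (hq : P.r q ∈ φ.U) : ∀ᶠ q' in 𝓝 q, P.r q' ∈ φ.U :=
  P.r_smooth.continuous.continuousAt.eventually (φ.isOpen.mem_nhds hq)

theorem contMDiffAt_γ {q : P.Q} (hq : P.r q ∈ φ.U) : ContMDiffAt P.Q.I 𝓘(ℝ, EG) ∞ φ.γ q :=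
  φ.smooth_γ.contMDiffAt (φ.eventually_mem hq)

end Gauge

theorem act_smooth_left [LieGroup 𝓘(ℝ, EG) ∞ G] (g : G) :
    ContMDiff P.Q.I P.Q.I ∞ (fun a => P.act a g) :=
  P.act_smooth.comp (contMDiff_id.prodMk contMDiff_const)

theorem act_smooth_right [LieGroup 𝓘(ℝ, EG) ∞ G] (a : P.Q) :
    ContMDiff 𝓘(ℝ, EG) P.Q.I ∞ (fun g => P.act a g) :=
  P.act_smooth.comp (contMDiff_const.prodMk contMDiff_id)

/-- The vertical tangent vectors of a principal bundle are tangent to the orbits. -/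
theorem exists_mfderiv_act_eq [LieGroup 𝓘(ℝ, EG) ∞ G] {q : P.Q} {v : P.Q.T q}
    (hv : v ∈ vert P.r q) :
    ∃ ζ : TangentSpace 𝓘(ℝ, EG) (1 : G), mfderiv 𝓘(ℝ, EG) P.Q.I (fun g => P.act q g) 1 ζ = v := by
  obtain ⟨φ, hφ⟩ := P.exists_gauge (P.r q)
  -- Near `q` every point is `B q' · C q'`, where `B` factors through `P.r` and `C` takes values in
  -- `G` with `C q = 1`. A vertical vector is killed by the differential of `B`, so it comes from
  -- that of `C`.
  set B : P.Q → P.Q := fun q' => P.act (φ.s (P.r q')) (φ.γ q) with hB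
  set C : P.Q → G := fun q' => (φ.γ q)⁻¹ * φ.γ q' with hC
  have hBq : B q = q := φ.act_γ q hφ
  have hCq : C q = 1 := inv_mul_cancel _
  have hsm : ContMDiffAt P.M.I P.Q.I ∞ (fun m => P.act (φ.s m) (φ.γ q)) (P.r q) :=
    (act_smooth_left (φ.γ q)).contMDiffAt.comp _ (φ.contMDiffAt_s hφ)
  have hBs : ContMDiffAt P.Q.I P.Q.I ∞ B q := hsm.comp q P.r_smooth.contMDiffAt
  have hCs : ContMDiffAt P.Q.I 𝓘(ℝ, EG) ∞ C q :=
    (contMDiff_mul_left (I := 𝓘(ℝ, EG)) (n := ∞) (a := (φ.γ q)⁻¹)).contMDiffAt.comp q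
      (φ.contMDiffAt_γ hφ)
  have h1 : (fun q' => P.act (B q') (C q')) =ᶠ[𝓝 q] id := by
    filter_upwards [φ.eventually_mem hφ] with q' hq'
    simp only [hB, hC, ← P.act_mul, mul_inv_cancel_left, φ.act_γ q' hq', id]
  have h2 := mfderiv_comp₂ (I₁ := P.Q.I) (I₂ := 𝓘(ℝ, EG)) (I₃ := P.Q.I) (I₄ := P.Q.I)
    (f := fun p : P.Q × G => P.act p.1 p.2) (P.act_smooth.mdifferentiableAt (by simp))
    (hBs.mdifferentiableAt (by simp)) (hCs.mdifferentiableAt (by simp)) v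
  have h3 : mfderiv P.Q.I P.Q.I B q v = 0 := by
    have := mfderiv_comp_apply q (hsm.mdifferentiableAt (by simp))
      (P.r_smooth.mdifferentiableAt (by simp)) v
    refine this.trans ?_
    have hv' : mfderiv P.Q.I P.M.I P.r q v = 0 := hv
    rw [hv', map_zero]
  rw [h3, map_zero, zero_add] at h2
  have h4 : mfderiv P.Q.I P.Q.I (fun q' => P.act (B q') (C q')) q v = v := by
    rw [h1.mfderiv_eq, mfderiv_id]; rfl
  -- This moves the differential from the base points `B q`, `C q` to the equal points `q`, `1`.
  have h5 : ∀ (p : P.Q) (g : G) (hp : p = q) (hg : g = 1) (ζ : EG),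
      (mfderiv 𝓘(ℝ, EG) P.Q.I (fun g => P.act p g) g ζ : P.Q.model) =
        mfderiv 𝓘(ℝ, EG) P.Q.I (fun g => P.act q g) 1 ζ := by
    rintro _ _ rfl rfl _; rfl
  exact ⟨_, (h5 _ _ hBq hCq _).symm.trans (h2.symm.trans h4)⟩

end PrincipalBundle

end Principal

end

noncomputable section

namespace PrincipalBundle

/-! ### The differential of a map defined on `Q × Y` -/

section Push

variable {EG : Type*} [NormedAddCommGroup EG] [NormedSpace ℝ EG]
  {G : Type*} [TopologicalSpace G] [ChartedSpace EG G] [Group G]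
  {P : PrincipalBundle.{u} (EG := EG) G} {Y Z W : SmoothMfd.{u}} {k : P.Q × Y → Z}

theorem push_add (a : P.Q) (y : Y) (v v' : P.Q.T a) (w w' : Y.T y) :
    P.push k a y (v + v') (w + w') = P.push k a y v w + P.push k a y v' w' :=
  map_add (mfderiv (P.Q.I.prod Y.I) Z.I k (a, y)) ((v, w) : P.Q.model × Y.model)
    ((v', w') : P.Q.model × Y.model)

theorem push_smul (a : P.Q) (y : Y) (r : ℝ) (v : P.Q.T a) (w : Y.T y) :
    P.push k a y (r • v) (r • w) = r • P.push k a y v w :=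
  map_smul (mfderiv (P.Q.I.prod Y.I) Z.I k (a, y)) r ((v, w) : P.Q.model × Y.model)

theorem push_zero (a : P.Q) (y : Y) : P.push k a y 0 0 = 0 :=
  map_zero (mfderiv (P.Q.I.prod Y.I) Z.I k (a, y))

theorem push_sub (a : P.Q) (y : Y) (v v' : P.Q.T a) (w w' : Y.T y) :
    P.push k a y (v - v') (w - w') = P.push k a y v w - P.push k a y v' w' :=
  map_sub (mfderiv (P.Q.I.prod Y.I) Z.I k (a, y)) ((v, w) : P.Q.model × Y.model)
    ((v', w') : P.Q.model × Y.model)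

theorem push_split (a : P.Q) (y : Y) (v : P.Q.T a) (w : Y.T y) :
    P.push k a y v w = P.push k a y v 0 + P.push k a y 0 w := by
  rw [← push_add, add_zero, zero_add]

variable (P k) in
/-- The differential of `k (a, ·)` as a linear map. -/
def pushR (a : P.Q) (y : Y) : Y.T y →ₗ[ℝ] Z.T (k (a, y)) where
  toFun w := P.push k a y 0 w
  map_add' w w' := by rw [← push_add, add_zero]
  map_smul' r w := by rw [RingHom.id_apply, ← push_smul, smul_zero]

theorem pushR_apply (a : P.Q) (y : Y) (w : Y.T y) : P.pushR k a y w = P.push k a y 0 w := rfl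

section Smooth

variable (hk : ContMDiff (P.Q.I.prod Y.I) Z.I ∞ k)
include hk

theorem push_eq (a : P.Q) (y : Y) (v : P.Q.T a) (w : Y.T y) :
    P.push k a y v w = mfderiv P.Q.I Z.I (fun b => k (b, y)) a v +
      mfderiv Y.I Z.I (fun z => k (a, z)) y w :=
  mfderiv_prod_eq_add_apply (hk.mdifferentiableAt (by simp))

theorem push_zero_left (a : P.Q) (y : Y) (w : Y.T y) :
    P.push k a y 0 w = mfderiv Y.I Z.I (fun z => k (a, z)) y w := by
  rw [push_eq hk, map_zero, zero_add]

theorem push_zero_right (a : P.Q) (y : Y) (v : P.Q.T a) :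
    P.push k a y v 0 = mfderiv P.Q.I Z.I (fun b => k (b, y)) a v := by
  rw [push_eq hk, map_zero, add_zero]

theorem mfderiv_push {f : Z → W} {a : P.Q} {y : Y} (hf : MDifferentiableAt Z.I W.I f (k (a, y)))
    (v : P.Q.T a) (w : Y.T y) :
    mfderiv Z.I W.I f (k (a, y)) (P.push k a y v w) = P.push (fun p => f (k p)) a y v w :=
  (mfderiv_comp_apply (a, y) hf (hk.mdifferentiableAt (by simp)) _).symm

theorem push_along {EN HN N : Type*} [NormedAddCommGroup EN] [NormedSpace ℝ EN]
    [TopologicalSpace HN] {J : ModelWithCorners ℝ EN HN} [TopologicalSpace N] [ChartedSpace HN N]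
    {b : N → P.Q} {c : N → Y} {v : ∀ n, P.Q.T (b n)} {w : ∀ n, Y.T (c n)} {n : N}
    (hv : SmoothAlong J P.Q b v n) (hw : SmoothAlong J Y c w n) :
    SmoothAlong J Z (fun n => k (b n, c n)) (fun n => P.push k (b n) (c n) (v n) (w n)) n := by
  have h1 : ContMDiff (P.Q.I.prod Y.I).tangent Z.I.tangent ∞ (tangentMap (P.Q.I.prod Y.I) Z.I k) :=
    hk.contMDiff_tangentMap (by simp)
  have h2 := contMDiff_equivTangentBundleProd_symm (I := P.Q.I) (M := P.Q) (I' := Y.I) (M' := Y)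
    (n := ∞)
  have h3 := ContMDiffAt.prodMk hv hw
  exact h1.contMDiffAt.comp n (h2.contMDiffAt.comp n h3)

end Smooth

end Push

/-! ### Associated bundles: descent of smoothness and splitting of the tangent space -/

section Assoc

variable {EG : Type*} [NormedAddCommGroup EG] [NormedSpace ℝ EG]
  {G : Type*} [TopologicalSpace G] [ChartedSpace EG G] [Group G] [LieGroup 𝓘(ℝ, EG) ∞ G]
  {P : PrincipalBundle.{u} (EG := EG) G} {Y Z : SmoothMfd.{u}} [MulAction G Y]
  {k : P.Q × Y → Z} (hk : P.IsAssociated Y Z k)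

namespace IsAssociated

include hk

theorem map_act (a : P.Q) (g : G) (y : Y) : k (P.act a g, y) = k (a, g • y) :=
  (hk.fibers _ _ _ _).2 ⟨g, rfl, rfl⟩

/-- Near `k p` one has `f = (f ∘ k) ∘ σ` for a smooth local section `σ` through `p`. This is the
descent principle by which smoothness on an associated bundle is checked upstairs. -/
theorem contMDiffAt_of_comp {EN HN N : Type*} [NormedAddCommGroup EN] [NormedSpace ℝ EN]
    [TopologicalSpace HN] {J : ModelWithCorners ℝ EN HN} [TopologicalSpace N] [ChartedSpace HN N]
    {f : Z → N} {p : P.Q × Y} (hf : ContMDiffAt (P.Q.I.prod Y.I) J ∞ (fun p => f (k p)) p) :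
    ContMDiffAt Z.I J ∞ f (k p) := by
  obtain ⟨σ, h1, h2, h3⟩ := exists_local_section (hk.smooth.contMDiffAt (x := p)) (hk.submersion p)
  have hf' : ContMDiffAt (P.Q.I.prod Y.I) J ∞ (fun p => f (k p)) (σ (k p)) := by rwa [h1]
  refine (hf'.comp (k p) h2).congr_of_eventuallyEq ?_
  filter_upwards [h3] with z hz
  simp only [Function.comp_apply, hz]

/-- A representative of a point of `Y_Q`. -/
def rep (z : Z) : P.Q × Y := Classical.choose (hk.surjective z)

theorem map_rep (z : Z) : k (hk.rep z) = z := Classical.choose_spec (hk.surjective z)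

theorem exists_rep_eq (a : P.Q) (y : Y) :
    ∃ g : G, (hk.rep (k (a, y))).1 = P.act a g ∧ y = g • (hk.rep (k (a, y))).2 :=
  (hk.fibers _ _ _ _).1 (hk.map_rep (k (a, y)))

/-- The bundle projection `Y_Q → M`. -/
def base (z : Z) : P.M := P.r (hk.rep z).1

theorem base_apply (a : P.Q) (y : Y) : hk.base (k (a, y)) = P.r a := by
  obtain ⟨g, h, -⟩ := hk.exists_rep_eq a y
  rw [base, h, P.r_act]

theorem base_smooth : ContMDiff Z.I P.M.I ∞ hk.base := by
  intro z
  obtain ⟨⟨a, y⟩, rfl⟩ := hk.surjective z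
  refine hk.contMDiffAt_of_comp ?_
  simp only [hk.base_apply]
  exact (P.r_smooth.comp contMDiff_fst).contMDiffAt

/-- The fibre coordinate `Y_Q → Y` in a gauge. -/
def fiberCoord (φ : P.Gauge) (z : Z) : Y := φ.γ (hk.rep z).1 • (hk.rep z).2

/-- The chosen representative is `(a · g, y')` with `y = g y'`, and equivariance gives `γ (a · g) y'
= γ a (g y')`. Over points outside the gauge domain the coordinate has no meaning. -/
theorem fiberCoord_apply (φ : P.Gauge) {a : P.Q} (ha : P.r a ∈ φ.U) (y : Y) :
    hk.fiberCoord φ (k (a, y)) = φ.γ a • y := by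
  obtain ⟨g, h, h'⟩ := hk.exists_rep_eq a y
  rw [fiberCoord, h, φ.γ_act a ha, mul_smul, ← h']

theorem fiberCoord_section (φ : P.Gauge) {m : P.M} (hm : m ∈ φ.U) (y : Y) :
    hk.fiberCoord φ (k (φ.s m, y)) = y := by
  rw [hk.fiberCoord_apply φ (by rwa [φ.r_s m hm]), φ.γ_s hm, one_smul]

theorem map_section_fiberCoord (φ : P.Gauge) {z : Z} (hz : hk.base z ∈ φ.U) :
    k (φ.s (hk.base z), hk.fiberCoord φ z) = z := by
  obtain ⟨⟨a, y⟩, rfl⟩ := hk.surjective z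
  rw [hk.base_apply] at hz ⊢
  rw [hk.fiberCoord_apply φ hz, ← hk.map_act, φ.act_γ a hz]

theorem fiberCoord_smooth [ContMDiffSMul 𝓘(ℝ, EG) Y.I ∞ G Y] (φ : P.Gauge) {z : Z}
    (hz : hk.base z ∈ φ.U) : ContMDiffAt Z.I Y.I ∞ (hk.fiberCoord φ) z := by
  obtain ⟨⟨a, y⟩, rfl⟩ := hk.surjective z
  rw [hk.base_apply] at hz
  refine hk.contMDiffAt_of_comp ?_
  have h1 : ContMDiffAt (P.Q.I.prod Y.I) Y.I ∞ (fun p : P.Q × Y => φ.γ p.1 • p.2) (a, y) :=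
    (contMDiff_smul (I := 𝓘(ℝ, EG)) (I' := Y.I) (n := ∞) (G := G) (M := Y)).contMDiffAt.comp (a, y)
      (((φ.contMDiffAt_γ hz).comp (a, y) contMDiffAt_fst).prodMk contMDiffAt_snd)
  refine h1.congr_of_eventuallyEq ?_
  filter_upwards [continuousAt_fst.eventually (φ.eventually_mem hz)] with p hp
  exact hk.fiberCoord_apply φ hp p.2

theorem mfderiv_base_push (a : P.Q) (y : Y) (v : P.Q.T a) (w : Y.T y) :
    mfderiv Z.I P.M.I hk.base (k (a, y)) (P.push k a y v w) = (mfderiv P.Q.I P.M.I P.r a v : _) := by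
  refine (mfderiv_push hk.smooth (hk.base_smooth.mdifferentiableAt (by simp)) v w).trans ?_
  have h1 : (fun p => hk.base (k p)) = fun p => P.r p.1 := funext fun p => hk.base_apply p.1 p.2
  have h2 : ContMDiff (P.Q.I.prod Y.I) P.M.I ∞ (fun p : P.Q × Y => P.r p.1) :=
    P.r_smooth.comp contMDiff_fst
  refine (congrArg (fun f : P.Q × Y → P.M => (P.push f a y v w : P.M.model)) h1).trans ?_
  refine (push_eq h2 a y v w).trans ?_
  have h3 : (mfderiv Y.I P.M.I (fun _ : Y => P.r a) y w : P.M.model) = 0 := by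
    rw [mfderiv_const]; rfl
  let m : P.M.model := mfderiv P.Q.I P.M.I P.r a v
  exact (congrArg (fun z : P.M.model => m + z) h3).trans (add_zero (M := P.M.model) _)

/-- In a gauge, `z ↦ (γ a)⁻¹ • fiberCoord z` is a smooth left inverse of `y ↦ k (a, y)`. -/
theorem pushR_injective [ContMDiffSMul 𝓘(ℝ, EG) Y.I ∞ G Y] (a : P.Q) (y : Y) :
    Function.Injective (P.pushR k a y) := by
  obtain ⟨φ, hφ⟩ := P.exists_gauge (P.r a)
  have h1 : (fun z => (φ.γ a)⁻¹ • hk.fiberCoord φ (k (a, z))) = id := by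
    funext z
    rw [hk.fiberCoord_apply φ hφ, inv_smul_smul]; rfl
  have h3 : ContMDiff Y.I Y.I ∞ (fun z : Y => (φ.γ a)⁻¹ • z) :=
    (contMDiff_smul (I := 𝓘(ℝ, EG)) (I' := Y.I) (n := ∞) (G := G) (M := Y)).comp
      (contMDiff_const.prodMk contMDiff_id)
  have h4 : ContMDiffAt Z.I Y.I ∞ (fun z => (φ.γ a)⁻¹ • hk.fiberCoord φ z) (k (a, y)) :=
    h3.contMDiffAt.comp (k (a, y)) (hk.fiberCoord_smooth φ (by rwa [hk.base_apply]))
  have h5 : ContMDiff Y.I Z.I ∞ (fun z => k (a, z)) :=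
    hk.smooth.comp (contMDiff_const.prodMk contMDiff_id)
  intro w w' h
  have h6 : ∀ w : Y.T y, (mfderiv Z.I Y.I (fun z => (φ.γ a)⁻¹ • hk.fiberCoord φ z) (k (a, y))
      (P.pushR k a y w) : Y.model) = w := by
    intro w
    rw [pushR_apply, push_zero_left hk.smooth]
    have := mfderiv_comp_apply y (h4.mdifferentiableAt (by simp))
      (h5.mdifferentiableAt (by simp)) w
    refine this.symm.trans ?_
    refine (congrArg (fun f : Y → Y => (mfderiv Y.I Y.I f y w : Y.model)) h1).trans ?_
    rw [mfderiv_id]; rfl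
  exact (h6 w).symm.trans ((congrArg _ h).trans (h6 w'))

/-- The identity `k (b · g, z) = k (b, g z)` is differentiated in each variable. It underlies the
independence of representatives of all induced data. The equation is placed in the model space since
the two base points are equal but not by definition. -/
theorem push_act [ContMDiffSMul 𝓘(ℝ, EG) Y.I ∞ G Y] (a : P.Q) (g : G) (y : Y)
    (v : P.Q.T a) (w : Y.T y) :
    (P.push k (P.act a g) y (mfderiv P.Q.I P.Q.I (fun b => P.act b g) a v) w : Z.model) =
      P.push k a (g • y) v (pushG g y w) := by
  have hl : ∀ y : Y, ContMDiff P.Q.I Z.I ∞ (fun b => k (b, y)) := fun y =>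
    hk.smooth.comp (contMDiff_id.prodMk contMDiff_const)
  have hr : ∀ a : P.Q, ContMDiff Y.I Z.I ∞ (fun z => k (a, z)) := fun a =>
    hk.smooth.comp (contMDiff_const.prodMk contMDiff_id)
  have hg : ContMDiff Y.I Y.I ∞ (fun z : Y => g • z) :=
    (contMDiff_smul (I := 𝓘(ℝ, EG)) (I' := Y.I) (n := ∞) (G := G) (M := Y)).comp
      (contMDiff_const.prodMk contMDiff_id)
  have h1 := mfderiv_comp_apply a ((hl y).mdifferentiableAt (x := P.act a g) (by simp))
      ((act_smooth_left g).mdifferentiableAt (by simp)) v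
  have h2 := mfderiv_comp_apply y ((hr a).mdifferentiableAt (x := g • y) (by simp))
      (hg.mdifferentiableAt (by simp)) w
  have e1 : (fun b => k (b, y)) ∘ (fun b => P.act b g) = fun b => k (b, g • y) :=
    funext fun b => hk.map_act b g y
  have e2 : (fun z => k (a, z)) ∘ (fun z : Y => g • z) = fun z => k (P.act a g, z) :=
    funext fun z => (hk.map_act a g z).symm
  refine (push_eq hk.smooth _ _ _ _).trans ?_
  refine Eq.trans (b := (mfderiv P.Q.I Z.I (fun b => k (b, g • y)) a v +
    mfderiv Y.I Z.I (fun z => k (a, z)) (g • y) (pushG g y w) : Z.model)) ?_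
    (push_eq hk.smooth a (g • y) v (pushG g y w)).symm
  refine congrArg₂ (fun v w : Z.model => v + w) ?_ ?_
  · exact h1.symm.trans (congrArg (fun f : P.Q → Z => (mfderiv P.Q.I Z.I f a v : Z.model)) e1)
  · exact (congrArg (fun f : Y → Z => (mfderiv Y.I Z.I f y w : Z.model)) e2).symm.trans h2

variable {V : ∀ q : P.Q, Submodule ℝ (P.Q.T q)} (hV : P.IsConnection V)
include hV

/-- The submersion property supplies some preimage `(ξ, w₀)`. The vertical part of `ξ` is the
velocity of an orbit, and since `k (a · g, y) = k (a, g y)` it has the same image as the velocity of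
the orbit of `y`. Moving it over to the `Y` component leaves a vector of `V a`. -/
theorem exists_push [ContMDiffSMul 𝓘(ℝ, EG) Y.I ∞ G Y] (a : P.Q) (y : Y) (ζ : Z.T (k (a, y))) :
    ∃ v ∈ V a, ∃ w, P.push k a y v w = ζ := by
  obtain ⟨ξ, w₀, h⟩ : ∃ (ξ : P.Q.T a) (w₀ : Y.T y), P.push k a y ξ w₀ = ζ := by
    obtain ⟨⟨ξ, w₀⟩, h⟩ := hk.submersion (a, y) ζ
    exact ⟨ξ, w₀, h⟩
  have hh := hV.distribution.horizontal
  let ν : P.Q.T a := vertProj hh a ξ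
  have hν : ξ - ν ∈ V a := by
    rw [← vertProj_eq_zero_iff hh, map_sub, vertProj_coe, sub_self]
  obtain ⟨η, hη⟩ := exists_mfderiv_act_eq (vertProj hh a ξ).2
  have hl : ContMDiff P.Q.I Z.I ∞ (fun b => k (b, y)) :=
    hk.smooth.comp (contMDiff_id.prodMk contMDiff_const)
  have hr : ContMDiff Y.I Z.I ∞ (fun z => k (a, z)) :=
    hk.smooth.comp (contMDiff_const.prodMk contMDiff_id)
  have hg : ContMDiff 𝓘(ℝ, EG) Y.I ∞ (fun g : G => g • y) :=
    (contMDiff_smul (I := 𝓘(ℝ, EG)) (I' := Y.I) (n := ∞) (G := G) (M := Y)).comp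
      (contMDiff_id.prodMk contMDiff_const)
  have h1 := mfderiv_comp_apply_of_eq 1 (hl.mdifferentiableAt (x := a) (by simp))
    ((act_smooth_right a).mdifferentiableAt (x := (1 : G)) (by simp)) (P.act_one a) η
  have h2 := mfderiv_comp_apply_of_eq 1 (hr.mdifferentiableAt (x := y) (by simp))
    (hg.mdifferentiableAt (x := (1 : G)) (by simp)) (one_smul G y) η
  have e1 : (fun b => k (b, y)) ∘ (fun g => P.act a g) = (fun z => k (a, z)) ∘ fun g : G => g • y :=
    funext fun g => hk.map_act a g y
  let w₁ : Y.T y := mfderiv 𝓘(ℝ, EG) Y.I (fun g : G => g • y) 1 η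
  have h3 : P.push k a y ν 0 = P.push k a y 0 w₁ := by
    rw [push_zero_right hk.smooth, push_zero_left hk.smooth]
    refine (congrArg (mfderiv P.Q.I Z.I (fun b => k (b, y)) a) hη.symm).trans ?_
    refine h1.symm.trans (Eq.trans ?_ h2)
    exact congrArg (fun f : G → Z => (mfderiv 𝓘(ℝ, EG) Z.I f 1 η : Z.model)) e1
  refine ⟨ξ - ν, hν, w₀ + w₁, ?_⟩
  have h4 : P.push k a y (ξ - ν) (w₀ + w₁) =
      P.push k a y ξ w₀ - P.push k a y ν 0 + P.push k a y 0 w₁ := by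
    rw [← push_sub, ← push_add, sub_zero, add_zero]
  rw [h4, h3, sub_add_cancel, h]

/-- Projection to `M` determines the component in `V`, which is isomorphic to the tangent space of
`M`; the other component is then determined by `pushR_injective`. -/
theorem eq_of_push_eq [ContMDiffSMul 𝓘(ℝ, EG) Y.I ∞ G Y] {a : P.Q} {y : Y} {v v' : P.Q.T a}
    (hv : v ∈ V a) (hv' : v' ∈ V a) {w w' : Y.T y} (h : P.push k a y v w = P.push k a y v' w') :
    v = v' ∧ w = w' := by
  have h1 := congrArg (mfderiv Z.I P.M.I hk.base (k (a, y))) h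
  have h2 : (mfderiv P.Q.I P.M.I P.r a v : P.M.model) = mfderiv P.Q.I P.M.I P.r a v' :=
    (hk.mfderiv_base_push a y v w).symm.trans (h1.trans (hk.mfderiv_base_push a y v' w'))
  have h3 : v = v' := congrArg Subtype.val
    ((hV.distribution.horizontal a).1 (a₁ := ⟨v, hv⟩) (a₂ := ⟨v', hv'⟩) h2)
  subst h3
  refine ⟨rfl, hk.pushR_injective a y ?_⟩
  rw [push_split, push_split a y v w'] at h
  exact add_left_cancel h

/-- The `V` component is horizontal with smooth image in `M`, hence smooth. Once its image is
subtracted, the `Y` component is recovered through the injective maps `pushR`. -/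
theorem lift_along [ContMDiffSMul 𝓘(ℝ, EG) Y.I ∞ G Y] {EN HN N : Type*} [NormedAddCommGroup EN]
    [NormedSpace ℝ EN] [TopologicalSpace HN] {J : ModelWithCorners ℝ EN HN} [TopologicalSpace N]
    [ChartedSpace HN N] {b : N → P.Q} {c : N → Y} {v : ∀ n, P.Q.T (b n)} {w : ∀ n, Y.T (c n)}
    {n : N} (hb : ContMDiffAt J P.Q.I ∞ b n) (hc : ContMDiffAt J Y.I ∞ c n)
    (hv : ∀ n, v n ∈ V (b n))
    (hu : SmoothAlong J Z (fun n => k (b n, c n)) (fun n => P.push k (b n) (c n) (v n) (w n)) n) :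
    SmoothAlong J P.Q b v n ∧ SmoothAlong J Y c w n := by
  have h1 : SmoothAlong J P.Q b v n := by
    refine smoothAlong_of_mem hV.distribution P.r_smooth hb hv ?_
    have := mfderiv_along hk.base_smooth hu
    refine this.congr_of_eventuallyEq (Eventually.of_forall fun m => ?_)
    have e1 := hk.base_apply (b m) (c m)
    have e2 := hk.mfderiv_base_push (b m) (c m) (v m) (w m)
    refine TotalSpace.ext e1.symm ?_
    exact heq_of_eq e2.symm
  refine ⟨h1, ?_⟩
  have hz : SmoothAlong J P.Q b (fun n => 0) n := along_zero (E := fun x : P.Q => P.Q.T x) hb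
  refine along_of_injective (E := fun y : Y => Y.T y) (E' := fun z : Z => Z.T z) hc
    (fun n => P.pushR k (b n) (c n))
    (fun y => push_along hk.smooth hz (along_coordSymm hc y))
    (hk.pushR_injective (b n) (c n)) ?_
  have h2 := along_sub (E := fun z : Z => Z.T z) hu (push_along hk.smooth h1
    (along_zero (E := fun y : Y => Y.T y) hc))
  refine h2.congr_of_eventuallyEq (Eventually.of_forall fun m => ?_)
  refine congrArg (TotalSpace.mk' Z.model (E := fun z : Z => Z.T z) (k (b m, c m))) ?_
  change P.push k (b m) (c m) 0 (w m) = _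
  rw [← push_sub, sub_self, sub_zero]

end IsAssociated

end Assoc

end PrincipalBundle

end

noncomputable section

/-! ### Construction of the manifold `Q ×_G Y` -/

section Glue

variable {T E H N : Type*} [TopologicalSpace T] [NormedAddCommGroup E] [NormedSpace ℝ E]
  [TopologicalSpace H] {J : ModelWithCorners ℝ E H} [TopologicalSpace N] [ChartedSpace H N]
  [IsManifold J ∞ N]

/-- A topological space covered by charts with values in a manifold, with smooth transition maps,
is a manifold on which these charts are diffeomorphisms. -/
theorem exists_chartedSpace_of_charts (φ : T → OpenPartialHomeomorph T N)
    (hmem : ∀ t, t ∈ (φ t).source)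
    (hsm : ∀ s t, ContMDiffOn J J ∞ (fun x => φ t ((φ s).symm x))
      ((φ s).symm ≫ₕ φ t).source) :
    ∃ (_ : ChartedSpace H T) (_ : IsManifold J ∞ T),
      ∀ t, ContMDiffOn J J ∞ (φ t) (φ t).source ∧
        ContMDiffOn J J ∞ (φ t).symm (φ t).target := by
  let cs : ChartedSpace N T :=
    { atlas := range φ
      chartAt := φ
      mem_chart_source := hmem
      chart_mem_atlas := mem_range_self }
  let cs' : ChartedSpace H T := ChartedSpace.comp H N T
  have hman : IsManifold J ∞ T := by
    refine isManifold_of_contDiffOn _ _ _ ?_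
    rintro _ _ ⟨_, ⟨s, rfl⟩, c, hc, rfl⟩ ⟨_, ⟨t, rfl⟩, d, hd, rfl⟩
    have hc' : c ∈ IsManifold.maximalAtlas J ∞ N := IsManifold.subset_maximalAtlas hc
    have hd' : d ∈ IsManifold.maximalAtlas J ∞ N := IsManifold.subset_maximalAtlas hd
    have hg : ContMDiffOn J J ∞ ((φ s ≫ₕ c).symm ≫ₕ φ t ≫ₕ d)
        ((φ s ≫ₕ c).symm ≫ₕ φ t ≫ₕ d).source := by
      intro x hx'
      simp only [mfld_simps] at hx'
      obtain ⟨⟨hx1, hx2⟩, hx3, hx4⟩ := hx'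
      refine ContMDiffAt.contMDiffWithinAt ?_
      have h1 : ContMDiffAt J J ∞ c.symm x :=
        (contMDiffOn_symm_of_mem_maximalAtlas hc').contMDiffAt (c.open_target.mem_nhds hx1)
      have h2 : ContMDiffAt J J ∞ (fun x => φ t ((φ s).symm x)) (c.symm x) :=
        (hsm s t).contMDiffAt (((φ s).symm ≫ₕ φ t).open_source.mem_nhds ⟨hx2, hx3⟩)
      have h3 : ContMDiffAt J J ∞ d (φ t ((φ s).symm (c.symm x))) :=
        (contMDiffOn_of_mem_maximalAtlas hd').contMDiffAt (d.open_source.mem_nhds hx4)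
      have h4 : ContMDiffAt J J ∞ (fun x => φ t ((φ s).symm (c.symm x))) x :=
        ContMDiffAt.comp (g := fun x => φ t ((φ s).symm x)) (f := c.symm) x h2 h1
      have h5 : ContMDiffAt J J ∞ (fun x => d (φ t ((φ s).symm (c.symm x)))) x :=
        ContMDiffAt.comp (g := d) (f := fun x => φ t ((φ s).symm (c.symm x))) x h3 h4
      exact h5
    rw [← contMDiffOn_iff_contDiffOn]
    exact J.contMDiff.comp_contMDiffOn (hg.comp (J.contMDiffOn_symm.mono inter_subset_right)
      fun x hx => hx.1)
  refine ⟨cs', hman, fun t => ?_⟩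
  -- At the point `y` itself, `φ y` is smooth because the chart of `T` at `y` is `φ y` followed by a
  -- chart of `N`. At other points of its source, any `φ t` is a transition map after such a `φ y`.
  have hφ : ∀ y : T, ContMDiffAt J J ∞ (φ y) y := by
    intro y
    have h1 : ContMDiffAt J J ∞ (chartAt H y) y :=
      contMDiffAt_of_mem_maximalAtlas (IsManifold.chart_mem_maximalAtlas y)
        (mem_chart_source _ y)
    have h2 : ContMDiffAt J J ∞ (chartAt H (φ y y)).symm
        (chartAt H y y) :=
      contMDiffAt_symm_of_mem_maximalAtlas (IsManifold.chart_mem_maximalAtlas (φ y y))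
        ((chartAt H (φ y y)).map_source (mem_chart_source _ _))
    refine (h2.comp y h1).congr_of_eventuallyEq ?_
    filter_upwards [(chartAt H y).open_source.mem_nhds (mem_chart_source _ y)] with z hz
    have hz' : z ∈ (φ y ≫ₕ chartAt H (φ y y)).source := hz
    exact ((chartAt H (φ y y)).left_inv hz'.2).symm
  have hφs : ∀ y : T, ContMDiffAt J J ∞ (φ y).symm (φ y y) := by
    intro y
    have h1 : ContMDiffAt J J ∞ (chartAt H (φ y y)) (φ y y) :=
      contMDiffAt_of_mem_maximalAtlas (IsManifold.chart_mem_maximalAtlas (φ y y))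
        (mem_chart_source _ _)
    have h2 : ContMDiffAt J J ∞ (chartAt H y).symm
        (chartAt H y y) :=
      contMDiffAt_symm_of_mem_maximalAtlas (IsManifold.chart_mem_maximalAtlas y)
        ((chartAt H y).map_source (mem_chart_source _ y))
    refine (h2.comp (φ y y) h1).congr_of_eventuallyEq ?_
    filter_upwards [(chartAt H (φ y y)).open_source.mem_nhds (mem_chart_source _ (φ y y))]
      with z hz
    exact (congrArg (φ y).symm ((chartAt H (φ y y)).left_inv hz)).symm
  constructor
  · intro y hy
    refine ContMDiffAt.contMDiffWithinAt ?_
    have h1 : ContMDiffAt J J ∞ (fun x => φ t ((φ y).symm x)) (φ y y) :=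
      (hsm y t).contMDiffAt (((φ y).symm ≫ₕ φ t).open_source.mem_nhds
        ⟨(φ y).map_source (hmem y), by
          change (φ y).symm (φ y y) ∈ (φ t).source
          rwa [(φ y).left_inv (hmem y)]⟩)
    refine (h1.comp y (hφ y)).congr_of_eventuallyEq ?_
    filter_upwards [(φ y).open_source.mem_nhds (hmem y)] with z hz
    simp only [Function.comp_apply, (φ y).left_inv hz]
  · intro x hx
    refine ContMDiffAt.contMDiffWithinAt ?_
    set y := (φ t).symm x with hy
    have hyt : y ∈ (φ t).source := (φ t).map_target hx
    have hxy : φ t y = x := (φ t).right_inv hx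
    have h1 : ContMDiffAt J J ∞ (fun x => φ y ((φ t).symm x)) x :=
      (hsm t y).contMDiffAt (((φ t).symm ≫ₕ φ y).open_source.mem_nhds ⟨hx, hmem y⟩)
    refine (ContMDiffAt.comp x (hφs y) h1).congr_of_eventuallyEq ?_
    have h2 : ∀ᶠ z in 𝓝 x, (φ t).symm z ∈ (φ y).source :=
      ((φ t).continuousAt_symm hx).eventually ((φ y).open_source.mem_nhds (hmem y))
    filter_upwards [h2] with z hz
    exact ((φ y).left_inv hz).symm

end Glue

namespace PrincipalBundle

variable {EG : Type*} [NormedAddCommGroup EG] [NormedSpace ℝ EG]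
  {G : Type*} [TopologicalSpace G] [ChartedSpace EG G] [Group G]
  (P : PrincipalBundle.{u} (EG := EG) G) (Y : SmoothMfd.{u}) [MulAction G Y]

/-- The relation `(a · g, y) ∼ (a, g y)` on `Q × Y`. -/
def assocSetoid : Setoid (P.Q × Y) where
  r p q := ∃ g : G, p.1 = P.act q.1 g ∧ q.2 = g • p.2
  iseqv :=
    { refl := fun p => ⟨1, (P.act_one _).symm, (one_smul G _).symm⟩
      symm := by
        rintro p q ⟨g, h1, h2⟩
        refine ⟨g⁻¹, ?_, ?_⟩
        · rw [h1, ← P.act_mul, mul_inv_cancel, P.act_one]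
        · rw [h2, inv_smul_smul]
      trans := by
        rintro p q t ⟨g, h1, h2⟩ ⟨h, h3, h4⟩
        exact ⟨h * g, by rw [h1, h3, P.act_mul], by rw [h4, h2, mul_smul]⟩ }

/-- The space `Q ×_G Y`. -/
def AssocSpace : Type u := Quotient (P.assocSetoid Y)

instance : TopologicalSpace (P.AssocSpace Y) :=
  inferInstanceAs (TopologicalSpace (Quotient (P.assocSetoid Y)))

namespace AssocSpace

/-- The quotient map. -/
def mk (p : P.Q × Y) : P.AssocSpace Y := Quotient.mk (P.assocSetoid Y) p

variable {P Y}

theorem mk_eq_iff {p q : P.Q × Y} :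
    mk P Y p = mk P Y q ↔ ∃ g : G, p.1 = P.act q.1 g ∧ q.2 = g • p.2 :=
  Quotient.eq (r := P.assocSetoid Y)

theorem mk_surjective : Function.Surjective (mk P Y) := Quotient.mk_surjective

theorem mk_act (a : P.Q) (g : G) (y : Y) : mk P Y (P.act a g, y) = mk P Y (a, g • y) :=
  mk_eq_iff.2 ⟨g, rfl, rfl⟩

variable [LieGroup 𝓘(ℝ, EG) ∞ G] [ContMDiffSMul 𝓘(ℝ, EG) Y.I ∞ G Y]

/-- The saturation of an open set is the union of its translates under the homeomorphisms `(a, y) ↦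
(a · g, g⁻¹ y)`. -/
theorem isOpenQuotientMap_mk : IsOpenQuotientMap (mk P Y) := by
  refine ⟨mk_surjective, continuous_quot_mk, fun U hU => ?_⟩
  have h1 : mk P Y ⁻¹' (mk P Y '' U) =
      ⋃ g : G, (fun p : P.Q × Y => (P.act p.1 g, g⁻¹ • p.2)) ⁻¹' U := by
    ext p
    simp only [mem_preimage, mem_image, mem_iUnion]
    constructor
    · rintro ⟨q, hq, h⟩
      obtain ⟨g, h1, h2⟩ := mk_eq_iff.1 h
      refine ⟨g, ?_⟩
      rwa [← h1, h2, inv_smul_smul]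
    · rintro ⟨g, hg⟩
      exact ⟨_, hg, by rw [mk_act, smul_inv_smul]⟩
  have h2 : IsOpen (mk P Y ⁻¹' (mk P Y '' U)) := by
    rw [h1]
    refine isOpen_iUnion fun g => hU.preimage ?_
    have h3 : Continuous (fun y : Y => g⁻¹ • y) :=
      ((contMDiff_smul (I := 𝓘(ℝ, EG)) (I' := Y.I) (n := ∞) (G := G) (M := Y)).comp
        (contMDiff_const.prodMk contMDiff_id)).continuous
    exact ((act_smooth_left (P := P) g).continuous.comp continuous_fst).prodMk
      (h3.comp continuous_snd)
  exact h2

variable (P Y) in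
/-- The projection to `M`. -/
def base : P.AssocSpace Y → P.M := Quotient.lift (fun p => P.r p.1) (by
  rintro p q ⟨g, h, -⟩
  simp only [h, P.r_act])

theorem continuous_base : Continuous (base P Y) :=
  isOpenQuotientMap_mk.continuous_comp_iff.1 (P.r_smooth.continuous.comp continuous_fst)

/-- The fibre coordinate in a gauge. -/
def coord (φ : P.Gauge) (z : P.AssocSpace Y) : Y :=
  φ.γ (Classical.choose (mk_surjective z)).1 • (Classical.choose (mk_surjective z)).2

theorem coord_mk (φ : P.Gauge) {a : P.Q} (ha : P.r a ∈ φ.U) (y : Y) :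
    coord φ (mk P Y (a, y)) = φ.γ a • y := by
  unfold coord
  set p := Classical.choose (mk_surjective (mk P Y (a, y))) with hp
  obtain ⟨g, h1, h2⟩ := mk_eq_iff.1 (Classical.choose_spec (mk_surjective (mk P Y (a, y))))
  rw [← hp] at h1 h2
  change y = _ at h2
  rw [h1, φ.γ_act a ha, mul_smul, h2]

theorem contMDiffAt_coord_mk (φ : P.Gauge) {p : P.Q × Y} (hp : P.r p.1 ∈ φ.U) :
    ContMDiffAt (P.Q.I.prod Y.I) Y.I ∞ (fun p => coord φ (mk P Y p)) p := by
  have h1 : ContMDiffAt (P.Q.I.prod Y.I) Y.I ∞ (fun p : P.Q × Y => φ.γ p.1 • p.2) p :=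
    (contMDiff_smul (I := 𝓘(ℝ, EG)) (I' := Y.I) (n := ∞) (G := G) (M := Y)).contMDiffAt.comp p
      (((φ.contMDiffAt_γ hp).comp p contMDiffAt_fst).prodMk contMDiffAt_snd)
  refine h1.congr_of_eventuallyEq ?_
  filter_upwards [continuousAt_fst.eventually (φ.eventually_mem hp)] with p hp
  exact coord_mk φ hp p.2

/-- The chart of `Q ×_G Y` with values in `M × Y` given by a gauge. -/
def chart (φ : P.Gauge) : OpenPartialHomeomorph (P.AssocSpace Y) (P.M × Y) where
  toFun z := (base P Y z, coord φ z)
  invFun p := mk P Y (φ.s p.1, p.2)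
  source := base P Y ⁻¹' φ.U
  target := φ.U ×ˢ univ
  map_source' z hz := ⟨hz, mem_univ _⟩
  map_target' p hp := by
    change P.r (φ.s p.1) ∈ φ.U
    rw [φ.r_s _ hp.1]
    exact hp.1
  left_inv' z hz := by
    obtain ⟨⟨a, y⟩, rfl⟩ := mk_surjective z
    have hz : P.r a ∈ φ.U := hz
    change mk P Y (φ.s (P.r a), coord φ (mk P Y (a, y))) = _
    rw [coord_mk φ hz, ← mk_act, φ.act_γ a hz]
  right_inv' p hp := by
    have hp := hp.1
    refine Prod.ext (φ.r_s _ hp) ?_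
    change coord φ (mk P Y (φ.s p.1, p.2)) = p.2
    rw [coord_mk φ (by rwa [φ.r_s _ hp]), φ.γ_s hp, one_smul]
  open_source := φ.isOpen.preimage continuous_base
  open_target := φ.isOpen.prod isOpen_univ
  continuousOn_toFun := by
    intro z hz
    obtain ⟨p, rfl⟩ := mk_surjective z
    refine ContinuousAt.continuousWithinAt ?_
    refine continuous_base.continuousAt.prodMk ?_
    exact isOpenQuotientMap_mk.continuousAt_comp_iff.1 (contMDiffAt_coord_mk φ hz).continuousAt
  continuousOn_invFun := by
    refine isOpenQuotientMap_mk.continuous.comp_continuousOn ?_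
    exact (φ.smooth_s.continuousOn.comp continuousOn_fst fun p hp => hp.1).prodMk continuousOn_snd

/-- The transition maps are `(m, y) ↦ (m, γ (s m) y)`, with the section of one gauge and the group
coordinate of the other. -/
theorem chart_transition (φ ψ : P.Gauge) : ContMDiffOn (P.M.I.prod Y.I) (P.M.I.prod Y.I) ∞
    (fun x => chart (Y := Y) ψ ((chart φ).symm x)) ((chart (Y := Y) φ).symm ≫ₕ chart ψ).source := by
  rintro p ⟨hp, hp'⟩
  have hp1 : p.1 ∈ φ.U := hp.1
  have hp2 : P.r (φ.s p.1) ∈ ψ.U := hp'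
  refine ContMDiffAt.contMDiffWithinAt ?_
  have h1 : ContMDiffAt (P.M.I.prod Y.I) (P.Q.I.prod Y.I) ∞
      (fun p : P.M × Y => (φ.s p.1, p.2)) p :=
    ((φ.contMDiffAt_s hp1).comp p contMDiffAt_fst).prodMk contMDiffAt_snd
  have h2 : ContMDiffAt (P.M.I.prod Y.I) P.M.I ∞ (fun p : P.M × Y => P.r (φ.s p.1)) p :=
    P.r_smooth.contMDiffAt.comp p (contMDiffAt_fst.comp p h1)
  have h3 : ContMDiffAt (P.M.I.prod Y.I) Y.I ∞
      (fun p : P.M × Y => coord ψ (mk P Y (φ.s p.1, p.2))) p :=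
    ContMDiffAt.comp p (contMDiffAt_coord_mk (p := (φ.s p.1, p.2)) ψ hp2) h1
  exact h2.prodMk h3

/-- Points over distinct points of `M` are separated in `M`; points over the same point lie in one
chart, which has a Hausdorff target. -/
instance : T2Space (P.AssocSpace Y) := by
  refine ⟨fun z w hzw => ?_⟩
  by_cases h : base P Y z = base P Y w
  · obtain ⟨φ, hφ⟩ := P.exists_gauge (base P Y z)
    have hz : z ∈ (chart (Y := Y) φ).source := hφ
    have hw : w ∈ (chart (Y := Y) φ).source := by
      change base P Y w ∈ φ.U
      rwa [← h]
    obtain ⟨A, B, hA, hB, hzA, hwB, hAB⟩ := t2_separation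
      (fun e => hzw ((chart (Y := Y) φ).injOn hz hw e))
    refine ⟨_, _, (chart (Y := Y) φ).isOpen_inter_preimage hA,
      (chart (Y := Y) φ).isOpen_inter_preimage hB, ⟨hz, hzA⟩, ⟨hw, hwB⟩, ?_⟩
    exact (hAB.preimage _).mono inter_subset_right inter_subset_right
  · obtain ⟨A, B, hA, hB, hzA, hwB, hAB⟩ := t2_separation h
    exact ⟨_, _, hA.preimage continuous_base, hB.preimage continuous_base, hzA, hwB,
      hAB.preimage _⟩

instance : SecondCountableTopology (P.AssocSpace Y) :=
  isOpenQuotientMap_mk.isQuotientMap.secondCountableTopology isOpenQuotientMap_mk.isOpenMap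

end AssocSpace

variable [LieGroup 𝓘(ℝ, EG) ∞ G] [ContMDiffSMul 𝓘(ℝ, EG) Y.I ∞ G Y]

/-- Associated bundles exist. -/
theorem exists_isAssociated : ∃ (Z : SmoothMfd.{u}) (k : P.Q × Y → Z), P.IsAssociated Y Z k := by
  choose φ hφ using fun z : P.AssocSpace Y => P.exists_gauge (AssocSpace.base P Y z)
  obtain ⟨cs, hman, hsm⟩ := exists_chartedSpace_of_charts (J := P.M.I.prod Y.I) (N := P.M × Y)
    (fun z => AssocSpace.chart (Y := Y) (φ z)) hφ
    (fun z w => AssocSpace.chart_transition (φ z) (φ w))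
  -- The two models with corners on the product are equal but not by definition; smoothness is
  -- proved for the product model and transferred along this equality.
  have hI : 𝓘(ℝ, P.M.model × Y.model) = P.M.I.prod Y.I := modelWithCornersSelf_prod
  let Z : SmoothMfd.{u} :=
    { carrier := P.AssocSpace Y
      model := P.M.model × Y.model
      charted := cs
      smooth := by rw [hI]; exact hman }
  have hZ : Z.I = P.M.I.prod Y.I := hI
  let k : P.Q × Y → P.AssocSpace Y := AssocSpace.mk P Y
  have hchart : ∀ z : P.AssocSpace Y, ContMDiffAt (P.M.I.prod Y.I) (P.M.I.prod Y.I) ∞ (AssocSpace.chart (Y := Y) (φ z)) z :=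
    fun z => (hsm z).1.contMDiffAt ((AssocSpace.chart (φ z)).open_source.mem_nhds (hφ z))
  have hsymm : ∀ (z : P.AssocSpace Y) (p : P.M × Y), p.1 ∈ (φ z).U → ContMDiffAt (P.M.I.prod Y.I) (P.M.I.prod Y.I) ∞
      (AssocSpace.chart (Y := Y) (φ z)).symm p := fun z p hp =>
    (hsm z).2.contMDiffAt ((AssocSpace.chart (φ z)).open_target.mem_nhds ⟨hp, mem_univ _⟩)
  have hk : ContMDiff (P.Q.I.prod Y.I) (P.M.I.prod Y.I) ∞ k := by
    rintro ⟨a, y⟩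
    have ha : P.r a ∈ (φ (k (a, y))).U := hφ (k (a, y))
    have h1 : ContMDiffAt (P.Q.I.prod Y.I) (P.M.I.prod Y.I) ∞
        (fun p : P.Q × Y => (P.r p.1, AssocSpace.coord (φ (k (a, y))) (AssocSpace.mk P Y p)))
        (a, y) :=
      (P.r_smooth.contMDiffAt.comp (a, y) contMDiffAt_fst).prodMk
        (AssocSpace.contMDiffAt_coord_mk _ ha)
    refine (ContMDiffAt.comp (a, y) (hsymm (k (a, y)) _ ha) h1).congr_of_eventuallyEq ?_
    filter_upwards [continuousAt_fst.eventually ((φ (k (a, y))).eventually_mem ha)] with p hp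
    exact ((AssocSpace.chart (Y := Y) (φ (k (a, y)))).left_inv
      (x := AssocSpace.mk P Y p) hp).symm
  refine ⟨Z, k, by rw [hZ]; exact hk, AssocSpace.mk_surjective, ?_,
    fun a b y z => AssocSpace.mk_eq_iff⟩
  rw [hZ]
  rintro ⟨a, y⟩
  set ψ := φ (k (a, y)) with hψ
  have ha : P.r a ∈ ψ.U := hφ (k (a, y))
  -- The section of the gauge, translated by `ψ.γ a` so as to pass through `(a, y)`. Differentiating
  -- `k ∘ σ = id` there shows that `k` is a submersion.
  let σ : P.AssocSpace Y → P.Q × Y := fun z =>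
    (P.act (ψ.s (AssocSpace.base P Y z)) (ψ.γ a), (ψ.γ a)⁻¹ • AssocSpace.coord ψ z)
  have hσk : σ (k (a, y)) = (a, y) := by
    refine Prod.ext (ψ.act_γ a ha) ?_
    change (ψ.γ a)⁻¹ • AssocSpace.coord ψ (AssocSpace.mk P Y (a, y)) = y
    rw [AssocSpace.coord_mk ψ ha, inv_smul_smul]
  have hkσ : (fun z => k (σ z)) =ᶠ[𝓝 (k (a, y))] id := by
    filter_upwards [(AssocSpace.chart (Y := Y) ψ).open_source.mem_nhds ha] with z hz
    change AssocSpace.mk P Y _ = z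
    simp only [σ, AssocSpace.mk_act, smul_inv_smul]
    exact (AssocSpace.chart (Y := Y) ψ).left_inv hz
  have h1 : ContMDiffAt (P.M.I.prod Y.I) P.Q.I ∞
      (fun p : P.M × Y => P.act (ψ.s p.1) (ψ.γ a))
        (P.r a, AssocSpace.coord ψ (AssocSpace.mk P Y (a, y))) :=
    (act_smooth_left (ψ.γ a)).contMDiffAt.comp _ (ContMDiffAt.comp _ (ψ.contMDiffAt_s ha)
      contMDiffAt_fst)
  have h2 : ContMDiff (P.M.I.prod Y.I) Y.I ∞ (fun p : P.M × Y => (ψ.γ a)⁻¹ • p.2) :=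
    (contMDiff_smul (I := 𝓘(ℝ, EG)) (I' := Y.I) (n := ∞) (G := G) (M := Y)).comp
      (contMDiff_const.prodMk contMDiff_snd)
  have hσ : ContMDiffAt (P.M.I.prod Y.I) (P.Q.I.prod Y.I) ∞ σ (k (a, y)) :=
    ContMDiffAt.comp (k (a, y)) (h1.prodMk h2.contMDiffAt) (hchart (k (a, y)))
  intro ζ
  have h3 := mfderiv_comp_apply_of_eq (k (a, y)) (hk.mdifferentiableAt (x := (a, y)) (by simp))
    (hσ.mdifferentiableAt (by simp)) hσk ζ
  have h4 : mfderiv (P.M.I.prod Y.I) (P.M.I.prod Y.I) (fun z => k (σ z)) (k (a, y)) ζ = ζ := by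
    rw [hkσ.mfderiv_eq, mfderiv_id]; rfl
  exact ⟨_, h3.symm.trans h4⟩

end PrincipalBundle

end

noncomputable section

/-! ### Smooth complex vector bundles from complex linear coordinate changes -/

section Core

variable {B : SmoothMfd.{u}} {F : Type u} [NormedAddCommGroup F] [NormedSpace ℂ F]
  [FiniteDimensional ℂ F] {ι : Type*} (c : VectorBundleCore ℂ B F ι)

theorem isLinear_real_of_complex {B F : Type*} {E : B → Type*} [TopologicalSpace B]
    [TopologicalSpace F] [TopologicalSpace (TotalSpace F E)] [AddCommGroup F] [Module ℂ F]
    [∀ x, AddCommGroup (E x)] [∀ x, Module ℂ (E x)] (e : Trivialization F (π F E))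
    [h : e.IsLinear ℂ] : e.IsLinear ℝ where
  linear b hb := by
    have h1 := h.linear b hb
    refine ⟨h1.1, fun r x => ?_⟩
    have h2 := h1.2 (r : ℂ) x
    rwa [Complex.coe_smul, Complex.coe_smul] at h2

instance (x : B) : IsTopologicalAddGroup (c.Fiber x) := inferInstanceAs (IsTopologicalAddGroup F)

instance (x : B) : ContinuousSMul ℝ (c.Fiber x) := inferInstanceAs (ContinuousSMul ℝ F)

instance (i : ι) : (c.localTriv i).IsLinear ℝ := isLinear_real_of_complex _

theorem coordChangeL_real_apply (i j : ι) {x : B} (hx : x ∈ c.baseSet i ∩ c.baseSet j) (y : F) :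
    (c.localTriv i).coordChangeL ℝ (c.localTriv j) x y = c.coordChange i j x y := by
  rw [← c.localTriv_coordChange_eq i j hx]
  exact (Trivialization.coordChangeL_apply (R := ℝ) _ _ hx y).trans
    (Trivialization.coordChangeL_apply (R := ℂ) _ _ hx y).symm

/-- The smooth complex vector bundle given by smooth complex linear coordinate changes. -/
def ComplexBundle.ofCore
    (hc : ∀ i j y, ∀ x ∈ c.baseSet i ∩ c.baseSet j,
      ContMDiffAt B.I 𝓘(ℝ, F) ∞ (fun x => c.coordChange i j x y) x) : ComplexBundle B :=
  have hF : FiniteDimensional ℝ F := FiniteDimensional.complexToReal F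
  have hsm : ∀ i j, ContMDiffOn B.I 𝓘(ℝ, F →L[ℝ] F) ∞ (fun b : B =>
      ((c.localTriv i).coordChangeL ℝ (c.localTriv j) b : F →L[ℝ] F))
      (c.baseSet i ∩ c.baseSet j) := fun i j x hx =>
    (contMDiffAt_clm_of_apply (N := B) (J := B.I) (F := F) (F' := F) fun y => by
      refine (hc i j y x hx).congr_of_eventuallyEq ?_
      filter_upwards [((c.isOpen_baseSet i).inter (c.isOpen_baseSet j)).mem_nhds hx] with z hz
      exact coordChangeL_real_apply c i j hz y).contMDiffWithinAt
  have hreal : VectorBundle ℝ F c.Fiber :=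
    { trivialization_linear' := by
        rintro _ ⟨i, rfl⟩
        exact isLinear_real_of_complex (c.localTriv i)
      continuousOn_coordChange' := by
        rintro _ _ ⟨i, rfl⟩ ⟨j, rfl⟩
        exact (hsm i j).continuousOn }
  { F := F
    fib := c.Fiber
    smooth :=
      { contMDiffOn_coordChangeL := by
          rintro _ _ ⟨i, rfl⟩ ⟨j, rfl⟩
          exact hsm i j } }

end Core

section ComplexCoord

variable {X : SmoothMfd.{u}} (E : ComplexBundle X)

/-- The complex linear coordinate `E_x → F` in the preferred trivialization at `x₀`. -/
abbrev ComplexBundle.coordC (x₀ x : X) : E.fib x →L[ℂ] E.F :=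
  (trivializationAt E.F E.fib x₀).continuousLinearMapAt ℂ x

/-- The inverse of the complex linear coordinate. -/
abbrev ComplexBundle.symmC (x₀ x : X) : E.F →L[ℂ] E.fib x :=
  (trivializationAt E.F E.fib x₀).symmL ℂ x

variable {E}

theorem ComplexBundle.symmC_coordC {x₀ x : X} (hx : x ∈ (trivializationAt E.F E.fib x₀).baseSet)
    (v : E.fib x) : E.symmC x₀ x (E.coordC x₀ x v) = v :=
  (trivializationAt E.F E.fib x₀).symmL_continuousLinearMapAt hx v

theorem ComplexBundle.coordC_symmC {x₀ x : X} (hx : x ∈ (trivializationAt E.F E.fib x₀).baseSet)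
    (v : E.F) : E.coordC x₀ x (E.symmC x₀ x v) = v :=
  (trivializationAt E.F E.fib x₀).continuousLinearMapAt_symmL hx v

theorem ComplexBundle.coordC_apply {x₀ x : X} (hx : x ∈ (trivializationAt E.F E.fib x₀).baseSet)
    (v : E.fib x) : E.coordC x₀ x v = (trivializationAt E.F E.fib x₀ ⟨x, v⟩).2 := by
  rw [coordC, Trivialization.continuousLinearMapAt_apply, Trivialization.linearMapAt_apply,
    if_pos hx]

/-- Over either field this is the inverse of the same trivialization on its base set and zero
elsewhere, so smoothness proved over the reals applies to complex linear coordinates. -/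
theorem ComplexBundle.symmC_eq (x₀ x : X) (y : E.F) :
    E.symmC x₀ x y = coordSymm E.F E.fib x₀ x y := by
  by_cases hx : x ∈ (trivializationAt E.F E.fib x₀).baseSet
  · rw [symmC, coordSymm, Trivialization.symmL_apply _ hx, Trivialization.symmL_apply _ hx]
  · rw [symmC, coordSymm, Trivialization.symmL_apply_of_notMem _ hx,
      Trivialization.symmL_apply_of_notMem _ hx]

theorem ComplexBundle.contMDiffAt_coordC {x₀ : X} {p : E.Tot}
    (hp : p.proj ∈ (trivializationAt E.F E.fib x₀).baseSet) :
    ContMDiffAt E.ITot 𝓘(ℝ, E.F) ∞ (fun p : E.Tot => E.coordC x₀ p.proj p.snd) p := by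
  have hs : (trivializationAt E.F E.fib x₀).source ∈ 𝓝 p :=
    (trivializationAt E.F E.fib x₀).open_source.mem_nhds
      ((trivializationAt E.F E.fib x₀).mem_source.2 hp)
  have h1 : ContMDiffAt E.ITot (X.I.prod 𝓘(ℝ, E.F)) ∞ (trivializationAt E.F E.fib x₀) p :=
    ((trivializationAt E.F E.fib x₀).contMDiffOn (IB := X.I)).contMDiffAt hs
  refine (contMDiffAt_snd.comp p h1).congr_of_eventuallyEq ?_
  filter_upwards [hs] with q hq
  exact ComplexBundle.coordC_apply ((trivializationAt E.F E.fib x₀).mem_source.1 hq) q.snd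

theorem ComplexBundle.contMDiffAt_symmC {x₀ x : X}
    (hx : x ∈ (trivializationAt E.F E.fib x₀).baseSet) (y : E.F) :
    ContMDiffAt X.I E.ITot ∞ (fun x => TotalSpace.mk' E.F x (E.symmC x₀ x y)) x := by
  simp only [ComplexBundle.symmC_eq]
  exact contMDiffAt_coordSymm x₀ hx y

end ComplexCoord

end

/-! ### Construction of the bundle `E_Q` and of the associated tower -/

noncomputable section

variable {EG : Type*} [NormedAddCommGroup EG] [NormedSpace ℝ EG]
  {G : Type*} [TopologicalSpace G] [ChartedSpace EG G] [Group G]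

namespace TowerAction

variable {τ : Tower.{u}} [MulAction G τ.X] [MulAction G τ.S] (α : TowerAction (EG := EG) G τ)

/-- The action on the total space of `E`. -/
def actTot (g : G) (p : τ.E.Tot) : τ.E.Tot :=
  TotalSpace.mk' τ.E.F (g • p.proj) (α.ρ g p.proj p.snd)

theorem actTot_one (p : τ.E.Tot) : α.actTot 1 p = p := α.ρ_one p.proj p.snd

theorem actTot_mul (g h : G) (p : τ.E.Tot) :
    α.actTot (g * h) p = α.actTot g (α.actTot h p) := α.ρ_mul g h p.proj p.snd

/-- The inverse comes from `g⁻¹`, but it lands in the fibre over `g⁻¹ • g • x`; for this reason the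
argument runs in the total space. -/
theorem ρ_bijective (g : G) (x : τ.X) : Function.Bijective (α.ρ g x) := by
  have h1 : ∀ p, α.actTot g⁻¹ (α.actTot g p) = p := fun p => by
    rw [← α.actTot_mul, inv_mul_cancel, α.actTot_one]
  have h2 : ∀ p, α.actTot g (α.actTot g⁻¹ p) = p := fun p => by
    rw [← α.actTot_mul, mul_inv_cancel, α.actTot_one]
  constructor
  · intro e f h
    have h3 := h1 (TotalSpace.mk' τ.E.F x e)
    have h4 := h1 (TotalSpace.mk' τ.E.F x f)
    have h5 : α.actTot g (TotalSpace.mk' τ.E.F x e) = α.actTot g (TotalSpace.mk' τ.E.F x f) :=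
      congrArg (TotalSpace.mk' τ.E.F (g • x)) h
    rw [h5, h4] at h3
    exact (TotalSpace.mk_inj.1 h3).symm
  · intro f
    obtain ⟨y, e, hy⟩ : ∃ (y : τ.X) (e : τ.E.fib y),
        α.actTot g⁻¹ (TotalSpace.mk' τ.E.F (g • x) f) = TotalSpace.mk' τ.E.F y e := ⟨_, _, rfl⟩
    have hyx : y = x := by
      have := congrArg TotalSpace.proj hy
      exact this.symm.trans (inv_smul_smul g x)
    subst hyx
    refine ⟨e, ?_⟩
    have h3 := h2 (TotalSpace.mk' τ.E.F (g • y) f)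
    rw [hy] at h3
    exact TotalSpace.mk_inj.1 h3

end TowerAction

namespace PrincipalBundle.IsAssociated

variable [LieGroup 𝓘(ℝ, EG) ∞ G] {P : PrincipalBundle.{u} (EG := EG) G}
  {τ : Tower.{u}} [MulAction G τ.X] [MulAction G τ.S] (α : TowerAction (EG := EG) G τ)
  {Z : SmoothMfd.{u}} {k : P.Q × τ.X → Z} (hk : P.IsAssociated τ.X Z k)

/-- A chosen gauge at a point of `M`. -/
def gauge (m : P.M) : P.Gauge := Classical.choose (P.exists_gauge m)

theorem mem_gauge (m : P.M) : m ∈ (gauge (P := P) m).U := Classical.choose_spec (P.exists_gauge m)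

include hk in
/-- The gauge at the base point of `i`. -/
abbrev gaugeAt (i : Z) : P.Gauge := gauge (hk.base i)

include hk in
/-- The point of `X` at the centre of the chart at `i`. -/
abbrev centre (i : Z) : τ.X := hk.fiberCoord (hk.gaugeAt i) i

/-- The coordinate in the typical fibre of the class `[a, p]`, for `p ∈ E`. -/
def fibCoord (i : Z) (a : P.Q) (x : τ.X) : τ.E.fib x →ₗ[ℂ] τ.E.F :=
  (τ.E.coordC (hk.centre i) ((hk.gaugeAt i).γ a • x)).toLinearMap ∘ₗ α.ρ ((hk.gaugeAt i).γ a) x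

theorem fibCoord_eq (i : Z) (a : P.Q) (p : τ.E.Tot) :
    fibCoord α hk i a p.proj p.snd =
      τ.E.coordC (hk.centre i) (α.actTot ((hk.gaugeAt i).γ a) p).proj
        (α.actTot ((hk.gaugeAt i).γ a) p).snd := rfl

include hk in
/-- The domain of the bundle chart at `i`. -/
def dom (i : Z) : Set Z :=
  {z | hk.base z ∈ (hk.gaugeAt i).U ∧
    hk.fiberCoord (hk.gaugeAt i) z ∈ (trivializationAt τ.E.F τ.E.fib (hk.centre i)).baseSet}

theorem fibCoord_act {i : Z} {a : P.Q} (ha : P.r a ∈ (hk.gaugeAt i).U) (g : G) (p : τ.E.Tot) :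
    fibCoord α hk i (P.act a g) p.proj p.snd =
      fibCoord α hk i a (α.actTot g p).proj (α.actTot g p).snd := by
  simp only [fibCoord_eq]
  rw [(hk.gaugeAt i).γ_act a ha, α.actTot_mul]

theorem mem_dom_self (i : Z) : i ∈ hk.dom i := by
  refine ⟨mem_gauge _, ?_⟩
  exact mem_baseSet_trivializationAt _ _ _

variable [ContMDiffSMul 𝓘(ℝ, EG) τ.X.I ∞ G τ.X]

theorem isOpen_dom (i : Z) : IsOpen (hk.dom i) := by
  have h1 : ContinuousOn (hk.fiberCoord (hk.gaugeAt i)) (hk.base ⁻¹' (hk.gaugeAt i).U) := fun z hz =>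
    (hk.fiberCoord_smooth _ hz).continuousAt.continuousWithinAt
  exact h1.isOpen_inter_preimage
    ((hk.gaugeAt i).isOpen.preimage hk.base_smooth.continuous)
    (trivializationAt τ.E.F τ.E.fib (hk.centre i)).open_baseSet

/-- The coordinate changes of `E_Q`. -/
def coordChange (i j : Z) (z : Z) : τ.E.F →L[ℂ] τ.E.F :=
  LinearMap.toContinuousLinearMap
    (fibCoord α hk j ((hk.gaugeAt i).s (hk.base z)) (hk.fiberCoord (hk.gaugeAt i) z) ∘ₗ
      (τ.E.symmC (hk.centre i) (hk.fiberCoord (hk.gaugeAt i) z)).toLinearMap)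

theorem coordChange_apply (i j z : Z) (v : τ.E.F) : coordChange α hk i j z v =
    fibCoord α hk j ((hk.gaugeAt i).s (hk.base z)) (hk.fiberCoord (hk.gaugeAt i) z)
      (τ.E.symmC (hk.centre i) (hk.fiberCoord (hk.gaugeAt i) z) v) := rfl

/-- The class `[a, p]` is also represented by `(s (r a), γ a · p)`, and the coordinate at `i` is
that of `γ a · p`. Inverting it and taking the coordinate at `j` of this representative gives the
coordinate at `j` of `[a, p]`. The cocycle condition and the smoothness of `Q × E → E_Q` both
follow. -/
theorem coordChange_fibCoord {i j : Z} {a : P.Q} {p : τ.E.Tot} (hi : k (a, p.proj) ∈ hk.dom i)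
    (hj : k (a, p.proj) ∈ hk.dom j) :
    coordChange α hk i j (k (a, p.proj)) (fibCoord α hk i a p.proj p.snd) =
      fibCoord α hk j a p.proj p.snd := by
  set φ := hk.gaugeAt i with hφ
  have ha : P.r a ∈ φ.U := by have := hi.1; rwa [hk.base_apply] at this
  have haj : P.r a ∈ (hk.gaugeAt j).U := by have := hj.1; rwa [hk.base_apply] at this
  have hF : hk.fiberCoord φ (k (a, p.proj)) = (α.actTot (φ.γ a) p).proj :=
    hk.fiberCoord_apply φ ha _
  have hsj : P.r (φ.s (P.r a)) ∈ (hk.gaugeAt j).U := by rwa [φ.r_s _ ha]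
  have h1 : fibCoord α hk j a p.proj p.snd = fibCoord α hk j (φ.s (P.r a))
      (α.actTot (φ.γ a) p).proj (α.actTot (φ.γ a) p).snd := by
    rw [← fibCoord_act α hk hsj, φ.act_γ a ha]
  have hb : (α.actTot (φ.γ a) p).proj ∈
      (trivializationAt τ.E.F τ.E.fib (hk.centre i)).baseSet := hF ▸ hi.2
  rw [h1, coordChange_apply, fibCoord_eq, ← hφ, hF, hk.base_apply,
    ComplexBundle.symmC_coordC hb]

theorem contMDiffAt_fibCoord {i : Z} {a : P.Q} {p : τ.E.Tot} (hi : k (a, p.proj) ∈ hk.dom i) :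
    ContMDiffAt (P.Q.I.prod τ.E.ITot) 𝓘(ℝ, τ.E.F) ∞
      (fun q : P.Q × τ.E.Tot => fibCoord α hk i q.1 q.2.proj q.2.snd) (a, p) := by
  set φ := hk.gaugeAt i with hφ
  have ha : P.r a ∈ φ.U := by have := hi.1; rwa [hk.base_apply] at this
  have hF : hk.fiberCoord φ (k (a, p.proj)) = (α.actTot (φ.γ a) p).proj :=
    hk.fiberCoord_apply φ ha _
  have hb : (α.actTot (φ.γ a) p).proj ∈
      (trivializationAt τ.E.F τ.E.fib (hk.centre i)).baseSet := hF ▸ hi.2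
  have h1 : ContMDiffAt (P.Q.I.prod τ.E.ITot) (𝓘(ℝ, EG).prod τ.E.ITot) ∞
      (fun q : P.Q × τ.E.Tot => (φ.γ q.1, q.2)) (a, p) :=
    ((φ.contMDiffAt_γ ha).comp (a, p) contMDiffAt_fst).prodMk contMDiffAt_snd
  have h2 : ContMDiffAt (P.Q.I.prod τ.E.ITot) τ.E.ITot ∞
      (fun q : P.Q × τ.E.Tot => α.actTot (φ.γ q.1) q.2) (a, p) :=
    α.ρ_smooth.contMDiffAt.comp (a, p) h1
  exact ContMDiffAt.comp (a, p) (ComplexBundle.contMDiffAt_coordC hb) h2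

theorem contMDiffAt_coordChange (i j : Z) (y : τ.E.F) {z : Z} (hz : z ∈ hk.dom i ∩ hk.dom j) :
    ContMDiffAt Z.I 𝓘(ℝ, τ.E.F) ∞ (fun z => coordChange α hk i j z y) z := by
  set φ := hk.gaugeAt i with hφ
  have h1 : ContMDiffAt Z.I P.Q.I ∞ (fun z => φ.s (hk.base z)) z :=
    ContMDiffAt.comp z (φ.contMDiffAt_s hz.1.1) hk.base_smooth.contMDiffAt
  have h2 : ContMDiffAt Z.I τ.E.ITot ∞ (fun z => TotalSpace.mk' τ.E.F (hk.fiberCoord φ z)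
      (τ.E.symmC (hk.centre i) (hk.fiberCoord φ z) y)) z :=
    ContMDiffAt.comp z (ComplexBundle.contMDiffAt_symmC hz.1.2 y) (hk.fiberCoord_smooth φ hz.1.1)
  exact ContMDiffAt.comp z (contMDiffAt_fibCoord α hk
    (p := TotalSpace.mk' τ.E.F (hk.fiberCoord φ z)
      (τ.E.symmC (hk.centre i) (hk.fiberCoord φ z) y)) (by
        have := hk.map_section_fiberCoord φ hz.1.1
        change k (φ.s (hk.base z), hk.fiberCoord φ z) ∈ _
        rw [this]
        exact hz.2)) (h1.prodMk h2)

/-- The bundle core of `E_Q`. -/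
def core : VectorBundleCore ℂ Z τ.E.F Z where
  baseSet := hk.dom
  isOpen_baseSet := hk.isOpen_dom
  indexAt := id
  mem_baseSet_at := hk.mem_dom_self
  coordChange := coordChange α hk
  coordChange_self i z hz v := by
    have h1 := coordChange_fibCoord α hk (i := i) (j := i) (a := (hk.gaugeAt i).s (hk.base z))
      (p := TotalSpace.mk' τ.E.F (hk.fiberCoord (hk.gaugeAt i) z)
        (τ.E.symmC (hk.centre i) (hk.fiberCoord (hk.gaugeAt i) z) v))
    have hp : TotalSpace.mk' τ.E.F (hk.fiberCoord (hk.gaugeAt i) z)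
        (τ.E.symmC (hk.centre i) (hk.fiberCoord (hk.gaugeAt i) z) v) =
        α.actTot 1 (TotalSpace.mk' τ.E.F (hk.fiberCoord (hk.gaugeAt i) z)
        (τ.E.symmC (hk.centre i) (hk.fiberCoord (hk.gaugeAt i) z) v)) := (α.actTot_one _).symm
    rw [coordChange_apply]
    refine (fibCoord_eq α hk i _ (TotalSpace.mk' τ.E.F (hk.fiberCoord (hk.gaugeAt i) z)
        (τ.E.symmC (hk.centre i) (hk.fiberCoord (hk.gaugeAt i) z) v))).trans ?_
    rw [(hk.gaugeAt i).γ_s hz.1, α.actTot_one]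
    exact ComplexBundle.coordC_symmC hz.2 v
  continuousOn_coordChange i j := by
    rw [continuousOn_clm_apply]
    intro y z hz
    exact (contMDiffAt_coordChange α hk i j y hz).continuousAt.continuousWithinAt
  coordChange_comp i j l z hz v := by
    have hm := hk.map_section_fiberCoord (hk.gaugeAt i) hz.1.1.1
    have h1 := coordChange_fibCoord α hk (i := j) (j := l) (a := (hk.gaugeAt i).s (hk.base z))
      (p := TotalSpace.mk' τ.E.F (hk.fiberCoord (hk.gaugeAt i) z)
        (τ.E.symmC (hk.centre i) (hk.fiberCoord (hk.gaugeAt i) z) v))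
      (by
        change k ((hk.gaugeAt i).s (hk.base z), hk.fiberCoord (hk.gaugeAt i) z) ∈ _
        rw [hm]; exact hz.1.2)
      (by
        change k ((hk.gaugeAt i).s (hk.base z), hk.fiberCoord (hk.gaugeAt i) z) ∈ _
        rw [hm]; exact hz.2)
    change coordChange α hk j l (k ((hk.gaugeAt i).s (hk.base z), hk.fiberCoord (hk.gaugeAt i) z))
      _ = _ at h1
    rw [hm] at h1
    exact h1

/-- The vector bundle `E_Q`. -/
def bundle : ComplexBundle Z :=
  ComplexBundle.ofCore (core α hk) fun i j y _ hz => contMDiffAt_coordChange α hk i j y hz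

/-- The isomorphisms `E_x ≃ (E_Q)_{[a, x]}`. -/
def toBundle (a : P.Q) (x : τ.X) : τ.E.fib x →ₗ[ℂ] (bundle α hk).fib (k (a, x)) :=
  fibCoord α hk (k (a, x)) a x

theorem toBundle_bijective (a : P.Q) (x : τ.X) : Function.Bijective (toBundle α hk a x) := by
  have hm := hk.mem_dom_self (k (a, x))
  set φ := hk.gaugeAt (k (a, x)) with hφ
  have ha : P.r a ∈ φ.U := by have := hm.1; rwa [hk.base_apply] at this
  have hF : hk.fiberCoord φ (k (a, x)) = φ.γ a • x := hk.fiberCoord_apply φ ha _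
  have hb : φ.γ a • x ∈ (trivializationAt τ.E.F τ.E.fib (hk.centre (k (a, x)))).baseSet :=
    hF ▸ hm.2
  have h1 : Function.Bijective (τ.E.coordC (hk.centre (k (a, x))) (φ.γ a • x)) :=
    Function.bijective_iff_has_inverse.2 ⟨_, ComplexBundle.symmC_coordC hb,
      ComplexBundle.coordC_symmC hb⟩
  exact h1.comp (α.ρ_bijective (φ.γ a) x)

theorem toBundle_smooth : ContMDiff (P.Q.I.prod τ.E.ITot) (bundle α hk).ITot ∞
    (fun p : P.Q × τ.E.Tot => TotalSpace.mk' (bundle α hk).F (k (p.1, p.2.proj))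
      (toBundle α hk p.1 p.2.proj p.2.snd)) := by
  rintro ⟨a, p⟩
  have hbase : ContMDiff (P.Q.I.prod τ.E.ITot) Z.I ∞
      (fun p : P.Q × τ.E.Tot => k (p.1, p.2.proj)) :=
    hk.smooth.comp (contMDiff_fst.prodMk ((contMDiff_proj τ.E.fib).comp contMDiff_snd))
  refine contMDiffAt_totalSpace.2 ⟨hbase.contMDiffAt, ?_⟩
  have hm := hk.mem_dom_self (k (a, p.proj))
  refine (contMDiffAt_fibCoord α hk hm).congr_of_eventuallyEq ?_
  filter_upwards [hbase.continuous.continuousAt.eventually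
    ((hk.isOpen_dom (k (a, p.proj))).mem_nhds hm)] with q hq
  exact coordChange_fibCoord α hk (hk.mem_dom_self _) hq

theorem toBundle_act (a : P.Q) (g : G) (x : τ.X) (e : τ.E.fib x) :
    TotalSpace.mk' (bundle α hk).F (k (P.act a g, x)) (toBundle α hk (P.act a g) x e) =
      TotalSpace.mk' (bundle α hk).F (k (a, g • x)) (toBundle α hk a (g • x) (α.ρ g x e)) := by
  -- The two base points are generalized to `z = z'`, so that after substitution both sides lie in
  -- one fibre.
  have h1 : ∀ (z z' : Z) (_ : z = z') (_ : P.r a ∈ (hk.gaugeAt z).U),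
      TotalSpace.mk (F := (bundle α hk).F) (E := (bundle α hk).fib) z
        (fibCoord α hk z (P.act a g) x e) =
      TotalSpace.mk (F := (bundle α hk).F) (E := (bundle α hk).fib) z'
        (fibCoord α hk z' a (g • x) (α.ρ g x e)) := by
    rintro z _ rfl hz
    exact congrArg (TotalSpace.mk (F := (bundle α hk).F) (E := (bundle α hk).fib) z)
      (fibCoord_act α hk hz g (TotalSpace.mk' τ.E.F x e))
  refine h1 _ _ (hk.map_act a g x) ?_
  have := (hk.mem_dom_self (k (P.act a g, x))).1
  rwa [hk.base_apply, P.r_act] at this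

end PrincipalBundle.IsAssociated

namespace PrincipalBundle

variable [LieGroup 𝓘(ℝ, EG) ∞ G] (P : PrincipalBundle.{u} (EG := EG) G)
  {τ : Tower.{u}} [MulAction G τ.X] [MulAction G τ.S] (α : TowerAction (EG := EG) G τ)
  [ContMDiffSMul 𝓘(ℝ, EG) τ.X.I ∞ G τ.X] [ContMDiffSMul 𝓘(ℝ, EG) τ.S.I ∞ G τ.S]

theorem nonempty_associatedTower : Nonempty (P.AssociatedTower α) := by
  obtain ⟨X, qX, hX⟩ := P.exists_isAssociated τ.X
  obtain ⟨S, qS, hS⟩ := P.exists_isAssociated τ.S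
  refine ⟨{
    tower := { X := X
               S := S
               pr := fun z => qS ((hX.rep z).1, τ.pr (hX.rep z).2)
               E := IsAssociated.bundle α hX }
    qX := qX
    qS := qS
    assocX := hX
    assocS := hS
    pr_q := fun a x => ?_
    qE := IsAssociated.toBundle α hX
    qE_bijective := IsAssociated.toBundle_bijective α hX
    qE_smooth := IsAssociated.toBundle_smooth α hX
    qE_invariant := IsAssociated.toBundle_act α hX }⟩
  obtain ⟨g, h1, h2⟩ := hX.exists_rep_eq a x
  refine (hS.fibers _ _ _ _).2 ⟨g, h1, ?_⟩
  rw [← α.pr_smul, ← h2]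

end PrincipalBundle

end

/-! ### Lifts of sections and vertical vectors from the associated tower -/

noncomputable section

variable {EG : Type*} [NormedAddCommGroup EG] [NormedSpace ℝ EG]
  {G : Type*} [TopologicalSpace G] [ChartedSpace EG G] [Group G]

section PushG

theorem smul_smooth (EG : Type*) [NormedAddCommGroup EG] [NormedSpace ℝ EG] {G : Type*}
    [TopologicalSpace G] [ChartedSpace EG G] [Group G] {Y : SmoothMfd.{u}} [MulAction G Y]
    [ContMDiffSMul 𝓘(ℝ, EG) Y.I ∞ G Y] (g : G) : ContMDiff Y.I Y.I ∞ (fun y : Y => g • y) :=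
  (contMDiff_smul (I := 𝓘(ℝ, EG)) (I' := Y.I) (n := ∞) (G := G) (M := Y)).comp
    (contMDiff_const.prodMk contMDiff_id)

end PushG

section TowerBasics

variable {τ : Tower.{u}} [MulAction G τ.X] [MulAction G τ.S] (α : TowerAction (EG := EG) G τ)
  [ContMDiffSMul 𝓘(ℝ, EG) τ.X.I ∞ G τ.X] [ContMDiffSMul 𝓘(ℝ, EG) τ.S.I ∞ G τ.S]

include α in
theorem pushG_mem_vert (hpr : ContMDiff τ.X.I τ.S.I ∞ τ.pr) (g : G) {x : τ.X} {w : τ.X.T x}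
    (hw : w ∈ vert τ.pr x) : pushG g x w ∈ vert τ.pr (g • x) := by
  have h1 := mfderiv_comp_apply x (hpr.mdifferentiableAt (x := g • x) (by simp))
    ((smul_smooth EG g).mdifferentiableAt (by simp)) w
  have h2 := mfderiv_comp_apply x ((smul_smooth EG g).mdifferentiableAt (x := τ.pr x) (by simp))
    (hpr.mdifferentiableAt (by simp)) w
  have h3 : τ.pr ∘ (fun z : τ.X => g • z) = (fun s : τ.S => g • s) ∘ τ.pr :=
    funext fun z => α.pr_smul g z
  have h4 : mfderiv τ.X.I τ.S.I τ.pr x w = 0 := hw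
  rw [h4, map_zero] at h2
  exact h1.symm.trans ((congrArg (fun f : τ.X → τ.S =>
    (mfderiv τ.X.I τ.S.I f x w : τ.S.model)) h3).trans h2)

end TowerBasics

namespace PrincipalBundle.AssociatedTower

variable [LieGroup 𝓘(ℝ, EG) ∞ G] {P : PrincipalBundle.{u} (EG := EG) G}
  {τ : Tower.{u}} [MulAction G τ.X] [MulAction G τ.S] {α : TowerAction (EG := EG) G τ}
  (R : P.AssociatedTower α)

/-- The isomorphisms `E_x ≃ (E_Q)_{[a, x]}` as linear equivalences. -/
def qEquiv (a : P.Q) (x : τ.X) : τ.E.fib x ≃ₗ[ℂ] R.tower.E.fib (R.qX (a, x)) :=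
  LinearEquiv.ofBijective (R.qE a x) (R.qE_bijective a x)

theorem qE_qEquiv_symm (a : P.Q) (x : τ.X) (f : R.tower.E.fib (R.qX (a, x))) :
    R.qE a x ((R.qEquiv a x).symm f) = f := (R.qEquiv a x).apply_symm_apply f

theorem qEquiv_symm_qE (a : P.Q) (x : τ.X) (e : τ.E.fib x) :
    (R.qEquiv a x).symm (R.qE a x e) = e := (R.qEquiv a x).symm_apply_apply e

/-- The lift of a section of `E_Q` to `Q × X`. -/
def liftSection (σ : ∀ z, R.tower.E.fib z) (a : P.Q) (x : τ.X) : τ.E.fib x :=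
  (R.qEquiv a x).symm (σ (R.qX (a, x)))

theorem qE_liftSection (σ : ∀ z, R.tower.E.fib z) (a : P.Q) (x : τ.X) :
    R.qE a x (R.liftSection σ a x) = σ (R.qX (a, x)) := R.qE_qEquiv_symm a x _

theorem eq_liftSection {σ : ∀ z, R.tower.E.fib z} {a : P.Q} {x : τ.X} {e : τ.E.fib x}
    (h : R.qE a x e = σ (R.qX (a, x))) : e = R.liftSection σ a x :=
  (R.qE_bijective a x).1 (h.trans (R.qE_liftSection σ a x).symm)

/-- By equivariance, two restrictions of the lift to slices over one orbit of `Q` are related by `ρ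
g`, the situation in which the invariance of `∇^E` is stated. -/
theorem ρ_liftSection (σ : ∀ z, R.tower.E.fib z) (a : P.Q) (g : G) (x : τ.X) :
    α.ρ g x (R.liftSection σ (P.act a g) x) = R.liftSection σ a (g • x) := by
  refine R.eq_liftSection ?_
  have h1 := R.qE_invariant a g x (R.liftSection σ (P.act a g) x)
  rw [R.qE_liftSection] at h1
  have h2 : TotalSpace.mk' R.tower.E.F (R.qX (P.act a g, x)) (σ (R.qX (P.act a g, x))) =
      TotalSpace.mk' R.tower.E.F (R.qX (a, g • x)) (σ (R.qX (a, g • x))) := by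
    rw [R.assocX.map_act]
  exact (TotalSpace.mk_inj.1 (h2.symm.trans h1)).symm

section Along

variable {EN HN N : Type*} [NormedAddCommGroup EN] [NormedSpace ℝ EN] [TopologicalSpace HN]
  {J : ModelWithCorners ℝ EN HN} [TopologicalSpace N] [ChartedSpace HN N]
  {b : N → P.Q} {c : N → τ.X} {n : N}

theorem qE_along {e : ∀ n, τ.E.fib (c n)} (hb : ContMDiffAt J P.Q.I ∞ b n)
    (he : τ.E.SmoothAlong J c e n) :
    R.tower.E.SmoothAlong J (fun n => R.qX (b n, c n)) (fun n => R.qE (b n) (c n) (e n)) n :=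
  R.qE_smooth.contMDiffAt.comp n (hb.prodMk he)

theorem qEquiv_symm_along {f : ∀ n, R.tower.E.fib (R.qX (b n, c n))}
    (hb : ContMDiffAt J P.Q.I ∞ b n) (hc : ContMDiffAt J τ.X.I ∞ c n)
    (hf : R.tower.E.SmoothAlong J (fun n => R.qX (b n, c n)) f n) :
    τ.E.SmoothAlong J c (fun n => (R.qEquiv (b n) (c n)).symm (f n)) n := by
  refine along_of_injective hc (fun n => (R.qE (b n) (c n)).restrictScalars ℝ)
    (fun y => R.qE_along hb (along_coordSymm hc y)) (R.qE_bijective (b n) (c n)).1 ?_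
  refine hf.congr_of_eventuallyEq (Eventually.of_forall fun m => ?_)
  exact congrArg (TotalSpace.mk' R.tower.E.F (R.qX (b m, c m))) (R.qE_qEquiv_symm _ _ _)

theorem liftSection_along {σ : ∀ z, R.tower.E.fib z} (hb : ContMDiffAt J P.Q.I ∞ b n)
    (hc : ContMDiffAt J τ.X.I ∞ c n)
    (hσ : ContMDiffAt R.tower.X.I R.tower.E.ITot ∞ (fun z => TotalSpace.mk' R.tower.E.F z (σ z))
      (R.qX (b n, c n))) :
    τ.E.SmoothAlong J c (fun n => R.liftSection σ (b n) (c n)) n :=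
  R.qEquiv_symm_along hb hc (ContMDiffAt.comp n hσ (R.assocX.smooth.contMDiffAt.comp n
    (hb.prodMk hc)))

/-- The coordinate of the lift is a smooth family of linear maps `A`, the inverse of `qE` in frames,
applied to the differentiable coordinate of `σ`. The axioms of a covariant derivative require this
weak regularity. -/
theorem liftSection_mdifferentiableAt {σ : ∀ z, R.tower.E.fib z} (hb : ContMDiffAt J P.Q.I ∞ b n)
    (hc : ContMDiffAt J τ.X.I ∞ c n)
    (hσ : MDifferentiableAt R.tower.X.I R.tower.E.ITot
      (fun z => TotalSpace.mk' R.tower.E.F z (σ z)) (R.qX (b n, c n))) :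
    MDifferentiableAt J 𝓘(ℝ, τ.E.F) (fun m => coordAt τ.E.F τ.E.fib (c n) (c m)
      (R.liftSection σ (b m) (c m))) n := by
  set z := R.qX (b n, c n) with hz
  have hq : ContMDiffAt J R.tower.X.I ∞ (fun m => R.qX (b m, c m)) n :=
    R.assocX.smooth.contMDiffAt.comp n (hb.prodMk hc)
  let A : N → R.tower.E.F →L[ℝ] τ.E.F := fun m => LinearMap.toContinuousLinearMap
    ((coordAt τ.E.F τ.E.fib (c n) (c m)).toLinearMap ∘ₗ
      ((R.qEquiv (b m) (c m)).symm.toLinearMap.restrictScalars ℝ) ∘ₗ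
        (coordSymm R.tower.E.F R.tower.E.fib z (R.qX (b m, c m))).toLinearMap)
  have hA : ContMDiffAt J 𝓘(ℝ, R.tower.E.F →L[ℝ] τ.E.F) ∞ A n :=
    contMDiffAt_clm_of_apply fun y =>
      along_coord (R.qEquiv_symm_along hb hc (along_coordSymm hq y))
  have h1 : MDifferentiableAt J 𝓘(ℝ, R.tower.E.F) (fun m => coordAt R.tower.E.F R.tower.E.fib z
      (R.qX (b m, c m)) (σ (R.qX (b m, c m)))) n :=
    MDifferentiableAt.comp n (along_mdifferentiableAt_coord (b := id) hσ).2
      (hq.mdifferentiableAt (by simp))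
  refine ((hA.mdifferentiableAt (by simp)).clm_apply h1).congr_of_eventuallyEq ?_
  filter_upwards [hq.continuousAt.eventually
    (eventually_mem_baseSet R.tower.E.F R.tower.E.fib z)] with m hm
  change coordAt τ.E.F τ.E.fib (c n) (c m) ((R.qEquiv (b m) (c m)).symm (σ (R.qX (b m, c m)))) =
    coordAt τ.E.F τ.E.fib (c n) (c m) ((R.qEquiv (b m) (c m)).symm
      (coordSymm R.tower.E.F R.tower.E.fib z (R.qX (b m, c m)) (coordAt _ _ _ _ _)))
  rw [coordSymm_coordAt hm]

end Along

theorem pr_smooth (hpr : ContMDiff τ.X.I τ.S.I ∞ τ.pr) :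
    ContMDiff R.tower.X.I R.tower.S.I ∞ R.tower.pr := by
  intro z
  obtain ⟨⟨a, x⟩, rfl⟩ := R.assocX.surjective z
  refine R.assocX.contMDiffAt_of_comp ?_
  have h1 : ContMDiff (P.Q.I.prod τ.X.I) R.tower.S.I ∞ (fun p : P.Q × τ.X => R.qS (p.1, τ.pr p.2)) :=
    R.assocS.smooth.comp (contMDiff_fst.prodMk (hpr.comp contMDiff_snd))
  exact h1.contMDiffAt.congr_of_eventuallyEq (Eventually.of_forall fun p => R.pr_q p.1 p.2)

section Vertical

variable (hpr : ContMDiff τ.X.I τ.S.I ∞ τ.pr)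
include hpr

theorem mfderiv_pr_push (a : P.Q) (x : τ.X) (v : P.Q.T a) (w : τ.X.T x) :
    (mfderiv R.tower.X.I R.tower.S.I R.tower.pr (R.qX (a, x)) (P.push R.qX a x v w) :
      R.tower.S.model) = P.push R.qS a (τ.pr x) v (mfderiv τ.X.I τ.S.I τ.pr x w) := by
  refine (mfderiv_push R.assocX.smooth ((R.pr_smooth hpr).mdifferentiableAt (by simp)) v w).trans ?_
  have h1 : (fun p => R.tower.pr (R.qX p)) = fun p => R.qS (p.1, τ.pr p.2) :=
    funext fun p => R.pr_q p.1 p.2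
  refine (congrArg (fun f : P.Q × τ.X → R.tower.S => (P.push f a x v w : R.tower.S.model))
    h1).trans ?_
  have h2 : ContMDiff (P.Q.I.prod τ.X.I) R.tower.S.I ∞ (fun p : P.Q × τ.X => R.qS (p.1, τ.pr p.2)) :=
    R.assocS.smooth.comp (contMDiff_fst.prodMk (hpr.comp contMDiff_snd))
  refine (push_eq h2 a x v w).trans ?_
  have h3 : ContMDiff τ.S.I R.tower.S.I ∞ (fun s => R.qS (a, s)) :=
    R.assocS.smooth.comp (contMDiff_const.prodMk contMDiff_id)
  refine Eq.trans ?_ (push_eq R.assocS.smooth a (τ.pr x) v _).symm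
  let m : R.tower.S.model := mfderiv P.Q.I R.tower.S.I (fun b => R.qS (b, τ.pr x)) a v
  refine congrArg (fun w : R.tower.S.model => m + w) ?_
  exact mfderiv_comp_apply x (h3.mdifferentiableAt (x := τ.pr x) (by simp))
    (hpr.mdifferentiableAt (by simp)) w

theorem push_mem_vert {a : P.Q} {x : τ.X} {w : τ.X.T x} (hw : w ∈ vert τ.pr x) :
    P.push R.qX a x 0 w ∈ vert R.tower.pr (R.qX (a, x)) := by
  have h1 := R.mfderiv_pr_push hpr a x 0 w
  have h2 : mfderiv τ.X.I τ.S.I τ.pr x w = 0 := hw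
  rw [h2] at h1
  exact h1.trans (push_zero a (τ.pr x))

variable [ContMDiffSMul 𝓘(ℝ, EG) τ.X.I ∞ G τ.X] [ContMDiffSMul 𝓘(ℝ, EG) τ.S.I ∞ G τ.S]
  {V : ∀ q : P.Q, Submodule ℝ (P.Q.T q)} (hV : P.IsConnection V)
include hV

/-- The image in `S_Q` is the push of `v` and `pr_* w`, and the splitting of the tangent space of
`S_Q` lets it vanish only if both components do. -/
theorem push_mem_vert_iff {a : P.Q} {x : τ.X} {v : P.Q.T a} (hv : v ∈ V a) {w : τ.X.T x} :
    P.push R.qX a x v w ∈ vert R.tower.pr (R.qX (a, x)) ↔ v = 0 ∧ w ∈ vert τ.pr x := by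
  constructor
  · intro h
    have h1 : P.push R.qS a (τ.pr x) v (mfderiv τ.X.I τ.S.I τ.pr x w) =
        P.push R.qS a (τ.pr x) 0 0 :=
      ((R.mfderiv_pr_push hpr a x v w).symm.trans h).trans (push_zero a (τ.pr x)).symm
    exact R.assocS.eq_of_push_eq hV hv (V a).zero_mem h1
  · rintro ⟨rfl, hw⟩
    exact R.push_mem_vert hpr hw

/-- The isomorphism `T_x(X/S) ≃ T_{[a, x]}(X_Q/S_Q)`. -/
def vertEquiv (a : P.Q) (x : τ.X) : vert τ.pr x ≃ₗ[ℝ] vert R.tower.pr (R.qX (a, x)) :=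
  LinearEquiv.ofBijective ((P.pushR R.qX a x).restrict fun _ hw => R.push_mem_vert hpr hw) (by
    constructor
    · intro w w' h
      exact Subtype.ext (R.assocX.pushR_injective a x (congrArg Subtype.val h))
    · intro ζ
      obtain ⟨v, hv, w, h⟩ := R.assocX.exists_push hV a x (ζ : R.tower.X.T (R.qX (a, x)))
      have h1 : P.push R.qX a x v w ∈ vert R.tower.pr (R.qX (a, x)) := h ▸ ζ.2
      obtain ⟨rfl, hw⟩ := (R.push_mem_vert_iff hpr hV hv).1 h1
      exact ⟨⟨w, hw⟩, Subtype.ext h⟩)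

end Vertical

end PrincipalBundle.AssociatedTower

end

noncomputable section

/-! ### Derivatives of maps into a fixed fibre, and the lifted derivative `d_Q + ∇^E` -/

section Mvfderiv

variable {EN HN N : Type*} [NormedAddCommGroup EN] [NormedSpace ℝ EN] [TopologicalSpace HN]
  {J : ModelWithCorners ℝ EN HN} [TopologicalSpace N] [ChartedSpace HN N]
  {EB HB B : Type*} [NormedAddCommGroup EB] [NormedSpace ℝ EB] [TopologicalSpace HB]
  {I : ModelWithCorners ℝ EB HB} [TopologicalSpace B] [ChartedSpace HB B]
  {W W' : Type*} [NormedAddCommGroup W] [NormedSpace ℝ W] [NormedAddCommGroup W'] [NormedSpace ℝ W']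

theorem mdifferentiableAt_clm_comp (C : W →L[ℝ] W') {h : N → W} {n : N}
    (hh : MDifferentiableAt J 𝓘(ℝ, W) h n) : MDifferentiableAt J 𝓘(ℝ, W') (fun m => C (h m)) n :=
  C.differentiableAt.mdifferentiableAt.comp n hh

theorem mvfderiv_clm_comp (C : W →L[ℝ] W') {h : N → W} {n : N}
    (hh : MDifferentiableAt J 𝓘(ℝ, W) h n) (v : TangentSpace J n) :
    mvfderiv J (fun m => C (h m)) n v = C (mvfderiv J h n v) := by
  have h1 := mfderiv_comp_apply n (C.differentiableAt (x := h n)).mdifferentiableAt hh v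
  refine Eq.trans h1 ?_
  rw [mfderiv_eq_fderiv, C.fderiv]
  rfl

theorem mvfderiv_comp_apply {g : B → W} {f : N → B} {n : N} (hg : MDifferentiableAt I 𝓘(ℝ, W) g (f n))
    (hf : MDifferentiableAt J I f n) (v : TangentSpace J n) :
    mvfderiv J (fun m => g (f m)) n v = mvfderiv I g (f n) (mfderiv J I f n v) :=
  mfderiv_comp_apply n hg hf v

end Mvfderiv

namespace ComplexBundle

variable {X Y A B : SmoothMfd.{u}} (E : ComplexBundle X) (E' : ComplexBundle Y)

/-- Differentiability of a map into one fixed fibre. -/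
abbrev FiberDifferentiableAt (A : SmoothMfd.{u}) (x : X) (f : A → E.fib x) (a : A) : Prop :=
  MDifferentiableAt A.I 𝓘(ℝ, E.F) (fun b => coordAt E.F E.fib x x (f b)) a

theorem fiberDeriv_eq (x : X) (f : A → E.fib x) (a : A) (v : A.T a) :
    E.fiberDeriv A x f a v =
      coordSymm E.F E.fib x x (mvfderiv A.I (fun b => coordAt E.F E.fib x x (f b)) a v) := by
  have h : ∀ e : E.fib x, (trivializationAt E.F E.fib x).continuousLinearEquivAt ℝ x
      (FiberBundle.mem_baseSet_trivializationAt' x) e = coordAt E.F E.fib x x e := fun e =>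
    (Trivialization.coe_continuousLinearEquivAt_eq (R := ℝ) (trivializationAt E.F E.fib x)
      (FiberBundle.mem_baseSet_trivializationAt' x)) ▸ rfl
  unfold fiberDeriv
  simp only [h]
  refine (ContinuousLinearEquiv.symm_apply_eq _).2 ?_
  rw [h, coordAt_coordSymm (mem_baseSet_trivializationAt _ _ x)]

theorem coordAt_fiberDeriv (x : X) (f : A → E.fib x) (a : A) (v : A.T a) :
    coordAt E.F E.fib x x (E.fiberDeriv A x f a v) =
      mvfderiv A.I (fun b => coordAt E.F E.fib x x (f b)) a v := by
  rw [fiberDeriv_eq, coordAt_coordSymm (mem_baseSet_trivializationAt _ _ x)]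

variable {E} in
theorem coordAt_self_injective (x : X) : Function.Injective (coordAt E.F E.fib x x) :=
  Function.LeftInverse.injective (g := coordSymm E.F E.fib x x)
    fun e => coordSymm_coordAt (mem_baseSet_trivializationAt _ _ x) e

/-- The derivative of a map into one fixed fibre, as a linear map. -/
def fiberDerivₗ (x : X) (f : A → E.fib x) (a : A) : A.T a →ₗ[ℝ] E.fib x :=
  (coordSymm E.F E.fib x x).toLinearMap ∘ₗ
    (mvfderiv A.I (fun b => coordAt E.F E.fib x x (f b)) a).toLinearMap

theorem fiberDerivₗ_apply (x : X) (f : A → E.fib x) (a : A) (v : A.T a) :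
    E.fiberDerivₗ x f a v = E.fiberDeriv A x f a v := (E.fiberDeriv_eq x f a v).symm

variable {E E'} {x : X} {a : A} {f f' : A → E.fib x}

theorem fiberDeriv_add (hf : E.FiberDifferentiableAt A x f a) (hf' : E.FiberDifferentiableAt A x f' a)
    (v : A.T a) : E.fiberDeriv A x (fun b => f b + f' b) a v =
      E.fiberDeriv A x f a v + E.fiberDeriv A x f' a v := by
  apply coordAt_self_injective x
  simp only [map_add, coordAt_fiberDeriv]
  rw [mvfderiv_fun_add hf hf']
  rfl

theorem fiberDeriv_smul {c : A → ℝ} (hc : MDifferentiableAt A.I 𝓘(ℝ, ℝ) c a)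
    (hf : E.FiberDifferentiableAt A x f a) (v : A.T a) :
    E.fiberDeriv A x (fun b => c b • f b) a v =
      c a • E.fiberDeriv A x f a v + mvfderiv A.I c a v • f a := by
  apply coordAt_self_injective x
  simp only [map_add, map_smul, coordAt_fiberDeriv]
  rw [mvfderiv_fun_smul hc hf]
  rfl

/-- In fibre coordinates a fixed linear map is a constant matrix. This is how the group action, the
grading and complex scalars commute with the derivative along `Q`. -/
theorem FiberDifferentiableAt.map {y : Y} (T : E.fib x →ₗ[ℝ] E'.fib y)
    (hf : E.FiberDifferentiableAt A x f a) : E'.FiberDifferentiableAt A y (fun b => T (f b)) a ∧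
      ∀ v, E'.fiberDeriv A y (fun b => T (f b)) a v = T (E.fiberDeriv A x f a v) := by
  let C : E.F →L[ℝ] E'.F := LinearMap.toContinuousLinearMap
    ((coordAt E'.F E'.fib y y).toLinearMap ∘ₗ T ∘ₗ (coordSymm E.F E.fib x x).toLinearMap)
  have hC : ∀ e, coordAt E'.F E'.fib y y (T e) = C (coordAt E.F E.fib x x e) := fun e => by
    change _ = coordAt E'.F E'.fib y y (T (coordSymm E.F E.fib x x (coordAt E.F E.fib x x e)))
    rw [coordSymm_coordAt (mem_baseSet_trivializationAt _ _ x)]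
  have h1 : (fun b => coordAt E'.F E'.fib y y (T (f b))) =
      fun b => C (coordAt E.F E.fib x x (f b)) := funext fun b => hC (f b)
  constructor
  · rw [FiberDifferentiableAt, h1]
    exact mdifferentiableAt_clm_comp C hf
  · intro v
    apply coordAt_self_injective y
    rw [coordAt_fiberDeriv, h1, mvfderiv_clm_comp C hf, hC, coordAt_fiberDeriv]

theorem fiberDeriv_comp {h : B → A} {b : B} (hf : E.FiberDifferentiableAt A x f (h b))
    (hh : MDifferentiableAt B.I A.I h b) (v : B.T b) :
    E.fiberDeriv B x (fun b => f (h b)) b v =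
      E.fiberDeriv A x f (h b) (mfderiv B.I A.I h b v) := by
  apply coordAt_self_injective x
  simp only [coordAt_fiberDeriv]
  exact mvfderiv_comp_apply hf hh v

end ComplexBundle

namespace PrincipalBundle.AssociatedTower

variable {EG : Type*} [NormedAddCommGroup EG] [NormedSpace ℝ EG]
  {G : Type*} [TopologicalSpace G] [ChartedSpace EG G] [Group G] [LieGroup 𝓘(ℝ, EG) ∞ G]
  {P : PrincipalBundle.{u} (EG := EG) G}
  {τ : Tower.{u}} [MulAction G τ.X] [MulAction G τ.S] {α : TowerAction (EG := EG) G τ}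
  (R : P.AssociatedTower α)

theorem liftSection_smooth {σ : ∀ z, R.tower.E.fib z} (hσ : R.tower.E.SmoothOn σ univ) (a : P.Q) :
    τ.E.SmoothOn (R.liftSection σ a) univ := by
  refine contMDiffOn_univ.2 fun x => ?_
  exact R.liftSection_along (b := fun _ => a) (c := id) contMDiffAt_const contMDiffAt_id
    (contMDiffOn_univ.1 hσ _)

theorem mdifferentiableAt_liftSection {σ : ∀ z, R.tower.E.fib z} {a : P.Q} {x : τ.X}
    (hσ : MDifferentiableAt R.tower.X.I R.tower.E.ITot
      (fun z => TotalSpace.mk' R.tower.E.F z (σ z)) (R.qX (a, x))) :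
    MDifferentiableAt τ.X.I τ.E.ITot
      (fun y => TotalSpace.mk' τ.E.F y (R.liftSection σ a y)) x := by
  refine (mdifferentiableAt_totalSpace τ.X.I _).2 ⟨mdifferentiableAt_id, ?_⟩
  refine (R.liftSection_mdifferentiableAt (b := fun _ => a) (c := id) (n := x) contMDiffAt_const
    contMDiffAt_id hσ).congr_of_eventuallyEq ?_
  filter_upwards [eventually_mem_baseSet τ.E.F τ.E.fib x] with y hy
  exact (coordAt_apply hy _).symm

theorem fiberDifferentiableAt_liftSection {σ : ∀ z, R.tower.E.fib z} {a : P.Q} {x : τ.X}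
    (hσ : MDifferentiableAt R.tower.X.I R.tower.E.ITot
      (fun z => TotalSpace.mk' R.tower.E.F z (σ z)) (R.qX (a, x))) :
    τ.E.FiberDifferentiableAt P.Q x (fun b => R.liftSection σ b x) a :=
  R.liftSection_mdifferentiableAt (b := id) (c := fun _ => x) (n := a) contMDiffAt_id
    contMDiffAt_const hσ

/-- The pulled back derivative `(d_Q + ∇^E)_{(v, w)}` of the lift of a section of `E_Q`. -/
def liftDeriv (𝒟 : GeometricData τ) (σ : ∀ z, R.tower.E.fib z) (a : P.Q) (x : τ.X) (v : P.Q.T a)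
    (w : τ.X.T x) : τ.E.fib x :=
  τ.E.fiberDeriv P.Q x (fun b => R.liftSection σ b x) a v + 𝒟.nabla (R.liftSection σ a) x w

variable (𝒟 : GeometricData τ)

theorem liftDeriv_add {σ σ' : ∀ z, R.tower.E.fib z} {a : P.Q} {x : τ.X}
    (hσ : MDifferentiableAt R.tower.X.I R.tower.E.ITot
      (fun z => TotalSpace.mk' R.tower.E.F z (σ z)) (R.qX (a, x)))
    (hσ' : MDifferentiableAt R.tower.X.I R.tower.E.ITot
      (fun z => TotalSpace.mk' R.tower.E.F z (σ' z)) (R.qX (a, x))) (v : P.Q.T a) (w : τ.X.T x) :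
    R.liftDeriv 𝒟 (σ + σ') a x v w = R.liftDeriv 𝒟 σ a x v w + R.liftDeriv 𝒟 σ' a x v w := by
  have h1 : R.liftSection (σ + σ') a = R.liftSection σ a + R.liftSection σ' a :=
    funext fun y => map_add (R.qEquiv a y).symm _ _
  have h2 : (fun b => R.liftSection (σ + σ') b x) =
      fun b => R.liftSection σ b x + R.liftSection σ' b x :=
    funext fun b => map_add (R.qEquiv b x).symm _ _
  rw [liftDeriv, h1, h2, ComplexBundle.fiberDeriv_add (R.fiberDifferentiableAt_liftSection hσ)
    (R.fiberDifferentiableAt_liftSection hσ'), 𝒟.nabla.isCovariantDerivativeOnUniv.add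
    (R.mdifferentiableAt_liftSection hσ) (R.mdifferentiableAt_liftSection hσ')]
  change _ + (𝒟.nabla (R.liftSection σ a) x w + 𝒟.nabla (R.liftSection σ' a) x w) = _
  rw [liftDeriv, liftDeriv]
  abel

theorem liftDeriv_smul {f : R.tower.X → ℝ} {σ : ∀ z, R.tower.E.fib z} {a : P.Q} {x : τ.X}
    (hσ : MDifferentiableAt R.tower.X.I R.tower.E.ITot
      (fun z => TotalSpace.mk' R.tower.E.F z (σ z)) (R.qX (a, x)))
    (hf : MDifferentiableAt R.tower.X.I 𝓘(ℝ, ℝ) f (R.qX (a, x))) (v : P.Q.T a) (w : τ.X.T x) :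
    R.liftDeriv 𝒟 (f • σ) a x v w = f (R.qX (a, x)) • R.liftDeriv 𝒟 σ a x v w +
      mvfderiv R.tower.X.I f (R.qX (a, x)) (P.push R.qX a x v w) • R.liftSection σ a x := by
  have hl : ContMDiff P.Q.I R.tower.X.I ∞ (fun b => R.qX (b, x)) :=
    R.assocX.smooth.comp (contMDiff_id.prodMk contMDiff_const)
  have hr : ContMDiff τ.X.I R.tower.X.I ∞ (fun y => R.qX (a, y)) :=
    R.assocX.smooth.comp (contMDiff_const.prodMk contMDiff_id)
  have hfl : MDifferentiableAt P.Q.I 𝓘(ℝ, ℝ) (fun b => f (R.qX (b, x))) a :=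
    MDifferentiableAt.comp (g := f) (f := fun b => R.qX (b, x)) a hf
      (hl.mdifferentiableAt (by simp))
  have hfr : MDifferentiableAt τ.X.I 𝓘(ℝ, ℝ) (fun y => f (R.qX (a, y))) x :=
    MDifferentiableAt.comp (g := f) (f := fun y => R.qX (a, y)) x hf
      (hr.mdifferentiableAt (by simp))
  have h1 : R.liftSection (f • σ) a = (fun y => f (R.qX (a, y))) • R.liftSection σ a :=
    funext fun y => ((R.qEquiv a y).symm.toLinearMap.restrictScalars ℝ).map_smul _ _
  have h2 : (fun b => R.liftSection (f • σ) b x) =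
      fun b => f (R.qX (b, x)) • R.liftSection σ b x :=
    funext fun b => ((R.qEquiv b x).symm.toLinearMap.restrictScalars ℝ).map_smul _ _
  -- The differential of `f` on a pushed vector splits into partial derivatives: one is the Leibniz
  -- term of `d_Q`, the other that of `∇^E`.
  have h3 : mvfderiv R.tower.X.I f (R.qX (a, x)) (P.push R.qX a x v w) =
      mvfderiv P.Q.I (fun b => f (R.qX (b, x))) a v +
        mvfderiv τ.X.I (fun y => f (R.qX (a, y))) x w := by
    rw [push_eq R.assocX.smooth, map_add]
    exact congrArg₂ (· + ·)
      (mvfderiv_comp_apply (f := fun b => R.qX (b, x)) hf (hl.mdifferentiableAt (by simp)) v).symm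
      (mvfderiv_comp_apply (f := fun y => R.qX (a, y)) hf (hr.mdifferentiableAt (by simp)) w).symm
  rw [liftDeriv, h1, h2, ComplexBundle.fiberDeriv_smul hfl
    (R.fiberDifferentiableAt_liftSection hσ), 𝒟.nabla.isCovariantDerivativeOnUniv.leibniz
    (R.mdifferentiableAt_liftSection hσ) hfr, h3, liftDeriv]
  change _ + (f (R.qX (a, x)) • 𝒟.nabla (R.liftSection σ a) x w +
    mvfderiv τ.X.I (fun y => f (R.qX (a, y))) x w • R.liftSection σ a x) = _
  rw [smul_add, add_smul]
  abel

end PrincipalBundle.AssociatedTower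

end

/-! ### Existence of the induced data -/

noncomputable section

variable {EG : Type*} [NormedAddCommGroup EG] [NormedSpace ℝ EG]
  {G : Type*} [TopologicalSpace G] [ChartedSpace EG G] [Group G] [LieGroup 𝓘(ℝ, EG) ∞ G]
  {P : PrincipalBundle.{u} (EG := EG) G} {V : ∀ q : P.Q, Submodule ℝ (P.Q.T q)}

/-- Both `V` at `b` and `V` at `b · g` are isomorphic to the same tangent space of `M`, and
translation by `g` covers the identity there. Invariance, assumed as an inclusion, is thus an
equality. -/
theorem PrincipalBundle.IsConnection.exists_mfderiv_act_eq (hV : P.IsConnection V) (g : G) (b : P.Q)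
    {v : P.Q.T (P.act b g)} (hv : v ∈ V (P.act b g)) :
    ∃ v₀ ∈ V b, (mfderiv P.Q.I P.Q.I (fun a => P.act a g) b v₀ : P.Q.model) = v := by
  have hr : ∀ w : P.Q.T b, (mfderiv P.Q.I P.M.I P.r (P.act b g)
      (mfderiv P.Q.I P.Q.I (fun a => P.act a g) b w) : P.M.model) =
      mfderiv P.Q.I P.M.I P.r b w := by
    intro w
    have h1 := mfderiv_comp_apply b (P.r_smooth.mdifferentiableAt (x := P.act b g) (by simp))
      ((PrincipalBundle.act_smooth_left g).mdifferentiableAt (by simp)) w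
    have h2 : P.r ∘ (fun a => P.act a g) = P.r := funext fun a => P.r_act a g
    exact h1.symm.trans (congrArg (fun f : P.Q → P.M => (mfderiv P.Q.I P.M.I f b w : P.M.model)) h2)
  obtain ⟨⟨v₀, hv₀⟩, h⟩ := (hV.distribution.horizontal b).2
    (mfderiv P.Q.I P.M.I P.r (P.act b g) v : P.M.model)
  refine ⟨v₀, hv₀, ?_⟩
  exact congrArg Subtype.val ((hV.distribution.horizontal (P.act b g)).1
    (a₁ := ⟨_, hV.invariant g b v₀ hv₀⟩) (a₂ := ⟨v, hv⟩) ((hr v₀).trans h))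

namespace PrincipalBundle.AssociatedTower

variable {τ : Tower.{u}} [MulAction G τ.X] [MulAction G τ.S] {α : TowerAction (EG := EG) G τ}
  (R : P.AssociatedTower α) [ContMDiffSMul 𝓘(ℝ, EG) τ.X.I ∞ G τ.X]

theorem push_zero_act (a : P.Q) (g : G) (x : τ.X) (w : τ.X.T x) :
    (P.push R.qX (P.act a g) x 0 w : R.tower.X.model) = P.push R.qX a (g • x) 0 (pushG g x w) := by
  have h := R.assocX.push_act a g x 0 w
  rwa [map_zero] at h

variable {𝒟 : GeometricData τ}

/-- The `∇^E` part is the invariance of the connection. For the part along `Q`, `ρ g x` is a fixed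
linear map and the chain rule applies to `b ↦ b · g`. This is what makes the induced connection
independent of the representative. -/
theorem ρ_liftDeriv (hα : α.Preserves 𝒟) {σ : ∀ z, R.tower.E.fib z}
    (hσ : R.tower.E.SmoothOn σ univ) (a : P.Q) (g : G) (x : τ.X) (v : P.Q.T a) (w : τ.X.T x) :
    α.ρ g x (R.liftDeriv 𝒟 σ (P.act a g) x (mfderiv P.Q.I P.Q.I (fun b => P.act b g) a v) w) =
      R.liftDeriv 𝒟 σ a (g • x) v (pushG g x w) := by
  have hd : ∀ z, MDifferentiableAt R.tower.X.I R.tower.E.ITot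
      (fun z => TotalSpace.mk' R.tower.E.F z (σ z)) z := fun z =>
    (contMDiffOn_univ.1 hσ z).mdifferentiableAt (by simp)
  have h1 := hα.nabla g (R.liftSection σ (P.act a g)) (R.liftSection σ a)
    (R.liftSection_smooth hσ _) (R.liftSection_smooth hσ _)
    (fun y => (R.ρ_liftSection σ a g y).symm) x w
  have h2 : (fun b => R.liftSection σ b (g • x)) =
      fun b => ((α.ρ g x).restrictScalars ℝ) (R.liftSection σ (P.act b g) x) :=
    funext fun b => (R.ρ_liftSection σ b g x).symm
  have h3 := R.fiberDifferentiableAt_liftSection (a := P.act a g) (x := x) (hd _)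
  have hg := (act_smooth_left (P := P) g).mdifferentiableAt (x := a) (by simp)
  have h4 : τ.E.FiberDifferentiableAt P.Q x (fun b => R.liftSection σ (P.act b g) x) a :=
    MDifferentiableAt.comp (f := fun b => P.act b g) a h3 hg
  have h5 := (ComplexBundle.FiberDifferentiableAt.map (E' := τ.E)
    ((α.ρ g x).restrictScalars ℝ) h4).2 v
  rw [liftDeriv, map_add, liftDeriv, h1, h2, h5]
  refine congrArg (fun e => α.ρ g x e + _) ?_
  exact (ComplexBundle.fiberDeriv_comp (f := fun b => R.liftSection σ b x) h3 hg v).symm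

/-- As in the companion lemmas for the other data, the object at `z` is built from one
representative and then shown to have the right form for all of them. Equations are stated in the
model space or the total space, with `R.qX (a, x) = z` as a hypothesis, to avoid transport between
fibres over equal points. -/
theorem exists_induced_H (hα : α.Preserves 𝒟) (hV : P.IsConnection V) (z : R.tower.X) :
    ∃ H : Submodule ℝ (R.tower.X.T z), ∀ a x, R.qX (a, x) = z → ∀ w : R.tower.X.T z, w ∈ H ↔
      ∃ v ∈ V a, ∃ h ∈ 𝒟.H x, (P.push R.qX a x v h : R.tower.X.model) = w := by
  have key : ∀ a x a' x', R.qX (a, x) = R.qX (a', x') → ∀ w : R.tower.X.model,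
      (∃ v ∈ V a, ∃ h ∈ 𝒟.H x, (P.push R.qX a x v h : R.tower.X.model) = w) →
        ∃ v ∈ V a', ∃ h ∈ 𝒟.H x', (P.push R.qX a' x' v h : R.tower.X.model) = w := by
    rintro a x a' x' h w ⟨v, hv, y, hy, rfl⟩
    obtain ⟨g, rfl, rfl⟩ := (R.assocX.fibers _ _ _ _).1 h
    obtain ⟨v₀, hv₀, rfl⟩ := hV.exists_mfderiv_act_eq g a' hv
    exact ⟨v₀, hv₀, pushG g x y, hα.H g x y hy, (R.assocX.push_act a' g x v₀ y).symm⟩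
  obtain ⟨⟨a₀, x₀⟩, rfl⟩ := R.assocX.surjective z
  refine ⟨{ carrier := {w | ∃ v ∈ V a₀, ∃ h ∈ 𝒟.H x₀, P.push R.qX a₀ x₀ v h = w}
            add_mem' := ?_, zero_mem' := ?_, smul_mem' := ?_ }, fun a x h w => ?_⟩
  · rintro _ _ ⟨v, hv, y, hy, rfl⟩ ⟨v', hv', y', hy', rfl⟩
    exact ⟨_, add_mem hv hv', _, add_mem hy hy', push_add _ _ _ _ _ _⟩
  · exact ⟨0, zero_mem _, 0, zero_mem _, push_zero _ _⟩
  · rintro c _ ⟨v, hv, y, hy, rfl⟩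
    exact ⟨_, Submodule.smul_mem _ c hv, _, Submodule.smul_mem _ c hy, push_smul _ _ _ _ _⟩
  · exact ⟨key _ _ _ _ h.symm w, key _ _ _ _ h w⟩

theorem exists_induced_ε (hα : α.Preserves 𝒟) (z : R.tower.X) :
    ∃ ε : R.tower.E.fib z →ₗ[ℂ] R.tower.E.fib z, ∀ a x, R.qX (a, x) = z →
      ∀ (e : τ.E.fib x) (f : R.tower.E.fib z),
        TotalSpace.mk' R.tower.E.F z f = TotalSpace.mk' R.tower.E.F (R.qX (a, x)) (R.qE a x e) →
          TotalSpace.mk' R.tower.E.F z (ε f) =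
            TotalSpace.mk' R.tower.E.F (R.qX (a, x)) (R.qE a x (𝒟.ε x e)) := by
  obtain ⟨⟨a₀, x₀⟩, rfl⟩ := R.assocX.surjective z
  refine ⟨R.qE a₀ x₀ ∘ₗ 𝒟.ε x₀ ∘ₗ (R.qEquiv a₀ x₀).symm.toLinearMap, fun a x h e f hf => ?_⟩
  obtain ⟨g, rfl, rfl⟩ := (R.assocX.fibers _ _ _ _).1 h
  rw [R.qE_invariant] at hf ⊢
  obtain rfl := TotalSpace.mk_inj.1 hf
  refine congrArg (TotalSpace.mk' R.tower.E.F (R.qX (a₀, g • x))) ?_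
  change R.qE a₀ (g • x) (𝒟.ε (g • x) ((R.qEquiv a₀ (g • x)).symm _)) = _
  rw [R.qEquiv_symm_qE, hα.grading]

instance finiteDimensional_tangentSpace (X : SmoothMfd.{u}) (x : X) : FiniteDimensional ℝ (X.T x) :=
  inferInstanceAs (FiniteDimensional ℝ X.model)

instance t2Space_tangentSpace (X : SmoothMfd.{u}) (x : X) : T2Space (X.T x) :=
  inferInstanceAs (T2Space X.model)

/-- The splitting `T_a Q ⊃ V_a`, `V_a × T_x X ≃ T_{[a, x]} X_Q`. -/
def pushEquiv (hV : P.IsConnection V) (a : P.Q) (x : τ.X) :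
    (V a × τ.X.T x) ≃ₗ[ℝ] R.tower.X.T (R.qX (a, x)) :=
  LinearEquiv.ofBijective
    { toFun := fun p => P.push R.qX a x p.1 p.2
      map_add' := fun p q => push_add _ _ _ _ _ _
      map_smul' := fun r p => push_smul _ _ _ _ _ } (by
    constructor
    · rintro ⟨v, w⟩ ⟨v', w'⟩ h
      obtain ⟨h1, h2⟩ := R.assocX.eq_of_push_eq hV v.2 v'.2 h
      exact Prod.ext (Subtype.ext h1) h2
    · intro ζ
      obtain ⟨v, hv, w, h⟩ := R.assocX.exists_push hV a x ζ
      exact ⟨(⟨v, hv⟩, w), h⟩)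

theorem pushEquiv_symm_push (hV : P.IsConnection V) {a : P.Q} {x : τ.X} {v : P.Q.T a} (hv : v ∈ V a)
    (w : τ.X.T x) : (R.pushEquiv hV a x).symm (P.push R.qX a x v w) = (⟨v, hv⟩, w) :=
  (R.pushEquiv hV a x).symm_apply_eq.2 rfl

/-- The operator is defined on all sections, with default values of derivatives where `σ` is not
differentiable. Additivity and the Leibniz rule are claimed for differentiable sections, and the
formula at every representative only for smooth ones, since the invariance of `∇^E` is given for
these. -/
theorem exists_induced_nabla (hα : α.Preserves 𝒟) (hV : P.IsConnection V) (z : R.tower.X) :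
    ∃ D : (∀ z, R.tower.E.fib z) → R.tower.X.T z →L[ℝ] R.tower.E.fib z,
      (∀ σ σ' : ∀ z, R.tower.E.fib z,
        MDifferentiableAt R.tower.X.I R.tower.E.ITot (fun z => TotalSpace.mk' R.tower.E.F z (σ z)) z →
        MDifferentiableAt R.tower.X.I R.tower.E.ITot
          (fun z => TotalSpace.mk' R.tower.E.F z (σ' z)) z → D (σ + σ') = D σ + D σ') ∧
      (∀ (σ : ∀ z, R.tower.E.fib z) (f : R.tower.X → ℝ),
        MDifferentiableAt R.tower.X.I R.tower.E.ITot (fun z => TotalSpace.mk' R.tower.E.F z (σ z)) z →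
        MDifferentiableAt R.tower.X.I 𝓘(ℝ, ℝ) f z →
          D (f • σ) = f z • D σ + (mvfderiv R.tower.X.I f z).smulRight (σ z)) ∧
      ∀ a x, R.qX (a, x) = z → ∀ σ : ∀ z, R.tower.E.fib z, R.tower.E.SmoothOn σ univ →
        ∀ v ∈ V a, ∀ w : τ.X.T x, ∀ ζ : R.tower.X.model,
          ζ = (P.push R.qX a x v w : R.tower.X.model) →
          TotalSpace.mk' R.tower.E.F z (D σ ζ) =
            TotalSpace.mk' R.tower.E.F (R.qX (a, x)) (R.qE a x (R.liftDeriv 𝒟 σ a x v w)) := by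
  obtain ⟨⟨a₀, x₀⟩, rfl⟩ := R.assocX.surjective z
  let T := R.pushEquiv hV a₀ x₀
  let L : (∀ z, R.tower.E.fib z) → V a₀ × τ.X.T x₀ →ₗ[ℝ] R.tower.E.fib (R.qX (a₀, x₀)) := fun σ =>
    ((R.qE a₀ x₀).restrictScalars ℝ) ∘ₗ
      ((τ.E.fiberDerivₗ x₀ (fun b => R.liftSection σ b x₀) a₀).comp ((V a₀).subtype)).coprod
        (𝒟.nabla (R.liftSection σ a₀) x₀).toLinearMap
  let D : (∀ z, R.tower.E.fib z) → R.tower.X.T (R.qX (a₀, x₀)) →L[ℝ] R.tower.E.fib (R.qX (a₀, x₀)) :=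
    fun σ => LinearMap.toContinuousLinearMap (L σ ∘ₗ T.symm.toLinearMap)
  have hD : ∀ σ, ∀ v ∈ V a₀, ∀ w, D σ (P.push R.qX a₀ x₀ v w) =
      R.qE a₀ x₀ (R.liftDeriv 𝒟 σ a₀ x₀ v w) := by
    intro σ v hv w
    change L σ (T.symm _) = _
    rw [R.pushEquiv_symm_push hV hv]
    exact congrArg (fun e => R.qE a₀ x₀ (e + _)) (τ.E.fiberDerivₗ_apply _ _ _ _)
  refine ⟨D, fun σ σ' hσ hσ' => ?_, fun σ f hσ hf => ?_, fun a x h σ hσ v hv w ζ hζ => ?_⟩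
  · ext ζ
    obtain ⟨v, hv, w, rfl⟩ := R.assocX.exists_push hV a₀ x₀ ζ
    rw [add_apply, hD (σ + σ') v hv, hD σ v hv, hD σ' v hv,
      R.liftDeriv_add 𝒟 hσ hσ', map_add]
  · ext ζ
    obtain ⟨v, hv, w, rfl⟩ := R.assocX.exists_push hV a₀ x₀ ζ
    rw [add_apply, smul_apply, hD (f • σ) v hv, hD σ v hv,
      R.liftDeriv_smul 𝒟 hσ hf, ContinuousLinearMap.smulRight_apply, ← R.qE_liftSection σ]
    change ((R.qE a₀ x₀).restrictScalars ℝ) _ = _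
    rw [map_add, map_smul, map_smul]
    rfl
  · obtain ⟨g, rfl, rfl⟩ := (R.assocX.fibers _ _ _ _).1 h
    obtain ⟨v₀, hv₀, rfl⟩ := hV.exists_mfderiv_act_eq g a₀ hv
    rw [R.qE_invariant]
    refine congrArg (TotalSpace.mk' R.tower.E.F (R.qX (a₀, g • x))) ?_
    have h1 := hD σ v₀ hv₀ (pushG g x w)
    rw [← R.ρ_liftDeriv hα hσ] at h1
    exact (congrArg (D σ) (hζ.trans (R.assocX.push_act a₀ g x v₀ w))).trans h1

end PrincipalBundle.AssociatedTower

end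

noncomputable section

namespace PrincipalBundle.AssociatedTower

variable {EG : Type*} [NormedAddCommGroup EG] [NormedSpace ℝ EG]
  {G : Type*} [TopologicalSpace G] [ChartedSpace EG G] [Group G] [LieGroup 𝓘(ℝ, EG) ∞ G]
  {P : PrincipalBundle.{u} (EG := EG) G} {V : ∀ q : P.Q, Submodule ℝ (P.Q.T q)}
  {τ : Tower.{u}} [MulAction G τ.X] [MulAction G τ.S] {α : TowerAction (EG := EG) G τ}
  (R : P.AssociatedTower α) [ContMDiffSMul 𝓘(ℝ, EG) τ.X.I ∞ G τ.X]
  [ContMDiffSMul 𝓘(ℝ, EG) τ.S.I ∞ G τ.S]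
  {𝒟 : GeometricData τ} (hpr : ContMDiff τ.X.I τ.S.I ∞ τ.pr)
include hpr

theorem vertEquiv_symm_act (hV : P.IsConnection V) (a : P.Q) (g : G) (x : τ.X) (v : vert τ.pr x)
    {v' : vert R.tower.pr (R.qX (a, g • x))}
    (h : ((v' : R.tower.X.T (R.qX (a, g • x))) : R.tower.X.model) =
      (P.push R.qX (P.act a g) x 0 (v : τ.X.T x) : R.tower.X.model)) :
    (R.vertEquiv hpr hV a (g • x)).symm v' = ⟨pushG g x v, pushG_mem_vert α hpr g v.2⟩ := by
  rw [LinearEquiv.symm_apply_eq]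
  exact Subtype.ext (h.trans (R.push_zero_act a g x v))

theorem exists_induced_g (hα : α.Preserves 𝒟) (hV : P.IsConnection V) (z : R.tower.X) :
    ∃ gz : LinearMap.BilinForm ℝ (vert R.tower.pr z), ∀ a x, R.qX (a, x) = z →
      ∀ (v w : vert τ.pr x) (v' w' : vert R.tower.pr z),
        ((v' : R.tower.X.T z) : R.tower.X.model) = (P.push R.qX a x 0 v : R.tower.X.model) →
        ((w' : R.tower.X.T z) : R.tower.X.model) = (P.push R.qX a x 0 w : R.tower.X.model) →
          gz v' w' = 𝒟.g x v w := by
  obtain ⟨⟨a₀, x₀⟩, rfl⟩ := R.assocX.surjective z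
  let e := (R.vertEquiv hpr hV a₀ x₀).symm.toLinearMap
  refine ⟨(𝒟.g x₀).comp e e, fun a x h v w v' w' hv hw => ?_⟩
  obtain ⟨g, rfl, rfl⟩ := (R.assocX.fibers _ _ _ _).1 h
  refine (congrArg₂ (fun v w => 𝒟.g (g • x) v w) (R.vertEquiv_symm_act hpr hV a₀ g x v hv)
    (R.vertEquiv_symm_act hpr hV a₀ g x w hw)).trans ?_
  exact hα.metric g x v w _ _ rfl rfl

/-- By `hgz` the inverse of `T_x(X/S) ≅ T_{[a, x]}(X_Q/S_Q)` is isometric, so it induces a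
homomorphism of Clifford algebras; the action on `E_x` is then conjugated by `qE`. -/
theorem exists_induced_c (hα : α.Preserves 𝒟) (hV : P.IsConnection V) (z : R.tower.X)
    {gz : LinearMap.BilinForm ℝ (vert R.tower.pr z)}
    (hgz : ∀ a x, R.qX (a, x) = z → ∀ (v w : vert τ.pr x) (v' w' : vert R.tower.pr z),
      ((v' : R.tower.X.T z) : R.tower.X.model) = (P.push R.qX a x 0 v : R.tower.X.model) →
      ((w' : R.tower.X.T z) : R.tower.X.model) = (P.push R.qX a x 0 w : R.tower.X.model) →
        gz v' w' = 𝒟.g x v w) :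
    ∃ c : CliffordAlgebra (cliffordForm gz) →ₐ[ℝ] Module.End ℂ (R.tower.E.fib z),
      ∀ a x, R.qX (a, x) = z → ∀ (v : vert τ.pr x) (v' : vert R.tower.pr z) (e : τ.E.fib x)
        (f : R.tower.E.fib z),
        ((v' : R.tower.X.T z) : R.tower.X.model) = (P.push R.qX a x 0 v : R.tower.X.model) →
        TotalSpace.mk' R.tower.E.F z f = TotalSpace.mk' R.tower.E.F (R.qX (a, x)) (R.qE a x e) →
          TotalSpace.mk' R.tower.E.F z (c (CliffordAlgebra.ι (cliffordForm gz) v') f) =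
            TotalSpace.mk' R.tower.E.F (R.qX (a, x)) (R.qE a x (𝒟.cmul x v e)) := by
  obtain ⟨⟨a₀, x₀⟩, rfl⟩ := R.assocX.surjective z
  let i : cliffordForm gz →qᵢ cliffordForm (𝒟.g x₀) :=
    { (R.vertEquiv hpr hV a₀ x₀).symm.toLinearMap with
      map_app' := fun v' => by
        have h1 := congrArg Subtype.val ((R.vertEquiv hpr hV a₀ x₀).apply_symm_apply v')
        exact congrArg Neg.neg (hgz a₀ x₀ rfl _ _ v' v' h1.symm h1.symm).symm }
  refine ⟨((R.qEquiv a₀ x₀).conjAlgEquiv ℝ).toAlgHom.comp ((𝒟.c x₀).comp (CliffordAlgebra.map i)),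
    fun a x h v v' e f hv hf => ?_⟩
  obtain ⟨g, rfl, rfl⟩ := (R.assocX.fibers _ _ _ _).1 h
  rw [R.qE_invariant] at hf ⊢
  obtain rfl := TotalSpace.mk_inj.1 hf
  refine congrArg (TotalSpace.mk' R.tower.E.F (R.qX (a₀, g • x))) ?_
  change R.qE a₀ (g • x) (𝒟.c (g • x) (CliffordAlgebra.map i (CliffordAlgebra.ι _ v'))
    ((R.qEquiv a₀ (g • x)).symm _)) = _
  rw [R.qEquiv_symm_qE, CliffordAlgebra.map_apply_ι]
  refine congrArg (R.qE a₀ (g • x)) ?_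
  refine (congrArg (fun w => 𝒟.cmul (g • x) w (α.ρ g x e))
    (R.vertEquiv_symm_act hpr hV a₀ g x v hv)).trans ?_
  exact hα.clifford g x v _ e rfl

theorem exists_isInduced (hα : α.Preserves 𝒟) (hV : P.IsConnection V) :
    ∃ 𝒟Q : GeometricData R.tower, R.IsInduced V 𝒟 𝒟Q := by
  choose H hH using R.exists_induced_H hα hV
  choose g hg using R.exists_induced_g hpr hα hV
  choose ε hε using R.exists_induced_ε hα
  choose c hc using fun z => R.exists_induced_c hpr hα hV z (hg z)
  choose D hD1 hD2 hD3 using R.exists_induced_nabla hα hV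
  refine ⟨{ H := H, g := g, ε := ε, c := c, nabla := ⟨fun σ z => D z σ, ?_, ?_⟩ }, ?_, ?_, ?_, ?_, ?_⟩
  · exact fun hσ hσ' _ => hD1 _ _ _ hσ hσ'
  · exact fun hσ hf _ => hD2 _ _ _ hσ hf
  · exact fun a x w => hH _ a x rfl w
  · exact fun a x v w v' w' => hg _ a x rfl v w v' w'
  · exact fun a x e => TotalSpace.mk_inj.1 (hε _ a x rfl e _ rfl)
  · exact fun a x v v' e hv => TotalSpace.mk_inj.1 (hc _ a x rfl v v' e _ hv rfl)
  · intro σ σ' hσ hσ' a x v hv w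
    -- Lifts are unique, because `qE` is injective.
    have h1 : σ' = R.liftSection σ := funext fun b => funext fun y => R.eq_liftSection (hσ' b y)
    subst h1
    exact TotalSpace.mk_inj.1 (hD3 _ a x rfl σ hσ v hv w _ rfl)

end PrincipalBundle.AssociatedTower

end

/-! ### Local triviality of `X_Q → S_Q` -/

noncomputable section

namespace PrincipalBundle.AssociatedTower

variable {EG : Type*} [NormedAddCommGroup EG] [NormedSpace ℝ EG]
  {G : Type*} [TopologicalSpace G] [ChartedSpace EG G] [Group G] [LieGroup 𝓘(ℝ, EG) ∞ G]
  {P : PrincipalBundle.{u} (EG := EG) G}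
  {τ : Tower.{u}} [MulAction G τ.X] [MulAction G τ.S] {α : TowerAction (EG := EG) G τ}
  (R : P.AssociatedTower α) [ContMDiffSMul 𝓘(ℝ, EG) τ.X.I ∞ G τ.X]
  [ContMDiffSMul 𝓘(ℝ, EG) τ.S.I ∞ G τ.S]

theorem base_pr (z : R.tower.X) : R.assocS.base (R.tower.pr z) = R.assocX.base z := by
  obtain ⟨⟨a, x⟩, rfl⟩ := R.assocX.surjective z
  rw [R.pr_q, R.assocS.base_apply, R.assocX.base_apply]

theorem pr_fiberCoord (φ : P.Gauge) {z : R.tower.X} (hz : R.assocX.base z ∈ φ.U) :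
    τ.pr (R.assocX.fiberCoord φ z) = R.assocS.fiberCoord φ (R.tower.pr z) := by
  obtain ⟨⟨a, x⟩, rfl⟩ := R.assocX.surjective z
  rw [R.assocX.base_apply] at hz
  rw [R.pr_q, R.assocS.fiberCoord_apply φ hz, R.assocX.fiberCoord_apply φ hz, α.pr_smul]

/-- The set over which a gauge and a trivialization of `X → S` trivialize `X_Q → S_Q`. -/
def trivSet (φ : P.Gauge) (B : Set τ.S) : Set R.tower.S :=
  {s | R.assocS.base s ∈ φ.U ∧ R.assocS.fiberCoord φ s ∈ B}

theorem isOpen_trivSet (φ : P.Gauge) {B : Set τ.S} (hB : IsOpen B) : IsOpen (R.trivSet φ B) := by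
  have h1 : ContinuousOn (R.assocS.fiberCoord φ) (R.assocS.base ⁻¹' φ.U) := fun z hz =>
    (R.assocS.fiberCoord_smooth _ hz).continuousAt.continuousWithinAt
  exact h1.isOpen_inter_preimage (φ.isOpen.preimage R.assocS.base_smooth.continuous) hB

variable {Z : SmoothMfd.{u}} (φ : P.Gauge) (t : Trivialization Z τ.pr)

/-- The trivialization of `X_Q → S_Q` given by a gauge and a trivialization of `X → S`. -/
def trivFun (ζ : R.tower.X) : R.tower.S × Z := (R.tower.pr ζ, (t (R.assocX.fiberCoord φ ζ)).2)

/-- The inverse of `trivFun`. -/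
def trivInv (p : R.tower.S × Z) : R.tower.X :=
  R.qX (φ.s (R.assocS.base p.1),
    t.toOpenPartialHomeomorph.symm (R.assocS.fiberCoord φ p.1, p.2))

theorem mem_trivSet_pr {ζ : R.tower.X} (h : R.tower.pr ζ ∈ R.trivSet φ t.baseSet) :
    R.assocX.base ζ ∈ φ.U ∧ R.assocX.fiberCoord φ ζ ∈ t.source := by
  have h1 : R.assocX.base ζ ∈ φ.U := R.base_pr ζ ▸ h.1
  exact ⟨h1, t.mem_source.2 (R.pr_fiberCoord φ h1 ▸ h.2)⟩

theorem pr_trivInv {p : R.tower.S × Z} (h : p.1 ∈ R.trivSet φ t.baseSet) :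
    R.tower.pr (R.trivInv φ t p) = p.1 := by
  rw [trivInv, R.pr_q, t.proj_symm_apply' h.2, R.assocS.map_section_fiberCoord φ h.1]

theorem trivInv_trivFun {ζ : R.tower.X} (h : R.tower.pr ζ ∈ R.trivSet φ t.baseSet) :
    R.trivInv φ t (R.trivFun φ t ζ) = ζ := by
  obtain ⟨h1, h2⟩ := R.mem_trivSet_pr φ t h
  have h3 := t.symm_apply_mk_proj h2
  rw [R.pr_fiberCoord φ h1] at h3
  rw [trivInv, trivFun, h3, R.base_pr, R.assocX.map_section_fiberCoord φ h1]

theorem trivFun_trivInv {p : R.tower.S × Z} (h : p.1 ∈ R.trivSet φ t.baseSet) :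
    R.trivFun φ t (R.trivInv φ t p) = p := by
  refine Prod.ext (R.pr_trivInv φ t h) ?_
  rw [trivFun, trivInv, R.assocX.fiberCoord_section φ h.1, t.apply_symm_apply' h.2]

theorem trivFun_smooth (hpr : ContMDiff τ.X.I τ.S.I ∞ τ.pr)
    (ht : ContMDiffOn τ.X.I (τ.S.I.prod Z.I) ∞ t t.source) :
    ContMDiffOn R.tower.X.I (R.tower.S.I.prod Z.I) ∞ (R.trivFun φ t)
      (R.tower.pr ⁻¹' R.trivSet φ t.baseSet) := by
  intro ζ h
  obtain ⟨h1, h2⟩ := R.mem_trivSet_pr φ t h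
  have h3 := ht.contMDiffAt (t.open_source.mem_nhds h2)
  exact ((R.pr_smooth hpr).contMDiffAt.prodMk (contMDiffAt_snd.comp ζ
    (ContMDiffAt.comp ζ h3 (R.assocX.fiberCoord_smooth φ h1)))).contMDiffWithinAt

theorem trivInv_smooth (ht : ContMDiffOn (τ.S.I.prod Z.I) τ.X.I ∞
      t.toOpenPartialHomeomorph.symm t.target) :
    ContMDiffOn (R.tower.S.I.prod Z.I) R.tower.X.I ∞ (R.trivInv φ t)
      (R.trivSet φ t.baseSet ×ˢ univ) := by
  rintro p ⟨h, -⟩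
  have h1 : ContMDiffAt (τ.S.I.prod Z.I) τ.X.I ∞ t.toOpenPartialHomeomorph.symm
      (R.assocS.fiberCoord φ p.1, p.2) :=
    ht.contMDiffAt (t.open_target.mem_nhds (t.mem_target.2 h.2))
  have h2 : ContMDiffAt (R.tower.S.I.prod Z.I) (τ.S.I.prod Z.I) ∞
      (fun p : R.tower.S × Z => (R.assocS.fiberCoord φ p.1, p.2)) p :=
    (ContMDiffAt.comp p (R.assocS.fiberCoord_smooth φ h.1) contMDiffAt_fst).prodMk contMDiffAt_snd
  have h3 : ContMDiffAt (R.tower.S.I.prod Z.I) P.Q.I ∞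
      (fun p : R.tower.S × Z => φ.s (R.assocS.base p.1)) p :=
    ContMDiffAt.comp p (φ.contMDiffAt_s h.1) (R.assocS.base_smooth.contMDiffAt.comp p
      contMDiffAt_fst)
  exact (R.assocX.smooth.contMDiffAt.comp p (h3.prodMk
    (ContMDiffAt.comp p h1 h2))).contMDiffWithinAt

/-- The local trivialization of `X_Q → S_Q` in a gauge. -/
def triv (hpr : ContMDiff τ.X.I τ.S.I ∞ τ.pr)
    (ht : ContMDiffOn τ.X.I (τ.S.I.prod Z.I) ∞ t t.source)
    (ht' : ContMDiffOn (τ.S.I.prod Z.I) τ.X.I ∞ t.toOpenPartialHomeomorph.symm t.target) :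
    Trivialization Z R.tower.pr where
  toFun := R.trivFun φ t
  invFun := R.trivInv φ t
  source := R.tower.pr ⁻¹' R.trivSet φ t.baseSet
  target := R.trivSet φ t.baseSet ×ˢ univ
  map_source' := fun _ h => ⟨h, mem_univ _⟩
  map_target' := fun p h => by
    change R.tower.pr (R.trivInv φ t p) ∈ R.trivSet φ t.baseSet
    rw [R.pr_trivInv φ t h.1]
    exact h.1
  left_inv' := fun _ h => R.trivInv_trivFun φ t h
  right_inv' := fun _ h => R.trivFun_trivInv φ t h.1
  continuousOn_toFun := (R.trivFun_smooth φ t hpr ht).continuousOn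
  continuousOn_invFun := (R.trivInv_smooth φ t ht').continuousOn
  open_source := (R.isOpen_trivSet φ t.open_baseSet).preimage (R.pr_smooth hpr).continuous
  open_target := (R.isOpen_trivSet φ t.open_baseSet).prod isOpen_univ
  baseSet := R.trivSet φ t.baseSet
  open_baseSet := R.isOpen_trivSet φ t.open_baseSet
  source_eq := rfl
  target_eq := rfl
  proj_toFun := fun _ _ => rfl

/-- A gauge turns `X_Q → S_Q` into `X → S` locally over `M`, and a trivialization of the latter is
transported with the same typical fibre; compactness and even dimension are inherited. -/
theorem isCompactEvenFiberBundle (h : IsCompactEvenFiberBundle τ.pr) :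
    IsCompactEvenFiberBundle R.tower.pr where
  smooth := R.pr_smooth h.smooth
  surjective s := by
    obtain ⟨⟨a, s⟩, rfl⟩ := R.assocS.surjective s
    obtain ⟨x, rfl⟩ := h.surjective s
    exact ⟨R.qX (a, x), R.pr_q a x⟩
  locallyTrivial s := by
    obtain ⟨φ, hφ⟩ := P.exists_gauge (R.assocS.base s)
    obtain ⟨Z, hZ, hZ', t, hs, ht, ht'⟩ := h.locallyTrivial (R.assocS.fiberCoord φ s)
    exact ⟨Z, hZ, hZ', R.triv φ t h.smooth ht ht', ⟨hφ, hs⟩, R.trivFun_smooth φ t h.smooth ht,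
      R.trivInv_smooth φ t ht'⟩

end PrincipalBundle.AssociatedTower

end

/-! ### Lifts of vector fields, and the induced geometric family -/

noncomputable section

namespace PrincipalBundle.AssociatedTower

variable {EG : Type*} [NormedAddCommGroup EG] [NormedSpace ℝ EG]
  {G : Type*} [TopologicalSpace G] [ChartedSpace EG G] [Group G] [LieGroup 𝓘(ℝ, EG) ∞ G]
  {P : PrincipalBundle.{u} (EG := EG) G} {V : ∀ q : P.Q, Submodule ℝ (P.Q.T q)}
  {τ : Tower.{u}} [MulAction G τ.X] [MulAction G τ.S] {α : TowerAction (EG := EG) G τ}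
  (R : P.AssociatedTower α) [ContMDiffSMul 𝓘(ℝ, EG) τ.X.I ∞ G τ.X]

section Lift

variable (hV : P.IsConnection V)

/-- The component along `V` of the lift of a vector field on `X_Q`. -/
def liftQ (u : ∀ z, R.tower.X.T z) (a : P.Q) (x : τ.X) : P.Q.T a :=
  (((R.pushEquiv hV a x).symm (u (R.qX (a, x)))).1 : P.Q.T a)

/-- The component along `X` of the lift of a vector field on `X_Q`. -/
def liftX (u : ∀ z, R.tower.X.T z) (a : P.Q) (x : τ.X) : τ.X.T x :=
  ((R.pushEquiv hV a x).symm (u (R.qX (a, x)))).2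

theorem liftQ_mem (u : ∀ z, R.tower.X.T z) (a : P.Q) (x : τ.X) : R.liftQ hV u a x ∈ V a :=
  ((R.pushEquiv hV a x).symm (u (R.qX (a, x)))).1.2

theorem push_lift (u : ∀ z, R.tower.X.T z) (a : P.Q) (x : τ.X) :
    P.push R.qX a x (R.liftQ hV u a x) (R.liftX hV u a x) = u (R.qX (a, x)) :=
  (R.pushEquiv hV a x).apply_symm_apply _

theorem lift_smooth {u : ∀ z, R.tower.X.T z} {p : P.Q × τ.X}
    (hu : SmoothFieldAt R.tower.X u (R.qX p)) :
    SmoothAlong (P.Q.I.prod τ.X.I) P.Q (fun p : P.Q × τ.X => p.1)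
      (fun p => R.liftQ hV u p.1 p.2) p ∧
    SmoothAlong (P.Q.I.prod τ.X.I) τ.X (fun p : P.Q × τ.X => p.2)
      (fun p => R.liftX hV u p.1 p.2) p := by
  refine R.assocX.lift_along hV contMDiffAt_fst contMDiffAt_snd
    (fun p => R.liftQ_mem hV u p.1 p.2) ?_
  simp only [push_lift]
  exact ContMDiffAt.comp p hu R.assocX.smooth.contMDiffAt

theorem eq_lift {u : ∀ z, R.tower.X.T z} {a : P.Q} {x : τ.X} {v : P.Q.T a} (hv : v ∈ V a)
    {w : τ.X.T x} (h : P.push R.qX a x v w = u (R.qX (a, x))) :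
    v = R.liftQ hV u a x ∧ w = R.liftX hV u a x :=
  R.assocX.eq_of_push_eq hV hv (R.liftQ_mem hV u a x) (h.trans (R.push_lift hV u a x).symm)

end Lift

variable [ContMDiffSMul 𝓘(ℝ, EG) τ.S.I ∞ G τ.S] (hpr : ContMDiff τ.X.I τ.S.I ∞ τ.pr)
  (hV : P.IsConnection V)

section VertLift

/-- The lift of a vertical field on `X_Q` to `Q × X`. -/
def liftVert (ν : VertField R.tower.pr) (a : P.Q) : VertField τ.pr := fun x =>
  (R.vertEquiv hpr hV a x).symm (ν (R.qX (a, x)))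

theorem push_liftVert (ν : VertField R.tower.pr) (a : P.Q) (x : τ.X) :
    P.push R.qX a x 0 (R.liftVert hpr hV ν a x : τ.X.T x) = ν (R.qX (a, x)) :=
  congrArg Subtype.val ((R.vertEquiv hpr hV a x).apply_symm_apply (ν (R.qX (a, x))))

theorem eq_liftVert {ν : VertField R.tower.pr} {ν' : P.Q → VertField τ.pr}
    (h : ∀ a x, P.push R.qX a x 0 (ν' a x : τ.X.T x) = ν (R.qX (a, x))) :
    ν' = R.liftVert hpr hV ν := by
  funext a x
  refine Subtype.ext (R.assocX.pushR_injective a x ?_)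
  exact (h a x).trans (R.push_liftVert hpr hV ν a x).symm

theorem liftVert_smooth {ν : VertField R.tower.pr} {p : P.Q × τ.X}
    (hν : SmoothFieldAt R.tower.X (fun z => (ν z : R.tower.X.T z)) (R.qX p)) :
    SmoothAlong (P.Q.I.prod τ.X.I) τ.X (fun p : P.Q × τ.X => p.2)
      (fun p => (R.liftVert hpr hV ν p.1 p.2 : τ.X.T p.2)) p := by
  refine (R.assocX.lift_along hV (b := fun p : P.Q × τ.X => p.1) (c := fun p => p.2)
    (v := fun p => 0) contMDiffAt_fst contMDiffAt_snd (fun p => (V p.1).zero_mem) ?_).2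
  simp only [push_liftVert]
  exact ContMDiffAt.comp p hν R.assocX.smooth.contMDiffAt

end VertLift

variable {R} {𝒟 : GeometricData τ} {𝒟Q : GeometricData R.tower}

/-- Under the splittings of the tangent spaces of `X_Q` and `S_Q`, the differential of the
projection restricted to `V_a ⊕ H_x` is the identity on `V_a` and `pr_*` on `H_x`. -/
theorem IsInduced.isHorizontal (hI : R.IsInduced V 𝒟 𝒟Q) (hH : IsHorizontal τ.pr 𝒟.H)
    (hpr : ContMDiff τ.X.I τ.S.I ∞ τ.pr) (hV : P.IsConnection V) :
    IsHorizontal R.tower.pr 𝒟Q.H := by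
  intro z
  obtain ⟨⟨a, x⟩, rfl⟩ := R.assocX.surjective z
  constructor
  · rintro ⟨ζ, hζ⟩ ⟨ζ', hζ'⟩ h
    obtain ⟨v, hv, w, hw, rfl⟩ := (hI.H a x ζ).1 hζ
    obtain ⟨v', hv', w', hw', rfl⟩ := (hI.H a x ζ').1 hζ'
    have h1 : P.push R.qS a (τ.pr x) v (mfderiv τ.X.I τ.S.I τ.pr x w) =
        P.push R.qS a (τ.pr x) v' (mfderiv τ.X.I τ.S.I τ.pr x w') :=
      (R.mfderiv_pr_push hpr a x v w).symm.trans (h.trans (R.mfderiv_pr_push hpr a x v' w'))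
    obtain ⟨rfl, h2⟩ := R.assocS.eq_of_push_eq hV hv hv' h1
    have h3 : w = w' := congrArg Subtype.val ((hH x).1 (a₁ := ⟨w, hw⟩) (a₂ := ⟨w', hw'⟩) h2)
    subst h3
    rfl
  · intro ζ
    obtain ⟨v, hv, w, h⟩ := R.assocS.exists_push hV a (τ.pr x) (ζ : R.tower.S.model)
    obtain ⟨⟨y, hy⟩, rfl⟩ := (hH x).2 w
    exact ⟨⟨_, (hI.H a x _).2 ⟨v, hv, y, hy, rfl⟩⟩, (R.mfderiv_pr_push hpr a x v y).trans h⟩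

/-- The decomposition `(v, w) = (0, P w) + (v, w - P w)` pushes forward to a vertical and a
horizontal summand. So the lift of `P Y` is `P` of the `X` component of the lift of `Y`, which also
yields the smoothness of `H_Q`. -/
theorem IsInduced.vertProj_push (hI : R.IsInduced V 𝒟 𝒟Q) (hH : IsHorizontal τ.pr 𝒟.H)
    (hpr : ContMDiff τ.X.I τ.S.I ∞ τ.pr) (hHQ : IsHorizontal R.tower.pr 𝒟Q.H) {a : P.Q} {x : τ.X}
    {v : P.Q.T a} (hv : v ∈ V a) (w : τ.X.T x) :
    (vertProj hHQ (R.qX (a, x)) (P.push R.qX a x v w) : R.tower.X.T (R.qX (a, x))) =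
      P.push R.qX a x 0 (vertProj hH x w) := by
  have h1 : P.push R.qX a x 0 (vertProj hH x w) ∈ vert R.tower.pr (R.qX (a, x)) :=
    R.push_mem_vert hpr (vertProj hH x w).2
  have h2 : P.push R.qX a x v (w - vertProj hH x w) ∈ 𝒟Q.H (R.qX (a, x)) := by
    refine (hI.H a x _).2 ⟨v, hv, _, ?_, rfl⟩
    rw [← vertProj_eq_zero_iff hH, map_sub, vertProj_coe, sub_self]
  have h3 : P.push R.qX a x v w = P.push R.qX a x 0 (vertProj hH x w) +
      P.push R.qX a x v (w - vertProj hH x w) := by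
    rw [← push_add, zero_add, add_sub_cancel]
  rw [h3, map_add, (vertProj_eq_zero_iff hHQ).2 h2, add_zero]
  exact congrArg Subtype.val (vertProj_coe hHQ _ ⟨_, h1⟩)

theorem IsInduced.isHorizontalDistribution (hI : R.IsInduced V 𝒟 𝒟Q)
    (hH : IsHorizontalDistribution τ.pr 𝒟.H) (hpr : ContMDiff τ.X.I τ.S.I ∞ τ.pr)
    (hV : P.IsConnection V) : IsHorizontalDistribution R.tower.pr 𝒟Q.H where
  horizontal := hI.isHorizontal hH.horizontal hpr hV
  smooth U Y hU hY z hz := by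
    obtain ⟨p, rfl⟩ := R.assocX.surjective z
    have h1 := (R.lift_smooth hV (hY.contMDiffAt (hU.mem_nhds hz))).2
    have h2 := push_along R.assocX.smooth (along_zero (E := fun x : P.Q => P.Q.T x)
      (contMDiffAt_fst (I := P.Q.I) (J := τ.X.I) (p := p))) (vertProj_along hH h1)
    refine (R.assocX.contMDiffAt_of_comp (p := p) ?_).contMDiffWithinAt
    refine h2.congr_of_eventuallyEq (Eventually.of_forall fun q => ?_)
    refine congrArg (TotalSpace.mk' R.tower.X.model (E := fun z : R.tower.X => R.tower.X.T z)
      (R.qX q)) ?_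
    have h3 := hI.vertProj_push hH.horizontal hpr (hI.isHorizontal hH.horizontal hpr hV)
      (R.liftQ_mem hV Y q.1 q.2) (R.liftX hV Y q.1 q.2)
    rwa [push_lift] at h3

include hV in
theorem IsInduced.isGeometricFamily (hI : R.IsInduced V 𝒟 𝒟Q) (h𝒟 : 𝒟.IsGeometricFamily) :
    𝒟Q.IsGeometricFamily := by
  have hpr := h𝒟.bundle.smooth
  have key : ∀ a x (v w : vert R.tower.pr (R.qX (a, x))), 𝒟Q.g (R.qX (a, x)) v w =
      𝒟.g x ((R.vertEquiv hpr hV a x).symm v) ((R.vertEquiv hpr hV a x).symm w) := fun a x v w =>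
    hI.metric a x _ _ v w
      (congrArg Subtype.val ((R.vertEquiv hpr hV a x).apply_symm_apply v)).symm
      (congrArg Subtype.val ((R.vertEquiv hpr hV a x).apply_symm_apply w)).symm
  refine ⟨R.isCompactEvenFiberBundle h𝒟.bundle,
    hI.isHorizontalDistribution h𝒟.distribution hpr hV, ?_, ?_, ?_⟩
  · intro z v w
    obtain ⟨⟨a, x⟩, rfl⟩ := R.assocX.surjective z
    rw [key, key, h𝒟.g_symm]
  · intro z v hv
    obtain ⟨⟨a, x⟩, rfl⟩ := R.assocX.surjective z
    rw [key]
    exact h𝒟.g_pos x _ fun h => hv ((LinearEquiv.map_eq_zero_iff _).1 h)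
  · intro U v w hU hv hw z hz
    obtain ⟨p, rfl⟩ := R.assocX.surjective z
    refine (R.assocX.contMDiffAt_of_comp (p := p) ?_).contMDiffWithinAt
    refine (h𝒟.metric_along (R.liftVert_smooth hpr hV (hv.contMDiffAt (hU.mem_nhds hz)))
      (R.liftVert_smooth hpr hV (hw.contMDiffAt (hU.mem_nhds hz)))).congr_of_eventuallyEq
      (Eventually.of_forall fun q => key q.1 q.2 _ _)

theorem IsInduced.ε_apply (hI : R.IsInduced V 𝒟 𝒟Q) (σ : ∀ z, R.tower.E.fib z) (a : P.Q) (x : τ.X) :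
    𝒟Q.ε (R.qX (a, x)) (σ (R.qX (a, x))) = R.qE a x (𝒟.ε x (R.liftSection σ a x)) := by
  rw [← hI.grading, qE_liftSection]

theorem IsInduced.cmul_apply (hI : R.IsInduced V 𝒟 𝒟Q) (ν : VertField R.tower.pr)
    (σ : ∀ z, R.tower.E.fib z) (a : P.Q) (x : τ.X) :
    𝒟Q.cmul (R.qX (a, x)) (ν (R.qX (a, x))) (σ (R.qX (a, x))) =
      R.qE a x (𝒟.cmul x (R.liftVert hpr hV ν a x) (R.liftSection σ a x)) := by
  rw [← hI.clifford a x _ (ν (R.qX (a, x))) _ (R.push_liftVert hpr hV ν a x).symm, qE_liftSection]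

include hV in
theorem IsInduced.isGradedCliffordModule (hI : R.IsInduced V 𝒟 𝒟Q)
    (h𝒟 : 𝒟.IsGeometricCliffordFamily) : 𝒟Q.IsGradedCliffordModule := by
  have hpr := h𝒟.family.bundle.smooth
  refine ⟨?_, ?_, ?_, ?_⟩
  · intro z e
    obtain ⟨⟨a, x⟩, rfl⟩ := R.assocX.surjective z
    obtain ⟨e, rfl⟩ := (R.qE_bijective a x).2 e
    rw [hI.grading, hI.grading, h𝒟.cliffordModule.ε_sq]
  · intro U σ hU hσ z hz
    obtain ⟨p, rfl⟩ := R.assocX.surjective z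
    refine (R.assocX.contMDiffAt_of_comp (p := p) ?_).contMDiffWithinAt
    refine (R.qE_along contMDiffAt_fst (h𝒟.ε_along (R.liftSection_along contMDiffAt_fst
      contMDiffAt_snd (hσ.contMDiffAt (hU.mem_nhds hz))))).congr_of_eventuallyEq
      (Eventually.of_forall fun q => ?_)
    exact congrArg (TotalSpace.mk' R.tower.E.F (R.qX q)) (hI.ε_apply σ q.1 q.2)
  · intro z v e
    obtain ⟨⟨a, x⟩, rfl⟩ := R.assocX.surjective z
    obtain ⟨e, rfl⟩ := (R.qE_bijective a x).2 e
    obtain ⟨v, rfl⟩ := (R.vertEquiv hpr hV a x).surjective v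
    rw [hI.clifford a x v _ _ rfl, hI.grading, hI.grading, hI.clifford a x v _ _ rfl,
      h𝒟.cliffordModule.odd, map_neg]
  · intro U v σ hU hv hσ z hz
    obtain ⟨p, rfl⟩ := R.assocX.surjective z
    refine (R.assocX.contMDiffAt_of_comp (p := p) ?_).contMDiffWithinAt
    refine (R.qE_along contMDiffAt_fst (h𝒟.cmul_along (R.liftVert_smooth hpr hV
      (hv.contMDiffAt (hU.mem_nhds hz))) (R.liftSection_along contMDiffAt_fst
      contMDiffAt_snd (hσ.contMDiffAt (hU.mem_nhds hz))))).congr_of_eventuallyEq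
      (Eventually.of_forall fun q => ?_)
    exact congrArg (TotalSpace.mk' R.tower.E.F (R.qX q)) (hI.cmul_apply hpr hV v σ q.1 q.2)

end PrincipalBundle.AssociatedTower

end

/-! ### Smoothness of the pulled back connection -/

noncomputable section

section MvfderivField

variable {EM HM M : Type*} [NormedAddCommGroup EM] [NormedSpace ℝ EM] [CompleteSpace EM]
  [TopologicalSpace HM]
  {I : ModelWithCorners ℝ EM HM} [I.Boundaryless] [TopologicalSpace M] [ChartedSpace HM M]
  [IsManifold I ∞ M]
  {F : Type*} [NormedAddCommGroup F] [NormedSpace ℝ F]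

/-- The derivative of a smooth function along a smooth vector field is smooth. -/
theorem contMDiffAt_mvfderiv_apply {ψ : M → F} {p : M} (hψ : ContMDiffAt I 𝓘(ℝ, F) ∞ ψ p)
    {W : ∀ y : M, TangentSpace I y}
    (hW : ContMDiffAt I (I.prod 𝓘(ℝ, EM)) ∞ (fun y => TotalSpace.mk' EM y (W y)) p) :
    ContMDiffAt I 𝓘(ℝ, F) ∞ (fun y => mvfderiv I ψ y (W y)) p := by
  refine ContMDiffAt.congr_of_eventuallyEq ?_ (mvfderiv_apply_eventuallyEq hψ W)
  have h1 : ContDiffAt ℝ ∞ (fderiv ℝ (ψ ∘ (extChartAt I p).symm)) (extChartAt I p p) :=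
    (contDiffAt_comp_extChartAt_symm hψ).fderiv_right (by simp)
  have h2 : ContMDiffAt I 𝓘(ℝ, EM →L[ℝ] F) ∞
      (fun y => fderiv ℝ (ψ ∘ (extChartAt I p).symm) (extChartAt I p y)) p :=
    ContMDiffAt.comp (g := fderiv ℝ (ψ ∘ (extChartAt I p).symm)) p h1.contMDiffAt
      contMDiffAt_extChartAt
  have h3 : ContMDiffAt I 𝓘(ℝ, EM) ∞
      (fun y => coordAt EM (TangentSpace I : M → Type _) p y (W y)) p := along_coord (b := id) hW
  exact h2.clm_apply h3

end MvfderivField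

section ProdField

variable {A X : SmoothMfd.{u}}

theorem contMDiffAt_prodField {v : ∀ p : A × X, A.T p.1} {w : ∀ p : A × X, X.T p.2} {p : A × X}
    (hv : SmoothAlong (A.I.prod X.I) A (fun p : A × X => p.1) v p)
    (hw : SmoothAlong (A.I.prod X.I) X (fun p : A × X => p.2) w p) :
    ContMDiffAt (A.I.prod X.I) ((A.I.prod X.I).prod 𝓘(ℝ, A.model × X.model)) ∞
      (fun p : A × X => TotalSpace.mk' (A.model × X.model)
        (E := fun p : A × X => TangentSpace (A.I.prod X.I) p) p
        (((v p, w p) : A.model × X.model))) p := by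
  have h2 := contMDiff_equivTangentBundleProd_symm (I := A.I) (M := A) (I' := X.I) (M' := X)
    (n := ∞)
  exact h2.contMDiffAt.comp p (ContMDiffAt.prodMk hv hw)

theorem mvfderiv_prod {W : Type*} [NormedAddCommGroup W] [NormedSpace ℝ W] {h : A × X → W}
    {p : A × X} (hh : MDifferentiableAt (A.I.prod X.I) 𝓘(ℝ, W) h p) (v : A.T p.1) (w : X.T p.2) :
    mvfderiv (A.I.prod X.I) h p ((v, w) : A.model × X.model) =
      mvfderiv A.I (fun b => h (b, p.2)) p.1 v + mvfderiv X.I (fun y => h (p.1, y)) p.2 w :=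
  mfderiv_prod_eq_add_apply hh

end ProdField

theorem ComplexBundle.fiberDeriv_clm {X A : SmoothMfd.{u}} {E : ComplexBundle X} {W : Type*}
    [NormedAddCommGroup W] [NormedSpace ℝ W] {x : X} (T : W →L[ℝ] E.fib x) {h : A → W} {a : A}
    (hh : MDifferentiableAt A.I 𝓘(ℝ, W) h a) (v : A.T a) :
    E.fiberDeriv A x (fun b => T (h b)) a v = T (mvfderiv A.I h a v) := by
  apply coordAt_self_injective x
  rw [coordAt_fiberDeriv]
  exact mvfderiv_clm_comp ((coordAt E.F E.fib x x).comp T) hh v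

section Nabla

variable {τ : Tower.{u}} {𝒟 : GeometricData τ}

/-- This serves expansions in a frame. Differentiability of the partial sums is part of the
conclusion because additivity demands it in the induction. -/
theorem GeometricData.nabla_sum (𝒟 : GeometricData τ) {ι : Type*} (s : Finset ι)
    {f : ι → τ.X → ℝ} {t : ι → ∀ x, τ.E.fib x} {x : τ.X}
    (hf : ∀ i, MDifferentiableAt τ.X.I 𝓘(ℝ, ℝ) (f i) x)
    (ht : ∀ i, MDifferentiableAt τ.X.I τ.E.ITot (fun y => TotalSpace.mk' τ.E.F y (t i y)) x)
    (w : τ.X.T x) :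
    MDifferentiableAt τ.X.I τ.E.ITot
      (fun y => TotalSpace.mk' τ.E.F y ((∑ i ∈ s, f i • t i) y)) x ∧
    𝒟.nabla (∑ i ∈ s, f i • t i) x w =
      ∑ i ∈ s, (f i x • 𝒟.nabla (t i) x w + mvfderiv τ.X.I (f i) x w • t i x) := by
  classical
  induction s using Finset.induction_on with
  | empty =>
    refine ⟨?_, ?_⟩
    · exact (along_zero (E := τ.E.fib) (b := id) (n₀ := x) contMDiffAt_id).mdifferentiableAt
        (by simp)
    · have := 𝒟.nabla.isCovariantDerivativeOnUniv.zero (x := x)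
      simp only [Finset.sum_empty]
      exact congrArg (fun L => L w) this
  | insert i s hi ih =>
    have h1 : MDifferentiableAt τ.X.I τ.E.ITot
        (fun y => TotalSpace.mk' τ.E.F y ((f i • t i) y)) x := (hf i).smul_section (ht i)
    rw [Finset.sum_insert hi, Finset.sum_insert hi]
    refine ⟨mdifferentiableAt_add_section h1 ih.1, ?_⟩
    rw [𝒟.nabla.isCovariantDerivativeOnUniv.add h1 ih.1,
      𝒟.nabla.isCovariantDerivativeOnUniv.leibniz (ht i) (hf i), add_apply, ih.2]
    rfl

theorem GeometricData.IsGeometricCliffordFamily.nabla_along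
    (h𝒟 : 𝒟.IsGeometricCliffordFamily) {EN HN N : Type*} [NormedAddCommGroup EN]
    [NormedSpace ℝ EN] [TopologicalSpace HN] {J : ModelWithCorners ℝ EN HN} [TopologicalSpace N]
    [ChartedSpace HN N] {σ : ∀ x, τ.E.fib x} (hσ : τ.E.SmoothOn σ univ) {b : N → τ.X}
    {w : ∀ n, τ.X.T (b n)} {n : N} (hw : SmoothAlong J τ.X b w n) :
    τ.E.SmoothAlong J b (fun n => 𝒟.nabla σ (b n) (w n)) n := by
  have h1 := contMDiffOn_univ.1 (h𝒟.nabla_smooth.contMDiff (σ := σ) hσ)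
  have h2 := (h1.contMDiffAt (x := b n)).comp n (along_base hw)
  exact ContMDiffAt.clm_bundle_apply (E₁ := fun x : τ.X => τ.X.T x) (E₂ := τ.E.fib)
    (F₁ := τ.X.model) (F₂ := τ.E.F) (b := b) (ϕ := fun m => 𝒟.nabla σ (b m)) h2 hw

/-- The pulled back derivative `d_A + ∇^E` of a smooth section over `A × X` along a smooth field is
smooth. -/
theorem GeometricData.IsGeometricCliffordFamily.pullback_nabla_along
    (h𝒟 : 𝒟.IsGeometricCliffordFamily) {A : SmoothMfd.{u}} {s : A → ∀ x, τ.E.fib x}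
    (hs : ∀ p : A × τ.X, τ.E.SmoothAlong (A.I.prod τ.X.I) (fun p : A × τ.X => p.2)
      (fun p => s p.1 p.2) p)
    {v : ∀ p : A × τ.X, A.T p.1} {w : ∀ p : A × τ.X, τ.X.T p.2} {p₀ : A × τ.X}
    (hv : SmoothAlong (A.I.prod τ.X.I) A (fun p : A × τ.X => p.1) v p₀)
    (hw : SmoothAlong (A.I.prod τ.X.I) τ.X (fun p : A × τ.X => p.2) w p₀) :
    τ.E.SmoothAlong (A.I.prod τ.X.I) (fun p : A × τ.X => p.2)
      (fun p => τ.E.fiberDeriv A p.2 (fun b => s b p.2) p.1 (v p) +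
        𝒟.nabla (s p.1) p.2 (w p)) p₀ := by
  let β := Module.finBasis ℝ τ.E.F
  set e := trivializationAt τ.E.F τ.E.fib p₀.2 with he
  -- The local frame is extended to global sections, the sections for which `nabla_along` gives
  -- smoothness.
  have hfr : ∀ i, ∃ t : ∀ x, τ.E.fib x, τ.E.SmoothOn t univ ∧
      ∀ᶠ x in 𝓝 p₀.2, t x = coordSymm τ.E.F τ.E.fib p₀.2 x (β i) := fun i => by
    obtain ⟨t, ht, ht'⟩ := exists_smooth_section_eventuallyEq (I := τ.X.I)
      (fun x => coordSymm τ.E.F τ.E.fib p₀.2 x (β i)) p₀.2 <| by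
      filter_upwards [eventually_mem_baseSet τ.E.F τ.E.fib p₀.2] with x hx
      exact contMDiffAt_coordSymm p₀.2 hx _
    exact ⟨t, ht.contMDiffOn, ht'⟩
  choose t ht ht' using hfr
  let h : A × τ.X → τ.E.F := fun p => coordAt τ.E.F τ.E.fib p₀.2 p.2 (s p.1 p.2)
  have hh : ∀ p : A × τ.X, p.2 ∈ e.baseSet → ContMDiffAt (A.I.prod τ.X.I) 𝓘(ℝ, τ.E.F) ∞ h p := by
    intro p hp
    have h1 := ((Trivialization.contMDiffAt_iff (e := e) (e.mem_source.2 hp)).1 (hs p)).2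
    refine h1.congr_of_eventuallyEq ?_
    filter_upwards [continuousAt_snd.eventually (e.open_baseSet.mem_nhds hp)] with q hq
    exact coordAt_apply hq _
  have hp₀ : p₀.2 ∈ e.baseSet := mem_baseSet_trivializationAt _ _ _
  -- With `s = ∑ hᵢ tᵢ` near `p₀`, the derivative along `A` contributes `dh (v, 0)` and the
  -- connection contributes `dh (0, w) + ∑ hᵢ ∇_w tᵢ`. Together the first two make up the full
  -- differential of `h`, and every term is visibly smooth.
  have key : ∀ᶠ p in 𝓝 p₀, τ.E.fiberDeriv A p.2 (fun b => s b p.2) p.1 (v p) +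
      𝒟.nabla (s p.1) p.2 (w p) = coordSymm τ.E.F τ.E.fib p₀.2 p.2
        (mvfderiv (A.I.prod τ.X.I) h p ((v p, w p) : A.model × τ.X.model)) +
      ∑ i, β.coord i (h p) • 𝒟.nabla (t i) p.2 (w p) := by
    have h1 : ∀ᶠ x in 𝓝 p₀.2, x ∈ e.baseSet ∧
        ∀ i, t i x = coordSymm τ.E.F τ.E.fib p₀.2 x (β i) :=
      Filter.Eventually.and (e.open_baseSet.mem_nhds hp₀) (eventually_all.2 ht')
    -- The frame identity is needed on a neighbourhood of each nearby point, because `∇^E`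
    -- differentiates there.
    filter_upwards [continuousAt_snd.eventually (eventually_eventually_nhds.2 h1)] with p hp
    obtain ⟨a, x⟩ := p
    have hx := hp.self_of_nhds
    have hhp := (hh (a, x) hx.1).mdifferentiableAt (by simp)
    have hl : ContMDiff A.I (A.I.prod τ.X.I) ∞ (fun b : A => (b, x)) :=
      contMDiff_id.prodMk contMDiff_const
    have hr : ContMDiff τ.X.I (A.I.prod τ.X.I) ∞ (fun y : τ.X => (a, y)) :=
      contMDiff_const.prodMk contMDiff_id
    have hhl : MDifferentiableAt A.I 𝓘(ℝ, τ.E.F) (fun b => h (b, x)) a :=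
      MDifferentiableAt.comp (f := fun b : A => (b, x)) a hhp (hl.mdifferentiableAt (by simp))
    have hhr : MDifferentiableAt τ.X.I 𝓘(ℝ, τ.E.F) (fun y => h (a, y)) x :=
      MDifferentiableAt.comp (f := fun y : τ.X => (a, y)) x hhp (hr.mdifferentiableAt (by simp))
    have h2 : (fun b => s b x) = fun b => coordSymm τ.E.F τ.E.fib p₀.2 x (h (b, x)) :=
      funext fun b => (coordSymm_coordAt hx.1 _).symm
    let β' : ∀ i, τ.E.F →L[ℝ] ℝ := fun i => LinearMap.toContinuousLinearMap (β.coord i)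
    have h3 := 𝒟.nabla_sum Finset.univ (f := fun i y => β' i (h (a, y))) (t := t) (x := x)
      (fun i => mdifferentiableAt_clm_comp (β' i) hhr)
      (fun i => (contMDiffOn_univ.1 (ht i) x).mdifferentiableAt (by simp)) (w (a, x))
    have h4 : ∀ᶠ y in 𝓝 x, s a y = (∑ i, (fun y => β' i (h (a, y))) • t i) y := by
      filter_upwards [hp] with y hy
      rw [Finset.sum_apply]
      calc s a y = coordSymm τ.E.F τ.E.fib p₀.2 y (h (a, y)) := (coordSymm_coordAt hy.1 _).symm
        _ = coordSymm τ.E.F τ.E.fib p₀.2 y (∑ i, β.repr (h (a, y)) i • β i) := by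
          rw [β.sum_repr]
        _ = _ := by
          rw [map_sum]
          refine Finset.sum_congr rfl fun i _ => ?_
          rw [map_smul, ← hy.2 i]
          rfl
    have h5 : MDifferentiableAt τ.X.I τ.E.ITot (fun y => TotalSpace.mk' τ.E.F y (s a y)) x :=
      ((hs (a, x)).mdifferentiableAt (by simp)).comp x (hr.mdifferentiableAt (by simp))
    rw [h2, ComplexBundle.fiberDeriv_clm _ hhl, mvfderiv_prod hhp,
      𝒟.nabla.isCovariantDerivativeOnUniv.congr_of_eventuallyEq h5 h3.1 univ_mem h4, h3.2,
      map_add, add_assoc, Finset.sum_add_distrib, add_comm (Finset.sum _ _)]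
    refine congrArg (fun e => coordSymm τ.E.F τ.E.fib p₀.2 x _ + (e + _)) ?_
    rw [← β.sum_repr (mvfderiv τ.X.I (fun y => h (a, y)) x (w (a, x))), map_sum]
    refine Finset.sum_congr rfl fun i _ => ?_
    rw [map_smul, ← hx.2 i, mvfderiv_clm_comp (β' i) hhr]
    rfl
  have h1 := contMDiffAt_mvfderiv_apply (hh p₀ hp₀) (contMDiffAt_prodField hv hw)
  have h2 : τ.E.SmoothAlong (A.I.prod τ.X.I) (fun p : A × τ.X => p.2)
      (fun p => coordSymm τ.E.F τ.E.fib p₀.2 p.2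
        (mvfderiv (A.I.prod τ.X.I) h p ((v p, w p) : A.model × τ.X.model))) p₀ := by
    refine (along_iff contMDiffAt_snd).2 (h1.congr_of_eventuallyEq ?_)
    filter_upwards [continuousAt_snd.eventually (e.open_baseSet.mem_nhds hp₀)] with q hq
    exact coordAt_coordSymm hq _
  have h3 : τ.E.SmoothAlong (A.I.prod τ.X.I) (fun p : A × τ.X => p.2)
      (fun p => ∑ i, β.coord i (h p) • 𝒟.nabla (t i) p.2 (w p)) p₀ :=
    along_sum contMDiffAt_snd fun i => along_smul
      ((LinearMap.toContinuousLinearMap (β.coord i)).contMDiff.contMDiffAt.comp p₀ (hh p₀ hp₀))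
      (h𝒟.nabla_along (ht i) hw)
  refine (along_add h2 h3).congr_of_eventuallyEq ?_
  filter_upwards [key] with p hp
  exact congrArg (TotalSpace.mk' τ.E.F p.2) hp

end Nabla

end

/-! ### Smoothness, complex linearity and grading for the induced connection -/

noncomputable section

namespace PrincipalBundle.AssociatedTower

variable {EG : Type*} [NormedAddCommGroup EG] [NormedSpace ℝ EG]
  {G : Type*} [TopologicalSpace G] [ChartedSpace EG G] [Group G] [LieGroup 𝓘(ℝ, EG) ∞ G]
  {P : PrincipalBundle.{u} (EG := EG) G} {V : ∀ q : P.Q, Submodule ℝ (P.Q.T q)}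
  {τ : Tower.{u}} [MulAction G τ.X] [MulAction G τ.S] {α : TowerAction (EG := EG) G τ}
  {R : P.AssociatedTower α} [ContMDiffSMul 𝓘(ℝ, EG) τ.X.I ∞ G τ.X]
  {𝒟 : GeometricData τ} {𝒟Q : GeometricData R.tower}

namespace IsInduced

variable (hI : R.IsInduced V 𝒟 𝒟Q)
include hI

theorem nabla_push {σ : ∀ z, R.tower.E.fib z} (hσ : R.tower.E.SmoothOn σ univ) {a : P.Q} {x : τ.X}
    {v : P.Q.T a} (hv : v ∈ V a) (w : τ.X.T x) :
    𝒟Q.nabla σ (R.qX (a, x)) (P.push R.qX a x v w) = R.qE a x (R.liftDeriv 𝒟 σ a x v w) :=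
  hI.nabla σ _ hσ (fun a x => R.qE_liftSection σ a x) a x v hv w

/-- Smoothness is tested on the frame fields of `X_Q`. Their lifts have smooth components in `V` and
in `TX`, and the derivative of `σ` along them is the image under `qE` of a pulled back derivative.
-/
theorem nabla_smooth (h𝒟 : 𝒟.IsGeometricCliffordFamily) (hV : P.IsConnection V) :
    ContMDiffCovariantDerivativeOn R.tower.E.F ∞ 𝒟Q.nabla.toFun Set.univ := by
  constructor
  intro σ hσ
  have hσ' : R.tower.E.SmoothOn σ univ := hσ
  refine contMDiffOn_univ.2 fun z => ?_
  refine along_hom (E := fun z : R.tower.X => R.tower.X.T z) (E' := R.tower.E.fib) (b := id)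
    contMDiffAt_id fun y => ?_
  obtain ⟨p, rfl⟩ := R.assocX.surjective z
  let u : ∀ z, R.tower.X.T z := fun z => tframe R.tower.X (R.qX p) z y
  have hu : SmoothFieldAt R.tower.X u (R.qX p) :=
    contMDiffAt_coordSymm (R.qX p) (mem_baseSet_trivializationAt _ _ _) y
  obtain ⟨h1, h2⟩ := R.lift_smooth hV hu
  refine R.assocX.contMDiffAt_of_comp (p := p) ?_
  have h3 := R.qE_along contMDiffAt_fst (h𝒟.pullback_nabla_along (s := R.liftSection σ)
    (fun q => R.liftSection_along contMDiffAt_fst contMDiffAt_snd (contMDiffOn_univ.1 hσ' _)) h1 h2)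
  refine h3.congr_of_eventuallyEq (Eventually.of_forall fun q => ?_)
  refine congrArg (TotalSpace.mk' R.tower.E.F (R.qX q)) ?_
  have h4 := hI.nabla_push hσ' (R.liftQ_mem hV u q.1 q.2) (R.liftX hV u q.1 q.2)
  rwa [R.push_lift] at h4

/-- The common argument for multiplication by `Complex.I` and for the grading: a fibrewise linear
operator commutes with `d_Q` automatically and with `∇^E` by hypothesis. -/
theorem nabla_map (hV : P.IsConnection V) {T : ∀ x, τ.E.fib x →ₗ[ℝ] τ.E.fib x}
    {TQ : ∀ z, R.tower.E.fib z → R.tower.E.fib z}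
    (hT : ∀ a x e, TQ (R.qX (a, x)) (R.qE a x e) = R.qE a x (T x e))
    (hsm : ∀ σ, R.tower.E.SmoothOn σ univ → R.tower.E.SmoothOn (fun z => TQ z (σ z)) univ)
    (hn : ∀ σ, τ.E.SmoothOn σ univ → ∀ (x : τ.X) (w : τ.X.T x),
      𝒟.nabla (fun y => T y (σ y)) x w = T x (𝒟.nabla σ x w))
    {σ : ∀ z, R.tower.E.fib z} (hσ : R.tower.E.SmoothOn σ univ) (z : R.tower.X)
    (ζ : R.tower.X.T z) :
    𝒟Q.nabla (fun z => TQ z (σ z)) z ζ = TQ z (𝒟Q.nabla σ z ζ) := by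
  obtain ⟨⟨a, x⟩, rfl⟩ := R.assocX.surjective z
  obtain ⟨v, hv, w, rfl⟩ := R.assocX.exists_push hV a x ζ
  rw [hI.nabla_push (hsm σ hσ) hv, hI.nabla_push hσ hv, hT]
  have h1 : R.liftSection (fun z => TQ z (σ z)) = fun a x => T x (R.liftSection σ a x) := by
    funext a x
    refine (R.eq_liftSection ?_).symm
    rw [← hT, R.qE_liftSection]
  have h2 := R.fiberDifferentiableAt_liftSection (a := a) (x := x)
    ((contMDiffOn_univ.1 hσ _).mdifferentiableAt (by simp))
  refine congrArg (R.qE a x) ?_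
  rw [liftDeriv, liftDeriv, h1, map_add, hn _ (R.liftSection_smooth hσ a)]
  exact congrArg (· + _) ((ComplexBundle.FiberDifferentiableAt.map (E' := τ.E) (T x) h2).2 v)

theorem nabla_complex (h𝒟 : 𝒟.IsGeometricCliffordFamily) (hV : P.IsConnection V)
    {σ : ∀ z, R.tower.E.fib z} (hσ : R.tower.E.SmoothOn σ univ) (z : R.tower.X)
    (ζ : R.tower.X.T z) :
    𝒟Q.nabla (fun z => Complex.I • σ z) z ζ = Complex.I • 𝒟Q.nabla σ z ζ := by
  refine hI.nabla_map hV
    (T := fun x => (LinearMap.lsmul ℂ (τ.E.fib x) Complex.I).restrictScalars ℝ)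
    (TQ := fun z e => Complex.I • e) (fun a x e => ((R.qE a x).map_smul _ _).symm) ?_
    h𝒟.nabla_complex hσ z ζ
  intro σ hσ
  refine contMDiffOn_univ.2 fun z => ?_
  exact along_map (E := R.tower.E.fib) (E' := R.tower.E.fib) (b := id) (c := id) contMDiffAt_id
    -- The frames are complex linear in the fibre coordinate, so `Complex.I` takes the frame section
    -- of `y` to that of `Complex.I • y`.
    (fun z => (LinearMap.lsmul ℂ (R.tower.E.fib z) Complex.I).restrictScalars ℝ) (fun y => by
      have h1 : R.tower.E.SmoothAlong R.tower.X.I id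
          (fun z' => coordSymm R.tower.E.F R.tower.E.fib z z' (Complex.I • y)) z :=
        contMDiffAt_coordSymm z (mem_baseSet_trivializationAt _ _ _) _
      refine h1.congr_of_eventuallyEq ?_
      filter_upwards [eventually_mem_baseSet R.tower.E.F R.tower.E.fib z] with z' hz'
      refine congrArg (TotalSpace.mk' R.tower.E.F z') ?_
      refine (congrArg (Complex.I • ·) (R.tower.E.symmC_eq z z' y).symm).trans ?_
      refine Eq.trans ?_ (R.tower.E.symmC_eq z z' (Complex.I • y))
      exact ((R.tower.E.symmC z z').map_smul Complex.I y).symm)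
    (contMDiffOn_univ.1 hσ z)

variable [ContMDiffSMul 𝓘(ℝ, EG) τ.S.I ∞ G τ.S]

theorem preservesGrading (h𝒟 : 𝒟.IsGeometricCliffordFamily) (hV : P.IsConnection V)
    (h : 𝒟.PreservesGrading) : 𝒟Q.PreservesGrading := fun _ hσ z ζ =>
  hI.nabla_map hV (T := fun x => (𝒟.ε x).restrictScalars ℝ) (TQ := fun z => 𝒟Q.ε z) hI.grading
    (fun σ hσ => (hI.isGradedCliffordModule hV h𝒟).ε_smooth univ σ isOpen_univ hσ) h hσ z ζ

end IsInduced

end PrincipalBundle.AssociatedTower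

end

/-! ### The Lie bracket on `X_Q` in terms of lifts -/

noncomputable section

section Bilinear

variable {EM HM M : Type*} [NormedAddCommGroup EM] [NormedSpace ℝ EM] [CompleteSpace EM]
  [TopologicalSpace HM]
  {I : ModelWithCorners ℝ EM HM} [I.Boundaryless] [TopologicalSpace M] [ChartedSpace HM M]
  [IsManifold I ∞ M]
  {W W' W'' : Type*} [NormedAddCommGroup W] [NormedSpace ℝ W] [NormedAddCommGroup W']
  [NormedSpace ℝ W'] [NormedAddCommGroup W''] [NormedSpace ℝ W'']

theorem mvfderiv_bilinear (B : W →L[ℝ] W' →L[ℝ] W'') {f : M → W} {g : M → W'} {p : M}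
    (hf : MDifferentiableAt I 𝓘(ℝ, W) f p) (hg : MDifferentiableAt I 𝓘(ℝ, W') g p)
    (v : TangentSpace I p) :
    mvfderiv I (fun m => B (f m) (g m)) p v =
      B (mvfderiv I f p v) (g p) + B (f p) (mvfderiv I g p v) := by
  have hBf : MDifferentiableAt I 𝓘(ℝ, W' →L[ℝ] W'') (fun m => B (f m)) p :=
    mdifferentiableAt_clm_comp B hf
  have hd : DifferentiableAt ℝ ((fun m => B (f m)) ∘ (extChartAt I p).symm) (extChartAt I p p) := by
    have := ((mdifferentiableAt_iff _ _).1 hBf).2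
    rw [I.range_eq_univ, differentiableWithinAt_univ] at this
    exact this
  have hd' : DifferentiableAt ℝ (g ∘ (extChartAt I p).symm) (extChartAt I p p) := by
    have := ((mdifferentiableAt_iff _ _).1 hg).2
    rw [I.range_eq_univ, differentiableWithinAt_univ] at this
    exact this
  have h1 := congrArg (fun L : EM →L[ℝ] W'' => L v) (fderiv_clm_apply hd hd')
  rw [mvfderiv_eq_fderiv (hBf.clm_apply hg), ← mvfderiv_clm_comp B hf, mvfderiv_eq_fderiv hBf,
    mvfderiv_eq_fderiv hg]
  refine h1.trans ?_
  have h2 : (extChartAt I p).symm (extChartAt I p p) = p := extChartAt_to_inv p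
  simp only [Function.comp_apply, h2]
  exact add_comm _ _

end Bilinear

section Tangent

variable {X A : SmoothMfd.{u}}

/-- The derivative of a map into a linear subspace of a tangent space lies in the subspace. -/
theorem tangentDeriv_mem {x : X} (K : Submodule ℝ (X.T x)) {f : A → X.T x} {a : A}
    (hf : MDifferentiableAt A.I 𝓘(ℝ, X.model) (M' := X.model) f a) (h : ∀ b, f b ∈ K)
    (v : A.T a) : tangentDeriv A x f a v ∈ K := by
  obtain ⟨K', hK⟩ := K.exists_isCompl
  let L : X.model →L[ℝ] X.model := LinearMap.toContinuousLinearMap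
    (K'.subtype ∘ₗ Submodule.projectionOnto K' K hK.symm : X.T x →ₗ[ℝ] X.T x)
  have hL : ∀ w : X.T x, L w = 0 ↔ w ∈ K := fun w => by
    rw [← Submodule.projectionOnto_apply_eq_zero_iff hK.symm]
    exact ⟨fun h => Subtype.ext h, fun h => congrArg Subtype.val h⟩
  refine (hL _).1 ?_
  refine (mvfderiv_clm_comp L hf v).symm.trans ?_
  have h1 : (fun b => L (f b)) = fun _ => (0 : X.model) := funext fun b => (hL _).2 (h b)
  rw [h1, mvfderiv_const]
  rfl

/-- Charts of a product are products of charts. The identity is wanted near `p`, since it is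
differentiated next. -/
theorem eventually_coordAt_prod (p : A × X) : ∀ᶠ y in 𝓝 p, ∀ (v : A.T y.1) (w : X.T y.2),
    (coordAt (A.model × X.model) (TangentSpace (A.I.prod X.I) : A × X → Type _) p y
      ((v, w) : A.model × X.model)).1 = tcoord A p.1 y.1 v ∧
    (coordAt (A.model × X.model) (TangentSpace (A.I.prod X.I) : A × X → Type _) p y
      ((v, w) : A.model × X.model)).2 = tcoord X p.2 y.2 w := by
  filter_upwards [(chartAt (ModelProd A.model X.model) p).open_source.mem_nhds
      (mem_chart_source _ p), continuousAt_fst.eventually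
      ((chartAt A.model p.1).open_source.mem_nhds (mem_chart_source _ p.1)),
    continuousAt_snd.eventually
      ((chartAt X.model p.2).open_source.mem_nhds (mem_chart_source _ p.2))] with y hy hy1 hy2 v w
  have hd : MDifferentiableAt (A.I.prod X.I) 𝓘(ℝ, A.model × X.model)
    (extChartAt (A.I.prod X.I) p) y := mdifferentiableAt_extChartAt hy
  have h := coordAt_tangent (I := A.I.prod X.I) hy ((v, w) : A.model × X.model)
  constructor
  · refine (congrArg Prod.fst h).trans (Eq.trans ?_ (coordAt_tangent (I := A.I) hy1 v).symm)
    refine (mvfderiv_clm_comp (ContinuousLinearMap.fst ℝ A.model X.model) hd _).symm.trans ?_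
    refine (mvfderiv_comp_apply (g := extChartAt A.I p.1) (f := Prod.fst)
      (mdifferentiableAt_extChartAt hy1) mdifferentiableAt_fst
      ((v, w) : A.model × X.model)).trans ?_
    rw [mfderiv_fst]
    rfl
  · refine (congrArg Prod.snd h).trans (Eq.trans ?_ (coordAt_tangent (I := X.I) hy2 w).symm)
    refine (mvfderiv_clm_comp (ContinuousLinearMap.snd ℝ A.model X.model) hd _).symm.trans ?_
    refine (mvfderiv_comp_apply (g := extChartAt X.I p.2) (f := Prod.snd)
      (mdifferentiableAt_extChartAt hy2) mdifferentiableAt_snd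
      ((v, w) : A.model × X.model)).trans ?_
    rw [mfderiv_snd]
    rfl

/-- Moving in `X` keeps the `A` component inside the fixed space `A.T p.1`, so its mixed derivative
needs no trivialization; the same holds with the factors exchanged. -/
theorem mvfderiv_coordAt_prod {v : ∀ p : A × X, A.T p.1} {w : ∀ p : A × X, X.T p.2} {p : A × X}
    (hv : SmoothAlong (A.I.prod X.I) A (fun p : A × X => p.1) v p)
    (hw : SmoothAlong (A.I.prod X.I) X (fun p : A × X => p.2) w p) (r : A.T p.1) (t : X.T p.2) :
    (mvfderiv (A.I.prod X.I) (fun y => coordAt (A.model × X.model)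
      (TangentSpace (A.I.prod X.I) : A × X → Type _) p y ((v y, w y) : A.model × X.model)) p
        ((r, t) : A.model × X.model)).1 =
      mvfderiv A.I (fun b => tcoord A p.1 b (v (b, p.2))) p.1 r +
        mvfderiv X.I (F := A.model) (fun y => v (p.1, y)) p.2 t ∧
    (mvfderiv (A.I.prod X.I) (fun y => coordAt (A.model × X.model)
      (TangentSpace (A.I.prod X.I) : A × X → Type _) p y ((v y, w y) : A.model × X.model)) p
        ((r, t) : A.model × X.model)).2 =
      mvfderiv A.I (F := X.model) (fun b => w (b, p.2)) p.1 r +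
        mvfderiv X.I (fun y => tcoord X p.2 y (w (p.1, y))) p.2 t := by
  have hd := (along_coord (b := id) (contMDiffAt_prodField hv hw)).mdifferentiableAt (by simp)
  have hv' := (along_coord hv).mdifferentiableAt (by simp)
  have hw' := (along_coord hw).mdifferentiableAt (by simp)
  constructor
  · refine (mvfderiv_clm_comp (ContinuousLinearMap.fst ℝ A.model X.model) hd _).symm.trans ?_
    have h1 := mvfderiv_congr' (J := A.I.prod X.I)
      ((eventually_coordAt_prod p).mono fun y hy => (hy (v y) (w y)).1)
    refine (congrArg (fun L : TangentSpace (A.I.prod X.I) p →L[ℝ] A.model => L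
      ((r, t) : A.model × X.model)) h1).trans ?_
    refine (mvfderiv_prod hv' r t).trans ?_
    have h2 : (fun y => tcoord A p.1 p.1 (v (p.1, y))) = fun y => v (p.1, y) :=
      funext fun y => tcoord_self p.1 _
    exact congrArg (fun f : X → A.model => mvfderiv A.I (fun b => tcoord A p.1 b (v (b, p.2))) p.1 r +
      mvfderiv X.I f p.2 t) h2
  · refine (mvfderiv_clm_comp (ContinuousLinearMap.snd ℝ A.model X.model) hd _).symm.trans ?_
    have h1 := mvfderiv_congr' (J := A.I.prod X.I)
      ((eventually_coordAt_prod p).mono fun y hy => (hy (v y) (w y)).2)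
    refine (congrArg (fun L : TangentSpace (A.I.prod X.I) p →L[ℝ] X.model => L
      ((r, t) : A.model × X.model)) h1).trans ?_
    refine (mvfderiv_prod hw' r t).trans ?_
    have h2 : (fun b => tcoord X p.2 p.2 (w (b, p.2))) = fun b => w (b, p.2) :=
      funext fun b => tcoord_self p.2 _
    exact congrArg (fun f : A → X.model => mvfderiv A.I f p.1 r +
      mvfderiv X.I (fun y => tcoord X p.2 y (w (p.1, y))) p.2 t) h2

end Tangent

namespace PrincipalBundle.AssociatedTower

variable {EG : Type*} [NormedAddCommGroup EG] [NormedSpace ℝ EG]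
  {G : Type*} [TopologicalSpace G] [ChartedSpace EG G] [Group G] [LieGroup 𝓘(ℝ, EG) ∞ G]
  {P : PrincipalBundle.{u} (EG := EG) G} {V : ∀ q : P.Q, Submodule ℝ (P.Q.T q)}
  {τ : Tower.{u}} [MulAction G τ.X] [MulAction G τ.S] {α : TowerAction (EG := EG) G τ}
  (R : P.AssociatedTower α) [ContMDiffSMul 𝓘(ℝ, EG) τ.X.I ∞ G τ.X]
  [ContMDiffSMul 𝓘(ℝ, EG) τ.S.I ∞ G τ.S] (hpr : ContMDiff τ.X.I τ.S.I ∞ τ.pr)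
  (hV : P.IsConnection V)

/-- Fields related by `q` differentiate `ψ ∘ q` and `ψ` compatibly. Holding near `p`, the relation
can be differentiated again. -/
theorem mvfderiv_extChartAt_qX {u : ∀ z, R.tower.X.T z} {p : P.Q × τ.X}
    {v : ∀ p : P.Q × τ.X, P.Q.T p.1} {w : ∀ p : P.Q × τ.X, τ.X.T p.2}
    (h : ∀ p, P.push R.qX p.1 p.2 (v p) (w p) = u (R.qX p)) {F : Type*} [NormedAddCommGroup F]
    [NormedSpace ℝ F] {ψ : R.tower.X → F} (hψ : ContMDiffAt R.tower.X.I 𝓘(ℝ, F) ∞ ψ (R.qX p)) :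
    (fun q => mvfderiv (P.Q.I.prod τ.X.I) (fun q => ψ (R.qX q)) q
      ((v q, w q) : P.Q.model × τ.X.model)) =ᶠ[𝓝 p]
      fun q => mvfderiv R.tower.X.I ψ (R.qX q) (u (R.qX q)) := by
  have h1 : ∀ᶠ z in 𝓝 (R.qX p), MDifferentiableAt R.tower.X.I 𝓘(ℝ, F) ψ z := by
    filter_upwards [(contMDiffAt_iff_contMDiffAt_nhds (n := 1) (by simp)).1
      (hψ.of_le ENat.LEInfty.out)] with z hz
    exact ContMDiffAt.mdifferentiableAt hz (by simp)
  filter_upwards [R.assocX.smooth.continuous.continuousAt.eventually h1] with q hq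
  rw [← h q]
  exact mvfderiv_comp_apply hq (R.assocX.smooth.mdifferentiableAt (by simp)) _

theorem liftX_smooth {u : ∀ z, R.tower.X.T z} {a : P.Q} {x : τ.X}
    (hu : SmoothFieldAt R.tower.X u (R.qX (a, x))) : SmoothFieldAt τ.X (R.liftX hV u a) x :=
  ContMDiffAt.comp (f := fun y : τ.X => (a, y)) x (R.lift_smooth hV (p := (a, x)) hu).2
    (contMDiffAt_const.prodMk contMDiffAt_id)

theorem liftVert_smoothField {ν : VertField R.tower.pr} {a : P.Q} {x : τ.X}
    (hν : SmoothFieldAt R.tower.X (fun z => (ν z : R.tower.X.T z)) (R.qX (a, x))) :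
    SmoothFieldAt τ.X (fun y => (R.liftVert hpr hV ν a y : τ.X.T y)) x :=
  ContMDiffAt.comp (f := fun y : τ.X => (a, y)) x (R.liftVert_smooth hpr hV (p := (a, x)) hν)
    (contMDiffAt_const.prodMk contMDiffAt_id)

/-- The Lie bracket of a vector field and a vertical field on `X_Q`, in terms of lifts. -/
theorem mlieBracket_push {u : ∀ z, R.tower.X.T z} {ν : VertField R.tower.pr} {a : P.Q} {x : τ.X}
    (hu : SmoothFieldAt R.tower.X u (R.qX (a, x)))
    (hν : SmoothFieldAt R.tower.X (fun z => (ν z : R.tower.X.T z)) (R.qX (a, x))) :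
    ∃ ξ ∈ V a, VectorField.mlieBracket R.tower.X.I u (fun z => (ν z : R.tower.X.T z))
        (R.qX (a, x)) = P.push R.qX a x ξ
      (tangentDeriv P.Q x (fun b => (R.liftVert hpr hV ν b x : τ.X.T x)) a (R.liftQ hV u a x) +
        VectorField.mlieBracket τ.X.I (R.liftX hV u a)
          (fun y => (R.liftVert hpr hV ν a y : τ.X.T y)) x) := by
  obtain ⟨hu1, hu2⟩ := R.lift_smooth hV (p := (a, x)) hu
  have hν2 := R.liftVert_smooth hpr hV (p := (a, x)) hν
  have hν1 : SmoothAlong (P.Q.I.prod τ.X.I) P.Q (fun p : P.Q × τ.X => p.1) (fun p => 0) (a, x) :=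
    along_zero (E := fun x : P.Q => P.Q.T x) contMDiffAt_fst
  have hU := contMDiffAt_prodField hu1 hu2
  have hW := contMDiffAt_prodField hν1 hν2
  have hψ : ContMDiffAt R.tower.X.I 𝓘(ℝ, R.tower.X.model) ∞
    (extChartAt R.tower.X.I (R.qX (a, x))) (R.qX (a, x)) := contMDiffAt_extChartAt
  have hΨ := ContMDiffAt.comp (f := R.qX) (a, x) hψ R.assocX.smooth.contMDiffAt
  -- The commutator formula is used twice: for a chart of `X_Q`, and for this chart composed with
  -- `q` along the lifted fields. The iterated derivatives agree, which identifies the bracket with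
  -- the push of its counterpart on `Q × X`.
  have e1 := mvfderiv_mvfderiv_sub hψ hu hν
  have e2 := mvfderiv_mvfderiv_sub hΨ hU hW
  have eW := R.mvfderiv_extChartAt_qX (p := (a, x)) (u := fun z => (ν z : R.tower.X.T z))
    (v := fun _ => 0) (w := fun p => (R.liftVert hpr hV ν p.1 p.2 : τ.X.T p.2))
    (fun p => R.push_liftVert hpr hV ν p.1 p.2) hψ
  have eU := R.mvfderiv_extChartAt_qX (p := (a, x)) (u := u)
    (v := fun p => R.liftQ hV u p.1 p.2) (w := fun p => R.liftX hV u p.1 p.2)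
    (fun p => R.push_lift hV u p.1 p.2) hψ
  have eb := mlieBracket_eq hu hν
  obtain ⟨d1, d2⟩ := mvfderiv_coordAt_prod hν1 hν2 (R.liftQ hV u a x) (R.liftX hV u a x)
  obtain ⟨d3, d4⟩ := mvfderiv_coordAt_prod hu1 hu2 0 (R.liftVert hpr hV ν a x : τ.X.T x)
  have eb' := mlieBracket_eq (R.liftX_smooth hV hu) (R.liftVert_smoothField hpr hV hν)
  have hq : MDifferentiableAt (P.Q.I.prod τ.X.I) R.tower.X.I R.qX (a, x) :=
    R.assocX.smooth.mdifferentiableAt (by simp)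
  have f1 := (mvfderiv_comp_apply ((contMDiffAt_mvfderiv_apply hψ hν).mdifferentiableAt (by simp)) hq
    ((R.liftQ hV u a x, R.liftX hV u a x) : P.Q.model × τ.X.model)).symm.trans
    (congrArg (fun L : TangentSpace (P.Q.I.prod τ.X.I) (a, x) →L[ℝ] R.tower.X.model => L
      ((R.liftQ hV u a x, R.liftX hV u a x) : P.Q.model × τ.X.model)) (mvfderiv_congr eW)).symm
  have f2 := (mvfderiv_comp_apply ((contMDiffAt_mvfderiv_apply hψ hu).mdifferentiableAt (by simp)) hq
    ((0, (R.liftVert hpr hV ν a x : τ.X.T x)) : P.Q.model × τ.X.model)).symm.trans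
    (congrArg (fun L : TangentSpace (P.Q.I.prod τ.X.I) (a, x) →L[ℝ] R.tower.X.model => L
      ((0, (R.liftVert hpr hV ν a x : τ.X.T x)) : P.Q.model × τ.X.model)) (mvfderiv_congr eU)).symm
  have g1 : mvfderiv R.tower.X.I (fun y => mvfderiv R.tower.X.I
      (extChartAt R.tower.X.I (R.qX (a, x))) y (ν y)) (R.qX (a, x)) (u (R.qX (a, x))) = _ :=
    (congrArg (fun w : R.tower.X.T (R.qX (a, x)) => mvfderiv R.tower.X.I (fun y =>
      mvfderiv R.tower.X.I (extChartAt R.tower.X.I (R.qX (a, x))) y (ν y)) (R.qX (a, x)) w)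
      (R.push_lift hV u a x)).symm.trans f1
  have g2 : mvfderiv R.tower.X.I (fun y => mvfderiv R.tower.X.I
      (extChartAt R.tower.X.I (R.qX (a, x))) y (u y)) (R.qX (a, x)) (ν (R.qX (a, x))) = _ :=
    (congrArg (fun w : R.tower.X.T (R.qX (a, x)) => mvfderiv R.tower.X.I (fun y =>
      mvfderiv R.tower.X.I (extChartAt R.tower.X.I (R.qX (a, x))) y (u y)) (R.qX (a, x)) w)
      (R.push_liftVert hpr hV ν a x)).symm.trans f2
  have e3 := e1.symm.trans ((congrArg₂ (fun s t : R.tower.X.model => s - t) g1 g2).trans e2)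
  have e4 := (mfderiv_extChartAt_self (R.qX (a, x)) _).symm.trans
    ((congrArg (fun w : R.tower.X.T (R.qX (a, x)) => mvfderiv R.tower.X.I
      (extChartAt R.tower.X.I (R.qX (a, x))) (R.qX (a, x)) w) eb).trans
      (e3.trans (mfderiv_extChartAt_comp hq _)))
  have hq1 : MDifferentiableAt τ.X.I 𝓘(ℝ, P.Q.model) (M' := P.Q.model)
      (fun y => R.liftQ hV u a y) x := by
    have h1 := ContMDiffAt.comp (f := fun y : τ.X => (a, y)) x (along_coord hu1)
      (contMDiffAt_const.prodMk contMDiffAt_id)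
    refine MDifferentiableAt.congr_of_eventuallyEq (h1.mdifferentiableAt (by simp)) ?_
    exact Filter.Eventually.of_forall fun y => (tcoord_self a _).symm
  -- The `Q` component of the lift of `ν` is zero, so only the derivative along `X` of the `Q`
  -- component of the lift of `u` is left. It lies in `V a` because that component takes values in
  -- the fixed subspace `V a`.
  refine ⟨-tangentDeriv τ.X a (fun y => R.liftQ hV u a y) x (R.liftVert hpr hV ν a x),
    neg_mem (tangentDeriv_mem (V a) hq1 (fun y => R.liftQ_mem hV u a y) _), e4.trans ?_⟩
  refine congrArg (fun w : P.Q.model × τ.X.model => (mfderiv (P.Q.I.prod τ.X.I) R.tower.X.I R.qX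
    (a, x) w : R.tower.X.model)) (Prod.ext ?_ ?_)
  · refine (congrArg₂ (fun s t : P.Q.model => s - t) d1 d3).trans ?_
    have h1 : (fun b => tcoord P.Q a b 0) = fun _ => (0 : P.Q.model) := funext fun b => map_zero _
    let m1 : P.Q.model := mvfderiv P.Q.I (fun b => tcoord P.Q a b 0) a (R.liftQ hV u a x)
    let m2 : P.Q.model := mvfderiv τ.X.I (F := P.Q.model) (fun _ => 0) x (R.liftX hV u a x)
    let m3 : P.Q.model := mvfderiv P.Q.I (fun b => tcoord P.Q a b (R.liftQ hV u b x)) a 0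
    let m4 : P.Q.model := mvfderiv τ.X.I (F := P.Q.model) (fun y => R.liftQ hV u a y) x
      (R.liftVert hpr hV ν a x)
    change m1 + m2 - (m3 + m4) = -m4
    have e1 : m1 = 0 := by
      simp only [m1]
      rw [h1, mvfderiv_const]
      rfl
    have e2 : m2 = 0 := by
      simp only [m2]
      rw [mvfderiv_const]
      rfl
    have e3 : m3 = 0 := map_zero _
    rw [e1, e2, e3]
    abel
  · refine (congrArg₂ (fun s t : τ.X.model => s - t) d2 d4).trans ?_
    let m1 : τ.X.model := tangentDeriv P.Q x (fun b => (R.liftVert hpr hV ν b x : τ.X.T x)) a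
      (R.liftQ hV u a x)
    let m2 : τ.X.model := mvfderiv τ.X.I
      (fun y => tcoord τ.X x y (R.liftVert hpr hV ν a y : τ.X.T y)) x (R.liftX hV u a x)
    let m3 : τ.X.model := mvfderiv P.Q.I (F := τ.X.model) (fun b => R.liftX hV u b x) a 0
    let m4 : τ.X.model := mvfderiv τ.X.I (fun y => tcoord τ.X x y (R.liftX hV u a y)) x
      (R.liftVert hpr hV ν a x)
    refine Eq.trans (b := m1 + (m2 - m4)) ?_
      (congrArg (fun t : τ.X.model => m1 + t) eb').symm
    change m1 + m2 - (m3 + m4) = m1 + (m2 - m4)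
    have e3 : m3 = 0 := map_zero _
    rw [e3]
    abel

end PrincipalBundle.AssociatedTower

end

/-! ### The terms of the Koszul formula on `X_Q`, computed upstairs -/

noncomputable section

namespace PrincipalBundle.AssociatedTower

variable {EG : Type*} [NormedAddCommGroup EG] [NormedSpace ℝ EG]
  {G : Type*} [TopologicalSpace G] [ChartedSpace EG G] [Group G] [LieGroup 𝓘(ℝ, EG) ∞ G]
  {P : PrincipalBundle.{u} (EG := EG) G} {V : ∀ q : P.Q, Submodule ℝ (P.Q.T q)}
  {τ : Tower.{u}} [MulAction G τ.X] [MulAction G τ.S] {α : TowerAction (EG := EG) G τ}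
  {R : P.AssociatedTower α} [ContMDiffSMul 𝓘(ℝ, EG) τ.X.I ∞ G τ.X]
  [ContMDiffSMul 𝓘(ℝ, EG) τ.S.I ∞ G τ.S] {𝒟 : GeometricData τ} {𝒟Q : GeometricData R.tower}

section Lift

variable (hpr : ContMDiff τ.X.I τ.S.I ∞ τ.pr) (hV : P.IsConnection V)

theorem liftX_smoothOn {u : ∀ z, R.tower.X.T z} (hu : SmoothFieldOn R.tower.X u univ) (a : P.Q) :
    SmoothFieldOn τ.X (R.liftX hV u a) univ :=
  smoothFieldOn_univ.2 fun _ => R.liftX_smooth hV (smoothFieldOn_univ.1 hu _)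

theorem liftVert_smoothOn {ν : VertField R.tower.pr} (hν : ν.SmoothOn univ) (a : P.Q) :
    (R.liftVert hpr hV ν a).SmoothOn univ :=
  smoothFieldOn_univ.2 fun _ => R.liftVert_smoothField hpr hV (smoothFieldOn_univ.1 hν _)

theorem mdifferentiableAt_liftVert {ν : VertField R.tower.pr} (hν : ν.SmoothOn univ) (a : P.Q)
    (x : τ.X) : MDifferentiableAt P.Q.I 𝓘(ℝ, τ.X.model) (M' := τ.X.model)
      (fun b => (R.liftVert hpr hV ν b x : τ.X.T x)) a := by
  have h1 := ContMDiffAt.comp (f := fun b : P.Q => (b, x)) a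
    (along_coord (R.liftVert_smooth hpr hV (p := (a, x)) (smoothFieldOn_univ.1 hν _)))
    (contMDiffAt_id.prodMk contMDiffAt_const)
  refine MDifferentiableAt.congr_of_eventuallyEq (h1.mdifferentiableAt (by simp)) ?_
  exact Filter.Eventually.of_forall fun y => (tcoord_self x _).symm

/-- The derivative along `Q` of the lift of a smooth vertical field, as a vertical vector. -/
def vertDeriv {ν : VertField R.tower.pr} (hν : ν.SmoothOn univ) (a : P.Q) (x : τ.X)
    (v : P.Q.T a) : vert τ.pr x :=
  ⟨tangentDeriv P.Q x (fun b => (R.liftVert hpr hV ν b x : τ.X.T x)) a v,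
    tangentDeriv_mem (vert τ.pr x) (mdifferentiableAt_liftVert hpr hV hν a x)
      (fun b => (R.liftVert hpr hV ν b x).2) v⟩

theorem vertDeriv_zero {ν : VertField R.tower.pr} (hν : ν.SmoothOn univ) (a : P.Q) (x : τ.X) :
    vertDeriv hpr hV hν a x 0 = 0 :=
  Subtype.ext (map_zero (mvfderiv P.Q.I (F := τ.X.model)
    (fun b => (R.liftVert hpr hV ν b x : τ.X.T x)) a))

theorem lift_coe (ν : VertField R.tower.pr) (a : P.Q) (x : τ.X) :
    R.liftQ hV (fun z => (ν z : R.tower.X.T z)) a x = 0 ∧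
      R.liftX hV (fun z => (ν z : R.tower.X.T z)) a x = R.liftVert hpr hV ν a x :=
  let h := R.eq_lift hV (u := fun z => (ν z : R.tower.X.T z)) (V a).zero_mem
    (R.push_liftVert hpr hV ν a x)
  ⟨h.1.symm, h.2.symm⟩

end Lift

namespace IsInduced

variable (hI : R.IsInduced V 𝒟 𝒟Q) (hpr : ContMDiff τ.X.I τ.S.I ∞ τ.pr) (hV : P.IsConnection V)
include hI

theorem metric_apply (ν μ : VertField R.tower.pr) (a : P.Q) (x : τ.X) :
    𝒟Q.g (R.qX (a, x)) (ν (R.qX (a, x))) (μ (R.qX (a, x))) =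
      𝒟.g x (R.liftVert hpr hV ν a x) (R.liftVert hpr hV μ a x) :=
  hI.metric a x _ _ _ _ (R.push_liftVert hpr hV ν a x).symm (R.push_liftVert hpr hV μ a x).symm

theorem liftVert_vertProj (hH : IsHorizontal τ.pr 𝒟.H) (hHQ : IsHorizontal R.tower.pr 𝒟Q.H)
    (u : ∀ z, R.tower.X.T z) :
    R.liftVert hpr hV (fun z => vertProj hHQ z (u z)) =
      fun a x => vertProj hH x (R.liftX hV u a x) := by
  refine (R.eq_liftVert hpr hV fun a x => ?_).symm
  rw [← hI.vertProj_push hH hpr hHQ (R.liftQ_mem hV u a x)]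
  exact congrArg (fun w => (vertProj hHQ (R.qX (a, x)) w : R.tower.X.T (R.qX (a, x))))
    (R.push_lift hV u a x)

/-- Upstairs the function is the metric of `X` applied to the lifts. In the direction of `Q` the
base point `x`, and with it the bilinear form, is fixed, whence two product-rule terms; in the
direction of `X` the derivative is left as it is. -/
theorem mvfderiv_metric_push (h𝒟 : 𝒟.IsGeometricFamily) {ν μ : VertField R.tower.pr}
    (hν : ν.SmoothOn univ) (hμ : μ.SmoothOn univ) (a : P.Q) (x : τ.X) (v : P.Q.T a)
    (w : τ.X.T x) :
    mvfderiv R.tower.X.I (fun z => 𝒟Q.g z (ν z) (μ z)) (R.qX (a, x)) (P.push R.qX a x v w) =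
      𝒟.g x (vertDeriv hpr hV hν a x v) (R.liftVert hpr hV μ a x) +
      𝒟.g x (R.liftVert hpr hV ν a x) (vertDeriv hpr hV hμ a x v) +
      mvfderiv τ.X.I (fun y => 𝒟.g y (R.liftVert hpr hV ν a y) (R.liftVert hpr hV μ a y)) x w := by
  have hQ := hI.isGeometricFamily hV h𝒟
  have h1 := (hQ.metric_along (J := R.tower.X.I) (b := id) (smoothFieldOn_univ.1 hν (R.qX (a, x)))
    (smoothFieldOn_univ.1 hμ (R.qX (a, x)))).mdifferentiableAt (by simp)
  have h2 := h𝒟.metric_along (R.liftVert_smooth hpr hV (p := (a, x)) (smoothFieldOn_univ.1 hν _))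
    (R.liftVert_smooth hpr hV (p := (a, x)) (smoothFieldOn_univ.1 hμ _))
  have h3 := (mvfderiv_comp_apply h1 (R.assocX.smooth.mdifferentiableAt (by simp))
    ((v, w) : P.Q.model × τ.X.model)).symm
  refine h3.trans ?_
  have h4 : (fun p => 𝒟Q.g (R.qX p) (ν (R.qX p)) (μ (R.qX p))) =
      fun p : P.Q × τ.X => 𝒟.g p.2 (R.liftVert hpr hV ν p.1 p.2) (R.liftVert hpr hV μ p.1 p.2) :=
    funext fun p => hI.metric_apply hpr hV ν μ p.1 p.2
  refine (congrArg (fun f : P.Q × τ.X → ℝ => mvfderiv (P.Q.I.prod τ.X.I) f (a, x)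
    ((v, w) : P.Q.model × τ.X.model)) h4).trans ?_
  refine (mvfderiv_prod (h2.mdifferentiableAt (by simp)) v w).trans ?_
  congr 1
  have hh := h𝒟.distribution.horizontal
  -- The metric at `x`, extended to all of `T_x X` by the vertical projection, becomes a bilinear
  -- form on a fixed normed space.
  let B : τ.X.model →ₗ[ℝ] τ.X.model →ₗ[ℝ] ℝ :=
    (𝒟.g x).compl₁₂ (vertProj hh x) (vertProj hh x)
  let B' : τ.X.model →L[ℝ] τ.X.model →L[ℝ] ℝ :=
    LinearMap.toContinuousLinearMap ((LinearMap.toContinuousLinearMap.toLinearMap).comp B)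
  have hB : ∀ s t : vert τ.pr x, B' (s : τ.X.T x) (t : τ.X.T x) = 𝒟.g x s t := fun s t => by
    change 𝒟.g x (vertProj hh x s) (vertProj hh x t) = _
    rw [vertProj_coe, vertProj_coe]
  have h5 := mvfderiv_bilinear B' (mdifferentiableAt_liftVert hpr hV hν a x)
    (mdifferentiableAt_liftVert hpr hV hμ a x) v
  have h6 : (fun b => B' (R.liftVert hpr hV ν b x : τ.X.T x) (R.liftVert hpr hV μ b x : τ.X.T x)) =
    fun b => 𝒟.g x (R.liftVert hpr hV ν b x) (R.liftVert hpr hV μ b x) := funext fun b => hB _ _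
  refine (congrArg (fun f : P.Q → ℝ => mvfderiv P.Q.I f a v) h6).symm.trans (h5.trans ?_)
  exact congrArg₂ (fun s t : ℝ => s + t)
    (hB (vertDeriv hpr hV hν a x v) (R.liftVert hpr hV μ a x))
    (hB (R.liftVert hpr hV ν a x) (vertDeriv hpr hV hμ a x v))

/-- The vertical projection discards the unknown vector of `V a` in `mlieBracket_push`, and it fixes
the derivative along `Q`, which is already vertical. -/
theorem metric_mlieBracket (hH : IsHorizontal τ.pr 𝒟.H) (hHQ : IsHorizontal R.tower.pr 𝒟Q.H)
    {u : ∀ z, R.tower.X.T z} {ν : VertField R.tower.pr} (hu : SmoothFieldOn R.tower.X u univ)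
    (hν : ν.SmoothOn univ) (μ : VertField R.tower.pr) (a : P.Q) (x : τ.X) :
    𝒟Q.g (R.qX (a, x)) (vertProj hHQ (R.qX (a, x)) (VectorField.mlieBracket R.tower.X.I u
        (fun z => (ν z : R.tower.X.T z)) (R.qX (a, x)))) (μ (R.qX (a, x))) =
      𝒟.g x (vertDeriv hpr hV hν a x (R.liftQ hV u a x)) (R.liftVert hpr hV μ a x) +
      𝒟.g x (vertProj hH x (VectorField.mlieBracket τ.X.I (R.liftX hV u a)
        (fun y => (R.liftVert hpr hV ν a y : τ.X.T y)) x)) (R.liftVert hpr hV μ a x) := by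
  obtain ⟨ξ, hξ, h⟩ := R.mlieBracket_push hpr hV (smoothFieldOn_univ.1 hu (R.qX (a, x)))
    (smoothFieldOn_univ.1 hν (R.qX (a, x)))
  rw [h]
  rw [← LinearMap.add_apply, ← map_add]
  refine hI.metric a x _ _ _ _ ?_ (R.push_liftVert hpr hV μ a x).symm
  refine (hI.vertProj_push hH hpr hHQ hξ _).trans ?_
  refine congrArg (fun w : vert τ.pr x => P.push R.qX a x 0 (w : τ.X.T x)) ?_
  rw [map_add]
  congr 1
  exact vertProj_coe hH x (vertDeriv hpr hV hν a x (R.liftQ hV u a x))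

end IsInduced

end PrincipalBundle.AssociatedTower

end

/-! ### The vertical connection of the associated family -/

noncomputable section

namespace PrincipalBundle.AssociatedTower

variable {EG : Type*} [NormedAddCommGroup EG] [NormedSpace ℝ EG]
  {G : Type*} [TopologicalSpace G] [ChartedSpace EG G] [Group G] [LieGroup 𝓘(ℝ, EG) ∞ G]
  {P : PrincipalBundle.{u} (EG := EG) G} {V : ∀ q : P.Q, Submodule ℝ (P.Q.T q)}
  {τ : Tower.{u}} [MulAction G τ.X] [MulAction G τ.S] {α : TowerAction (EG := EG) G τ}
  {R : P.AssociatedTower α} [ContMDiffSMul 𝓘(ℝ, EG) τ.X.I ∞ G τ.X]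
  [ContMDiffSMul 𝓘(ℝ, EG) τ.S.I ∞ G τ.S] {𝒟 : GeometricData τ} {𝒟Q : GeometricData R.tower}


variable (hpr : ContMDiff τ.X.I τ.S.I ∞ τ.pr) (hV : P.IsConnection V)

namespace IsInduced

/-- Both Koszul formulas are compared, writing `δ` for the derivative along `Q` of lifts. The
derivative of `g(ν, μ)` along `u` contributes `g(δν, μ) + g(ν, δμ)`, the bracket of `u` and `ν`
contributes `g(δν, μ)`, and the bracket of `u` and `μ` contributes `-g(δμ, ν)`. The other terms
involve only vertical directions, where the `Q` component is zero. The total excess over the formula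
on `X` is `2 g(δν, μ)`. -/
theorem isInducedVertical (hI : R.IsInduced V 𝒟 𝒟Q) (hV : P.IsConnection V)
    (h𝒟 : 𝒟.IsGeometricFamily) (hH : IsHorizontal τ.pr 𝒟.H) (hHQ : IsHorizontal R.tower.pr 𝒟Q.H)
    {N : VertField τ.pr → ∀ x : τ.X, τ.X.T x → vert τ.pr x}
    {NQ : VertField R.tower.pr → ∀ z : R.tower.X, R.tower.X.T z → vert R.tower.pr z}
    (hN : IsVerticalConnection hH 𝒟.g N) (hNQ : IsVerticalConnection hHQ 𝒟Q.g NQ) :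
    R.IsInducedVertical V N NQ := by
  have hpr := h𝒟.bundle.smooth
  have hQ := hI.isGeometricFamily hV h𝒟
  intro ν ν' hν hν' a x v hv w
  obtain rfl := R.eq_liftVert hpr hV hν'
  -- The Koszul formula concerns vector fields, so the tangent vector is extended; by uniqueness of
  -- lifts, the lift at `(a, x)` is `(v, w)`.
  obtain ⟨u, hu, huz⟩ := exists_smoothField (R.qX (a, x)) (P.push R.qX a x v w)
  obtain ⟨hv', hw'⟩ := R.eq_lift hV hv huz.symm
  let δ := vertDeriv hpr hV hν a x v
  have hδ : P.push R.qX a x 0 (δ + N (R.liftVert hpr hV ν a) x w : vert τ.pr x) ∈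
      vert R.tower.pr (R.qX (a, x)) :=
    R.push_mem_vert hpr (δ + N (R.liftVert hpr hV ν a) x w).2
  suffices h : NQ ν (R.qX (a, x)) (P.push R.qX a x v w) = ⟨_, hδ⟩ from congrArg Subtype.val h
  by_contra hne
  have hpos := hQ.g_pos _ _ (sub_ne_zero.2 hne)
  -- The difference of the two sides is extended to a smooth vertical field `μ` and serves as its
  -- own test vector: pairing with it gives zero, contrary to positivity.
  set ζ := NQ ν (R.qX (a, x)) (P.push R.qX a x v w) - ⟨_, hδ⟩ with hζ
  obtain ⟨μ, hμ, hμz⟩ : ∃ μ : VertField R.tower.pr, μ.SmoothOn univ ∧ μ (R.qX (a, x)) = ζ := by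
    obtain ⟨m, hm, hmz⟩ := exists_smoothField (R.qX (a, x)) (ζ : R.tower.X.T (R.qX (a, x)))
    refine ⟨fun z => vertProj hHQ z (m z), hQ.distribution.smooth univ m isOpen_univ hm, ?_⟩
    simp only [hmz]
    exact vertProj_coe hHQ _ ζ
  have hPu : VertField.SmoothOn (fun z => vertProj hHQ z (u z)) univ :=
    hQ.distribution.smooth univ u isOpen_univ hu
  have k1 := hNQ.koszul hHQ hQ.g_symm hQ.bundle.smooth hu hν hμ (R.qX (a, x))
  have k2 := hN.koszul hH h𝒟.g_symm hpr (liftX_smoothOn hV hu a) (liftVert_smoothOn hpr hV hν a)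
    (liftVert_smoothOn hpr hV hμ a) x
  have t1 := hI.mvfderiv_metric_push hpr hV h𝒟 hν hμ a x v w
  -- Here and in `t3` the direction is vertical, so its `Q` component is `0` and no derivative along
  -- `Q` will remain.
  have t2 := hI.mvfderiv_metric_push hpr hV h𝒟 hPu hμ a x 0 (R.liftVert hpr hV ν a x)
  have t3 := hI.mvfderiv_metric_push hpr hV h𝒟 hPu hν a x 0 (R.liftVert hpr hV μ a x)
  have t4 := hI.metric_mlieBracket hpr hV hH hHQ hu hν μ a x
  have t5 := hI.metric_mlieBracket hpr hV hH hHQ hu hμ ν a x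
  have t6 := hI.metric_mlieBracket hpr hV hH hHQ hν hμ (fun z => vertProj hHQ z (u z)) a x
  have t7 : 𝒟Q.g (R.qX (a, x)) ⟨_, hδ⟩ (μ (R.qX (a, x))) =
      𝒟.g x (δ + N (R.liftVert hpr hV ν a) x w) (R.liftVert hpr hV μ a x) :=
    hI.metric a x _ _ _ _ rfl (R.push_liftVert hpr hV μ a x).symm
  rw [R.push_liftVert hpr hV] at t2 t3
  rw [hI.liftVert_vertProj hpr hV hH hHQ] at t2 t3 t6
  rw [(lift_coe hpr hV ν a x).1] at t6
  have e1 : R.liftX hV (fun z => (ν z : R.tower.X.T z)) a =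
      fun y => (R.liftVert hpr hV ν a y : τ.X.T y) := funext fun y => (lift_coe hpr hV ν a y).2
  rw [e1] at t6
  rw [← hv'] at t4 t5
  rw [vertDeriv_zero, map_zero] at t2 t3 t6
  rw [vertDeriv_zero, map_zero] at t2 t3
  simp only [LinearMap.zero_apply, zero_add] at t2 t3 t6
  rw [t4, t5, t6, t2, t3, huz, t1] at k1
  rw [← hw'] at k1 k2
  rw [map_add, LinearMap.add_apply] at t7
  simp only [δ] at t7
  have k3 : 𝒟.g x (R.liftVert hpr hV ν a x) (vertDeriv hpr hV hμ a x v) =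
    𝒟.g x (vertDeriv hpr hV hμ a x v) (R.liftVert hpr hV ν a x) := h𝒟.g_symm _ _ _
  have k4 : 𝒟Q.g (R.qX (a, x)) ζ (μ (R.qX (a, x))) = 0 := by
    rw [hζ, map_sub, LinearMap.sub_apply, t7]
    linarith
  rw [hμz] at k4
  exact hpos.ne' k4

end IsInduced

end PrincipalBundle.AssociatedTower

end

/-! ### The Clifford property and the conclusion -/

noncomputable section

namespace PrincipalBundle.AssociatedTower

variable {EG : Type*} [NormedAddCommGroup EG] [NormedSpace ℝ EG]
  {G : Type*} [TopologicalSpace G] [ChartedSpace EG G] [Group G] [LieGroup 𝓘(ℝ, EG) ∞ G]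
  {P : PrincipalBundle.{u} (EG := EG) G} {V : ∀ q : P.Q, Submodule ℝ (P.Q.T q)}
  {τ : Tower.{u}} [MulAction G τ.X] [MulAction G τ.S] {α : TowerAction (EG := EG) G τ}
  {R : P.AssociatedTower α} [ContMDiffSMul 𝓘(ℝ, EG) τ.X.I ∞ G τ.X]
  [ContMDiffSMul 𝓘(ℝ, EG) τ.S.I ∞ G τ.S] {𝒟 : GeometricData τ} {𝒟Q : GeometricData R.tower}



namespace IsInduced

/-- The product rule for the Clifford product of maps into fixed fibres. -/
theorem fiberDeriv_cmul {ν : VertField R.tower.pr} (hν : ν.SmoothOn univ)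
    (hpr : ContMDiff τ.X.I τ.S.I ∞ τ.pr) (hV : P.IsConnection V) (hH : IsHorizontal τ.pr 𝒟.H)
    {a : P.Q} {x : τ.X} {s : P.Q → τ.E.fib x} (hs : τ.E.FiberDifferentiableAt P.Q x s a)
    (v : P.Q.T a) :
    τ.E.fiberDeriv P.Q x (fun b => 𝒟.cmul x (R.liftVert hpr hV ν b x) (s b)) a v =
      𝒟.cmul x (vertDeriv hpr hV hν a x v) (s a) +
        𝒟.cmul x (R.liftVert hpr hV ν a x) (τ.E.fiberDeriv P.Q x s a v) := by
  let B : τ.X.model →ₗ[ℝ] τ.E.F →ₗ[ℝ] τ.E.F :=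
    ((𝒟.cmulₗ x).compl₁₂ (vertProj hH x) (coordSymm τ.E.F τ.E.fib x x).toLinearMap).compr₂
      (coordAt τ.E.F τ.E.fib x x).toLinearMap
  let B' : τ.X.model →L[ℝ] τ.E.F →L[ℝ] τ.E.F :=
    LinearMap.toContinuousLinearMap ((LinearMap.toContinuousLinearMap.toLinearMap).comp B)
  have hB : ∀ (t : vert τ.pr x) (e : τ.E.fib x), B' (t : τ.X.T x) (coordAt τ.E.F τ.E.fib x x e) =
      coordAt τ.E.F τ.E.fib x x (𝒟.cmul x t e) := fun t e => by
    change coordAt τ.E.F τ.E.fib x x (𝒟.cmul x (vertProj hH x t)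
      (coordSymm τ.E.F τ.E.fib x x (coordAt τ.E.F τ.E.fib x x e))) = _
    rw [vertProj_coe, coordSymm_coordAt (mem_baseSet_trivializationAt _ _ x)]
  apply ComplexBundle.coordAt_self_injective x
  rw [map_add, ComplexBundle.coordAt_fiberDeriv, ← hB, ← hB, ComplexBundle.coordAt_fiberDeriv]
  refine Eq.trans ?_ (mvfderiv_bilinear B' (mdifferentiableAt_liftVert hpr hV hν a x) hs v)
  exact congrArg (fun f : P.Q → τ.E.F => mvfderiv P.Q.I f a v) (funext fun b => (hB _ _).symm)

/-- The lift of `ν · σ` is the product of the lifts. Along `Q` the Clifford multiplication of the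
fixed fibre is bilinear and the product rule holds; along `X` the Leibniz rule for `∇^E` applies.
The two derivatives of the lift of `ν` add up to the lift of `NQ ν`. -/
theorem cliffordLeibniz (hI : R.IsInduced V 𝒟 𝒟Q) (hV : P.IsConnection V)
    (h𝒟 : 𝒟.IsGeometricCliffordFamily)
    {N : VertField τ.pr → ∀ x : τ.X, τ.X.T x → vert τ.pr x}
    {NQ : VertField R.tower.pr → ∀ z : R.tower.X, R.tower.X.T z → vert R.tower.pr z}
    (hN : 𝒟.CliffordLeibniz N) (hNQ : R.IsInducedVertical V N NQ) : 𝒟Q.CliffordLeibniz NQ := by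
  have hpr := h𝒟.family.bundle.smooth
  intro ν σ hν hσ z ζ
  obtain ⟨⟨a, x⟩, rfl⟩ := R.assocX.surjective z
  obtain ⟨v, hv, w, rfl⟩ := R.assocX.exists_push hV a x ζ
  have hsm : R.tower.E.SmoothOn (fun z => 𝒟Q.cmul z (ν z) (σ z)) univ :=
    (hI.isGradedCliffordModule hV h𝒟).cmul_smooth univ ν σ isOpen_univ hν hσ
  have h1 : R.liftSection (fun z => 𝒟Q.cmul z (ν z) (σ z)) =
      fun a x => 𝒟.cmul x (R.liftVert hpr hV ν a x) (R.liftSection σ a x) := by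
    funext a x
    exact (R.eq_liftSection (hI.cmul_apply hpr hV ν σ a x).symm).symm
  have h2 := R.fiberDifferentiableAt_liftSection (a := a) (x := x)
    ((contMDiffOn_univ.1 hσ _).mdifferentiableAt (by simp))
  have h3 := hI.clifford a x (vertDeriv hpr hV hν a x v + N (R.liftVert hpr hV ν a) x w)
    (NQ ν (R.qX (a, x)) (P.push R.qX a x v w)) (R.liftSection σ a x)
    (hNQ ν _ hν (R.push_liftVert hpr hV ν) a x v hv w)
  have h4 := hI.clifford a x (R.liftVert hpr hV ν a x) (ν (R.qX (a, x)))
    (R.liftDeriv 𝒟 σ a x v w) (R.push_liftVert hpr hV ν a x).symm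
  rw [R.qE_liftSection] at h3
  rw [hI.nabla_push hsm hv, hI.nabla_push hσ hv, h3, h4, ← map_add]
  refine congrArg (R.qE a x) ?_
  rw [liftDeriv, liftDeriv, h1, hN _ _ (liftVert_smoothOn hpr hV hν a) (R.liftSection_smooth hσ a),
    fiberDeriv_cmul hν hpr hV h𝒟.family.distribution.horizontal h2]
  change 𝒟.cmulₗ x _ _ + 𝒟.cmulₗ x _ _ + (𝒟.cmulₗ x _ _ + 𝒟.cmulₗ x _ _) =
    𝒟.cmulₗ x _ _ + 𝒟.cmulₗ x _ _
  rw [map_add, LinearMap.add_apply, map_add]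
  abel

theorem isGeometricCliffordFamily (hI : R.IsInduced V 𝒟 𝒟Q) (hV : P.IsConnection V)
    (h𝒟 : 𝒟.IsGeometricCliffordFamily) : 𝒟Q.IsGeometricCliffordFamily := by
  have hQ := hI.isGeometricFamily hV h𝒟.family
  obtain ⟨N, hN, hL⟩ := h𝒟.clifford
  obtain ⟨NQ, hNQ⟩ := exists_verticalConnection hQ
  exact ⟨hQ, hI.isGradedCliffordModule hV h𝒟, hI.nabla_smooth h𝒟 hV,
    fun _ hσ => hI.nabla_complex h𝒟 hV hσ, NQ, hNQ,
    hI.cliffordLeibniz hV h𝒟 hL (hI.isInducedVertical hV h𝒟.family _ _ hN hNQ)⟩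

end IsInduced

end PrincipalBundle.AssociatedTower

end

end CliffordFamily

theorem mainTheorem6
    {EG : Type*} [NormedAddCommGroup EG] [NormedSpace ℝ EG] [FiniteDimensional ℝ EG]
    {G : Type*} [TopologicalSpace G] [T2Space G] [SecondCountableTopology G]
    [ChartedSpace EG G] [Group G] [LieGroup 𝓘(ℝ, EG) ∞ G]
    (τ : CliffordFamily.Tower.{u})
    [MulAction G τ.X] [ContMDiffSMul 𝓘(ℝ, EG) τ.X.I ∞ G τ.X]
    [MulAction G τ.S] [ContMDiffSMul 𝓘(ℝ, EG) τ.S.I ∞ G τ.S]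
    (𝒟 : CliffordFamily.GeometricData τ) (h𝒟 : 𝒟.IsGeometricCliffordFamily)
    (α : CliffordFamily.TowerAction (EG := EG) G τ) (hα : α.Preserves 𝒟)
    (P : CliffordFamily.PrincipalBundle.{u} (EG := EG) G)
    (V : ∀ q : P.Q, Submodule ℝ (P.Q.T q)) (hV : P.IsConnection V) :
    Nonempty (P.AssociatedTower α) ∧
    ∀ R : P.AssociatedTower α,
      (∃ 𝒟Q : CliffordFamily.GeometricData R.tower, R.IsInduced V 𝒟 𝒟Q) ∧
      ∀ 𝒟Q : CliffordFamily.GeometricData R.tower, R.IsInduced V 𝒟 𝒟Q →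
        ∃ hQ : 𝒟Q.IsGeometricCliffordFamily,
          (𝒟.PreservesGrading → 𝒟Q.PreservesGrading) ∧
          ∀ N NQ,
            CliffordFamily.IsVerticalConnection h𝒟.family.distribution.horizontal 𝒟.g N →
            CliffordFamily.IsVerticalConnection hQ.family.distribution.horizontal 𝒟Q.g NQ →
              R.IsInducedVertical V N NQ ∧ 𝒟Q.CliffordLeibniz NQ := by
  refine ⟨P.nonempty_associatedTower α, fun R =>
    ⟨R.exists_isInduced h𝒟.family.bundle.smooth hα hV, fun 𝒟Q hI =>
      ⟨hI.isGeometricCliffordFamily hV h𝒟, hI.preservesGrading h𝒟 hV, fun N NQ hN hNQ =>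
        ⟨hI.isInducedVertical hV h𝒟.family _ _ hN hNQ, ?_⟩⟩⟩⟩
  -- The Leibniz rule is known for some vertical connection `N₀`, not for the given `N`. As `NQ` is
  -- induced from every vertical connection of the original family, `N₀` can be used instead.
  obtain ⟨N₀, hN₀, hL⟩ := h𝒟.clifford
  exact hI.cliffordLeibniz hV h𝒟 hL (hI.isInducedVertical hV h𝒟.family _ _ hN₀ hNQ)
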